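/- **Setting.** Let $X_1,\dots,X_n$ be i.i.d. random vectors in $\mathbb R^p$ with the elliptical law of $\mu+r\,\Sigma_0^{1/2}u$, where $u$ is uniformly distributed on the unit sphere $\mathbb S^{p-1}$, $r$ is a real random variable independent of $u$ with $\mathbb E[r^2]=p$, and $\Sigma_0\in\mathbb R^{p\times p}$ is symmetric positive definite. Put $\Lambda_0=\frac{p}{\operatorname{tr}\Sigma_0}\Sigma_0$ and $V_0=(v_{ij})=\Lambda_0^{-1}$. For a matrix $A=(a_{ij})$ let $\|A\|_\infty=\max_{i,j}|a_{ij}|$, $\|A\|_1=\sum_{i,j}|a_{ij}|$, $\|A\|_{L_1}=\max_j\sum_i|a_{ij}|$, let $\|A\|_{\mathrm{op}}$ be the Euclidean operator norm and $\|A\|_F$ the Frobenius norm. Let $U(x)=x/\|x\|_2$ for $x\ne0$, $U(0)=0$, and $S=\mathbb E[U(X_1-\mu)U(X_1-\mu)^\top]$. **Estimator.** Let $\hat\mu$ be a sample spatial median, i.e. a minimizer of $m\mapsto\sum_{i=1}^n\|X_i-m\|_2$, let $\hat S=\frac1n\sum_{i=1}^nU(X_i-\hat\mu)U(X_i-\hat\mu)^\top$,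 and let $\hat V_1=(\hat v^1_{ij})$ be a minimizer of $\|V\|_1$ over all $V\in\mathbb R^{p\times p}$ with $\|p\hat S V-I_p\|_\infty\le\lambda_n$. The estimator $\hat V_{SCLIME}$ is the symmetric matrix whose $(i,j)$ and $(j,i)$ entries are both equal to the one of $\hat v^1_{ij},\hat v^1_{ji}$ that is smaller in absolute value (either one in case of a tie). **Assumptions.** For constants $T>0$, $\eta>0$, $M>0$, $c_0>0$, $\zeta>0$, $\psi>0$, $K_\nu>0$ and for $0\le q<1$, $s_0(p)>0$: 1. $\|V_0\|_{L_1}\le T$ and $\max_i\sum_j|v_{ij}|^q\le s_0(p)$ (with $0^0=0$); 2. all eigenvalues of $\Sigma_0$ lie in $(\eta,1/\eta)$, $\|\Sigma_0\|_\infty<M$, and $c_0p\le\operatorname{tr}(\Sigma_0)\le p/c_0$; 3. with $\xi=\|X_1-\mu\|_2$ and $\zeta_k=\mathbb E[\xi^{-k}]$: $\zeta_k\zeta_1^{-k}<\zeta$ for $k=1,2,3,4$ (all these moments being finite); $\|S\|_{\mathrm{op}}<1-\psi$; and $\nu=\zeta_1^{-1}\xi^{-1}$ satisfies $\|\nu\|_{\psi_2}:=\sup_{k\ge1}k^{-1/2}(\mathbb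 E|\nu|^k)^{1/k}\le K_\nu$, the supremum being over integers $k$. **Theorem.** There are constants $C'=C_{c_0,\eta,T,M}>0$, depending only on $c_0,\eta,T,M$, and $C>0$, depending only on $\zeta,\psi,K_\nu$, such that the following holds for all $n$ and $p$ that are sufficiently large (beyond thresholds depending only on $c_0,\eta,T,M,\zeta,\psi,K_\nu$) and satisfy $n>(3\log p)^{1/3}$. Put $$R_{n,p}=\frac{\sqrt2\,C\,(8+\eta^2C')}{\eta^2}\sqrt{\frac{\log p}{n}}+\frac{C'}{\sqrt p},\qquad \lambda_n=T\,R_{n,p}.$$ Then there is an event of probability larger than $1-2p^{-2}$ on which the estimator exists and every choice of it satisfies $$\|\hat V_{SCLIME}-V_0\|_\infty\le4T^2R_{n,p},$$ $$\|\hat V_{SCLIME}-V_0\|_{\mathrm{op}}\le\|\hat V_{SCLIME}-V_0\|_{L_1}\le C_4\,R_{n,p}^{\,1-q}\,s_0(p),$$ $$\frac1p\|\hat V_{SCLIME}-V_0\|_F^2\le C_5\,R_{n,p}^{\,2-q}\,s_0(p),$$ where $C_4=(1+2^{1-q}+3^{1-q})(4T^2)^{1-q}$ and $C_5=4T^2C_4$.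 -/

import Mathlib

open MeasureTheory ProbabilityTheory
open scoped Matrix MatrixOrder ENNReal

noncomputable section

namespace SCLIME

/-- Euclidean space of dimension `p`. -/
abbrev Vec (p : ℕ) := EuclideanSpace ℝ (Fin p)

/-- Real `p × p` matrices. -/
abbrev Mat (p : ℕ) := Matrix (Fin p) (Fin p) ℝ

/-! ### Matrix norms -/

/-- Elementwise maximum norm. -/
def maxNorm {p : ℕ} (A : Mat p) : ℝ := ⨆ i, ⨆ j, |A i j|

/-- Operator norm with respect to the Euclidean norm. -/
def opNorm {p : ℕ} (A : Mat p) : ℝ := ‖Matrix.toEuclideanCLM (n := Fin p) (𝕜 := ℝ) A‖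

/-- Matrix `L₁` norm: the maximal absolute column sum. -/
def matL1 {p : ℕ} (A : Mat p) : ℝ := ⨆ j, ∑ i, |A i j|

/-- Frobenius norm. -/
def frobNorm {p : ℕ} (A : Mat p) : ℝ := Real.sqrt (∑ i, ∑ j, A i j ^ 2)

/-- Elementwise `ℓ₁` norm. -/
def elemL1 {p : ℕ} (A : Mat p) : ℝ := ∑ i, ∑ j, |A i j|

/-! ### The elliptical model -/

/-- The uniform probability law on the unit sphere: the normalized surface measure. -/
def uniformSphere (p : ℕ) : Measure (Metric.sphere (0 : Vec p) 1) :=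
  ((volume : Measure (Vec p)).toSphere Set.univ)⁻¹ • (volume : Measure (Vec p)).toSphere

/-- The law `EC_p(μ, Σ, r)` of `μ + r Σ^{1/2} u`, where `r` has law `ρ`, `u` is uniform on the
unit sphere, and `r`, `u` are independent. -/
def ellipticalLaw {p : ℕ} (μ : Vec p) (Sig : Mat p) (ρ : Measure ℝ) : Measure (Vec p) :=
  (ρ.prod (uniformSphere p)).map fun z =>
    μ + z.1 • Matrix.toEuclideanCLM (n := Fin p) (𝕜 := ℝ) (CFC.sqrt Sig) (z.2 : Vec p)

/-- The shape matrix `Λ₀ = (p / tr Σ₀) Σ₀`. -/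
def shape {p : ℕ} (Sig : Mat p) : Mat p := ((p : ℝ) / Sig.trace) • Sig

/-- The precision matrix `V₀ = Λ₀⁻¹`. -/
def precision {p : ℕ} (Sig : Mat p) : Mat p := (shape Sig)⁻¹

/-- The spatial sign `U(x) = x / ‖x‖`, with `U(0) = 0`. -/
def spatialSign {p : ℕ} (x : Vec p) : Vec p := ‖x‖⁻¹ • x

/-- The population spatial-sign covariance matrix `S` of a law `L` with centre `μ`. -/
def popSSCM {p : ℕ} (L : Measure (Vec p)) (μ : Vec p) : Mat p :=
  Matrix.of fun i j => ∫ x, spatialSign (x - μ) i * spatialSign (x - μ) j ∂L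

/-- `ζ_k = E ‖X - μ‖₂^{-k}`, with values in `[0, ∞]`. -/
def zetaMom {p : ℕ} (L : Measure (Vec p)) (μ : Vec p) (k : ℕ) : ℝ≥0∞ :=
  ∫⁻ x, (‖x - μ‖ₑ⁻¹) ^ k ∂L

/-- The standardized inverse radius `ν = ζ₁⁻¹ ‖X - μ‖₂⁻¹`. -/
def invRadius {p : ℕ} (L : Measure (Vec p)) (μ : Vec p) (x : Vec p) : ℝ :=
  (zetaMom L μ 1).toReal⁻¹ * ‖x - μ‖⁻¹

/-- Sub-Gaussian norm `sup_{k ≥ 1} k^{-1/2} (E|Y|^k)^{1/k}`, with values in `[0, ∞]`. -/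
def psi2Norm {α : Type*} [MeasurableSpace α] (Y : α → ℝ) (P : Measure α) : ℝ≥0∞ :=
  ⨆ k : ℕ, ⨆ _ : 1 ≤ k, ENNReal.ofReal ((k : ℝ) ^ (-(1 / 2) : ℝ)) * eLpNorm Y (k : ℝ≥0∞) P

/-! ### Assumptions on the model -/

/-- `|x|^q`, with the convention `0^0 = 0` (so that `q = 0` counts nonzero entries). -/
def absPow (q x : ℝ) : ℝ := if x = 0 then 0 else |x| ^ q

/-- Bounded matrix `L₁` norm and `ℓ_q`-sparsity of the rows. -/
structure SparseCond {p : ℕ} (T q s₀ : ℝ) (V₀ : Mat p) : Prop where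
  l1_le : matL1 V₀ ≤ T
  sparse : ∀ i, ∑ j, absPow q (V₀ i j) ≤ s₀

/-- `Σ₀` is positive definite, with eigenvalues in `(η, 1/η)`, entries bounded by `M` and trace
of order `p`. -/
structure CovCond {p : ℕ} (c₀ η M : ℝ) (Sig : Mat p) : Prop where
  posDef : Sig.PosDef
  eig : ∀ i, η < posDef.isHermitian.eigenvalues i ∧ posDef.isHermitian.eigenvalues i < 1 / η
  bounded : maxNorm Sig < M
  trace_ge : c₀ * p ≤ Sig.trace
  trace_le : Sig.trace ≤ 1 / c₀ * p

/-- The conditions on the inverse radius and on the spatial-sign covariance matrix. -/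
structure RadiusCond {p : ℕ} (ζ ψ K : ℝ) (L : Measure (Vec p)) (μ : Vec p) : Prop where
  moments : ∀ k ∈ Finset.Icc 1 4, zetaMom L μ k < ENNReal.ofReal ζ * zetaMom L μ 1 ^ k
  op_lt : opNorm (popSSCM L μ) < 1 - ψ
  subGaussian : psi2Norm (invRadius L μ) L ≤ ENNReal.ofReal K

/-- `r` is a real random variable (with law `ρ`) such that `E r² = p`. -/
structure RadialLaw (p : ℕ) (ρ : Measure ℝ) : Prop where
  prob : IsProbabilityMeasure ρ
  sq_integrable : Integrable (fun r : ℝ => r ^ 2) ρ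
  second_moment : ∫ r, r ^ 2 ∂ρ = p

/-! ### The estimator -/

/-- `m` is a sample spatial median of `x₁, …, xₙ`. -/
def IsSpatialMedian {n p : ℕ} (x : Fin n → Vec p) (m : Vec p) : Prop :=
  ∀ m' : Vec p, ∑ i, ‖x i - m‖ ≤ ∑ i, ‖x i - m'‖

/-- The sample spatial-sign covariance matrix with centre `m`. -/
def sampleSSCM {n p : ℕ} (x : Fin n → Vec p) (m : Vec p) : Mat p :=
  Matrix.of fun j k => (1 / (n : ℝ)) * ∑ i, spatialSign (x i - m) j * spatialSign (x i - m) k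

/-- The constraint `‖p Ŝ V - I‖_∞ ≤ lam`. -/
def Feasible {p : ℕ} (S : Mat p) (lam : ℝ) (V : Mat p) : Prop :=
  maxNorm ((p : ℝ) • (S * V) - 1) ≤ lam

/-- `V` solves `min ‖V‖₁` subject to `‖p Ŝ V - I‖_∞ ≤ lam`. -/
def IsSolution {p : ℕ} (S : Mat p) (lam : ℝ) (V : Mat p) : Prop :=
  Feasible S lam V ∧ ∀ W, Feasible S lam W → elemL1 V ≤ elemL1 W

/-- `V` is the symmetrization of `V₁`: of the entries `(i,j)` and `(j,i)` of `V₁`, the one that is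
smaller in absolute value is kept (if `|V₁ i j| = |V₁ j i|`, either of them). -/
def IsSymmetrization {p : ℕ} (V₁ V : Mat p) : Prop :=
  V.IsSymm ∧ ∀ i j, (V i j = V₁ i j ∧ |V₁ i j| ≤ |V₁ j i|) ∨ (V i j = V₁ j i ∧ |V₁ j i| ≤ |V₁ i j|)

/-- `V` is an SCLIME estimate computed from the sample `x` with tuning parameter `lam`. -/
def IsSCLIME {n p : ℕ} (x : Fin n → Vec p) (lam : ℝ) (V : Mat p) : Prop :=
  ∃ m V₁, IsSpatialMedian x m ∧ IsSolution (sampleSSCM x m) lam V₁ ∧ IsSymmetrization V₁ V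

/-! ### The rate -/

/-- `√2 C (8 + η² C') / η² · √(log p / n) + C' / √p`. -/
def rate (C C' η : ℝ) (n p : ℕ) : ℝ :=
  Real.sqrt 2 * C * (8 + η ^ 2 * C') / η ^ 2 * Real.sqrt (Real.log p / n) + C' / Real.sqrt p

/-- `(1 + 2^{1-q} + 3^{1-q}) (4 T²)^{1-q}`. -/
def const4 (T q : ℝ) : ℝ :=
  (1 + (2 : ℝ) ^ (1 - q) + (3 : ℝ) ^ (1 - q)) * (4 * T ^ 2) ^ (1 - q)

/-- `4 T² C₄`. -/
def const5 (T q : ℝ) : ℝ := 4 * T ^ 2 * const4 T q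

/-- The asserted error bounds for an estimate `V` of `V₀`, with `R` the rate. -/
structure ErrorBounds {p : ℕ} (T q s₀ R : ℝ) (V V₀ : Mat p) : Prop where
  max_le : maxNorm (V - V₀) ≤ 4 * T ^ 2 * R
  op_le : opNorm (V - V₀) ≤ matL1 (V - V₀)
  l1_le : matL1 (V - V₀) ≤ const4 T q * R ^ (1 - q) * s₀
  frob_le : 1 / (p : ℝ) * frobNorm (V - V₀) ^ 2 ≤ const5 T q * R ^ (2 - q) * s₀

end SCLIME

end

noncomputable section

namespace SCLIME

/-! ### Elementary facts on the matrix norms -/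

/-! Everything reduces to one entrywise estimate: whichever sample spatial median is used, `p Ŝ` is
within `R` of the shape matrix `Λ₀`. Then `V₀` is feasible at level `T R`, so every column of a
minimizer `V₁` has ℓ₁ norm at most that of the same column of `V₀`. The identity `V₁ - V₀ = V₀ (Λ₀
V₁ - 1)` bounds the maximum norm, and ℓ_q sparsity turns this into the bounds in the other norms
(`sclime_bounds`).

The error `p Ŝ - Λ₀` has three sources.

Bias: `p S` and `Λ₀` are averages over the sphere of the same quadratic expression, divided by
`‖Σ^{1/2} u‖²` and by its mean `tr Σ / p` respectively. That squared norm has variance of order `1 /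
p`, so the bias is of order `1 / √p` (`abs_popSSCM_sub_shape_le`).

Sampling with known centre: projections of the signs are sub-Gaussian at scale `1 / √p`, by
comparison of the sphere with a Gaussian vector (`integral_exp_inner_sq`). Products of coordinates
are then sub-exponential and Bernstein's inequality applies.

Estimated centre: put `a_i = U(X_i - μ)`, let `ν_i` be the standardized inverse radius and `z = ζ₁
(m - μ)`. Then `X_i - m` is a positive multiple of `a_i - ν_i z`, and `z` minimizes a weighted sum
of the norms of these vectors. Quantitative convexity bounds `‖z‖`, and the estimating equation
bounds each coordinate of `z`. The danger is a large `ν_i`, which may bring `a_i - ν_i z` close to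
zero. If `n ≥ 16 log²(np) log p`, all `ν_i ‖z‖` are at most `1/2` and a first-order expansion
suffices (`exists_centre_bound_of_small_radius`). Otherwise `n ≤ 64 log³ p`, so that the few signs
are nearly orthogonal. The subgradient condition then keeps the median away from the sample points,
and each `⟨a_k, z⟩` is of order `1 / n` (`exists_centre_bound_of_orthogonal`). Both regimes meet in
`exists_bound_of_goodSample`.

The resulting constant depends jointly on `η` and `K`, whereas `C'` may not depend on `K` nor `C` on
`η`. The rate dominates the product `C C'` times `√(log p / n)`, so it is enough to majorize a
function of two parameters by a product after rounding both to integer levels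
(`exists_product_majorant`). The concentration argument needs `log p ≤ δ n`. If this fails, the
constants force `T R ≥ 1`; the zero matrix is then feasible, the estimate is zero, and the bounds
hold for every sample. -/

lemma abs_le_maxNorm {p : ℕ} (A : Mat p) (i j : Fin p) : |A i j| ≤ maxNorm A :=
  (le_ciSup (f := fun j => |A i j|) (Set.finite_range _).bddAbove j).trans
    (le_ciSup (f := fun i => ⨆ j, |A i j|) (Set.finite_range _).bddAbove i)

lemma maxNorm_le {p : ℕ} {A : Mat p} {c : ℝ} (hc : 0 ≤ c) (h : ∀ i j, |A i j| ≤ c) :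
    maxNorm A ≤ c :=
  Real.iSup_le (fun i => Real.iSup_le (h i) hc) hc

lemma col_sum_le_matL1 {p : ℕ} (A : Mat p) (j : Fin p) : ∑ i, |A i j| ≤ matL1 A :=
  le_ciSup (f := fun j => ∑ i, |A i j|) (Set.finite_range _).bddAbove j

lemma matL1_le {p : ℕ} {A : Mat p} {c : ℝ} (hc : 0 ≤ c) (h : ∀ j, ∑ i, |A i j| ≤ c) :
    matL1 A ≤ c :=
  Real.iSup_le h hc

lemma matL1_nonneg {p : ℕ} (A : Mat p) : 0 ≤ matL1 A :=
  Real.iSup_nonneg fun _ => Finset.sum_nonneg fun _ _ => abs_nonneg _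

lemma abs_mul_apply_le {p : ℕ} {A B : Mat p} {c d : ℝ} (hc : 0 ≤ c) {i j : Fin p}
    (hA : ∀ k, |A i k| ≤ c) (hB : ∑ k, |B k j| ≤ d) : |(A * B) i j| ≤ c * d := by
  rw [Matrix.mul_apply]
  calc |∑ k, A i k * B k j| ≤ ∑ k, |A i k * B k j| := Finset.abs_sum_le_sum_abs _ _
    _ ≤ ∑ k, c * |B k j| := by
        refine Finset.sum_le_sum fun k _ => ?_
        rw [abs_mul]; exact mul_le_mul_of_nonneg_right (hA k) (abs_nonneg _)
    _ = c * ∑ k, |B k j| := by rw [Finset.mul_sum]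
    _ ≤ c * d := mul_le_mul_of_nonneg_left hB hc

/-- The operator norm of a symmetric matrix is at most its `L₁` norm. -/
lemma opNorm_le_matL1 {p : ℕ} {A : Mat p} (hA : A.IsSymm) : opNorm A ≤ matL1 A := by
  refine ContinuousLinearMap.opNorm_le_bound _ (matL1_nonneg A) fun x => ?_
  have hrow : ∀ i, ∑ j, |A i j| ≤ matL1 A := fun i => by
    simpa only [hA.apply] using col_sum_le_matL1 A i
  refine abs_le_of_sq_le_sq' ?_ (mul_nonneg (matL1_nonneg A) (norm_nonneg _)) |>.2
  rw [mul_pow, EuclideanSpace.norm_sq_eq, EuclideanSpace.norm_sq_eq]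
  calc ∑ i, ‖(Matrix.toEuclideanCLM (n := Fin p) (𝕜 := ℝ) A x) i‖ ^ 2
      = ∑ i, (∑ j, A i j * x j) ^ 2 := by
        refine Finset.sum_congr rfl fun i _ => ?_
        rw [Real.norm_eq_abs, sq_abs]
        simp [Matrix.mulVec, dotProduct]
    _ ≤ ∑ i, (matL1 A * ∑ j, |A i j| * x j ^ 2) := by
        refine Finset.sum_le_sum fun i _ => ?_
        -- Schur's test: Cauchy–Schwarz with weights `|A i j|`, with row sums used here and column
        -- sums after exchanging the summations.
        refine (Finset.sum_sq_le_sum_mul_sum_of_sq_le_mul Finset.univ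
          (f := fun j => |A i j|) (g := fun j => |A i j| * x j ^ 2)
          (fun _ _ => abs_nonneg _) (fun _ _ => by positivity) (fun j _ => le_of_eq ?_)).trans ?_
        · rw [mul_pow, ← mul_assoc, ← sq, sq_abs]
        · exact mul_le_mul_of_nonneg_right (hrow i) (Finset.sum_nonneg fun _ _ => by positivity)
    _ = matL1 A * ∑ j, (∑ i, |A i j|) * x j ^ 2 := by
        rw [← Finset.mul_sum, Finset.sum_comm]
        simp_rw [Finset.sum_mul]
    _ ≤ matL1 A * ∑ j, matL1 A * x j ^ 2 := by
        refine mul_le_mul_of_nonneg_left (Finset.sum_le_sum fun j _ => ?_) (matL1_nonneg A)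
        exact mul_le_mul_of_nonneg_right (col_sum_le_matL1 A j) (sq_nonneg _)
    _ = matL1 A ^ 2 * ∑ i, ‖x i‖ ^ 2 := by
        rw [← Finset.mul_sum]; simp only [Real.norm_eq_abs, sq_abs]; ring

/-! ### Existence of the estimator -/

/-- The objective is continuous and, already because of its first summand, coercive. -/
lemma exists_isSpatialMedian {n p : ℕ} (hn : 0 < n) (x : Fin n → Vec p) :
    ∃ m, IsSpatialMedian x m := by
  have hc : Continuous fun m : Vec p => ∑ i, ‖x i - m‖ := by fun_prop
  refine hc.exists_forall_le (Filter.tendsto_atTop_mono' _ (Filter.Eventually.of_forall fun m => ?_)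
    (Filter.tendsto_atTop_add_const_right _ (-‖x ⟨0, hn⟩‖) (tendsto_norm_cocompact_atTop (E := Vec p))))
  have h1 : ‖x ⟨0, hn⟩ - m‖ ≤ ∑ i, ‖x i - m‖ :=
    Finset.single_le_sum (f := fun i => ‖x i - m‖) (fun _ _ => norm_nonneg _) (Finset.mem_univ _)
  have h2 := norm_sub_norm_le m (x ⟨0, hn⟩)
  rw [norm_sub_rev] at h2
  linarith

lemma abs_le_elemL1 {p : ℕ} (A : Mat p) (i j : Fin p) : |A i j| ≤ elemL1 A :=
  (Finset.single_le_sum (f := fun j => |A i j|) (fun _ _ => abs_nonneg _) (Finset.mem_univ j)).trans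
    (Finset.single_le_sum (f := fun i => ∑ j, |A i j|)
      (fun _ _ => Finset.sum_nonneg fun _ _ => abs_nonneg _) (Finset.mem_univ i))

/-- A feasible `V₀` confines the search to the compact box of entries bounded by `elemL1 V₀`; any
matrix outside that box has a larger objective. -/
lemma exists_isSolution {p : ℕ} {S V₀ : Mat p} {lam : ℝ} (h : Feasible S lam V₀) :
    ∃ V, IsSolution S lam V := by
  rcases lt_or_ge lam 0 with hl | hl
  · exact absurd (h.trans_lt hl) (not_lt.2 (Real.iSup_nonneg fun _ =>
      Real.iSup_nonneg fun _ => abs_nonneg _))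
  have hfe : ∀ V, Feasible S lam V ↔ ∀ i j, |((p : ℝ) • (S * V) - 1) i j| ≤ lam := fun V =>
    ⟨fun hV i j => (abs_le_maxNorm _ i j).trans hV, fun hV => maxNorm_le hl hV⟩
  let B : Set (Mat p) := Set.pi Set.univ fun _ => Set.pi Set.univ fun _ =>
    Set.Icc (-elemL1 V₀) (elemL1 V₀)
  have hB : IsCompact B := isCompact_univ_pi fun _ => isCompact_univ_pi fun _ => isCompact_Icc
  have hcl : IsClosed {V : Mat p | Feasible S lam V} := by
    simp only [hfe, Set.ofPred_forall]
    refine isClosed_iInter fun i => isClosed_iInter fun j => isClosed_le ?_ continuous_const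
    have : Continuous fun V : Mat p => (p : ℝ) • (S * V) - 1 := by fun_prop
    exact ((continuous_apply j).comp ((continuous_apply i).comp this)).abs
  have hmem : V₀ ∈ B ∩ {V | Feasible S lam V} :=
    ⟨fun i _ j _ => abs_le.1 (abs_le_elemL1 V₀ i j), h⟩
  have hcont : Continuous fun V : Mat p => elemL1 V := by
    unfold elemL1
    refine continuous_finsetSum _ fun i _ => continuous_finsetSum _ fun j _ => ?_
    exact ((continuous_apply j).comp (continuous_apply i)).abs
  obtain ⟨V, hV, hmin⟩ := (hB.inter_right hcl).exists_isMinOn ⟨V₀, hmem⟩ hcont.continuousOn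
  refine ⟨V, hV.2, fun W hW => ?_⟩
  by_cases hWB : W ∈ B
  · exact hmin ⟨hWB, hW⟩
  · refine (hmin hmem).trans ?_
    by_contra hlt
    rw [not_le] at hlt
    exact hWB fun i _ j _ => abs_le.1 ((abs_le_elemL1 W i j).trans hlt.le)

lemma exists_isSymmetrization {p : ℕ} (V₁ : Mat p) : ∃ V, IsSymmetrization V₁ V := by
  classical
  -- On ties the entry above the diagonal is taken for both positions, which makes the choice
  -- symmetric.
  refine ⟨Matrix.of fun i j => if |V₁ i j| < |V₁ j i| then V₁ i j else
    if |V₁ j i| < |V₁ i j| then V₁ j i else V₁ (min i j) (max i j), ?_, fun i j => ?_⟩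
  · ext i j
    simp only [Matrix.transpose_apply, Matrix.of_apply]
    rcases lt_trichotomy |V₁ i j| |V₁ j i| with h | h | h
    · simp [h, h.not_gt]
    · simp [h, min_comm, max_comm]
    · simp [h, h.not_gt]
  · simp only [Matrix.of_apply]
    rcases lt_trichotomy |V₁ i j| |V₁ j i| with h | h | h
    · left; simp [h, h.le]
    · rcases le_total i j with hij | hij
      · left; simp [h, hij]
      · right; simp [h, hij]
    · right; simp [h, h.le, h.not_gt]

/-! ### Deterministic error analysis of the constrained `ℓ₁` problem -/

/-- Each column of a solution has the least `ℓ₁` norm among the columns of feasible matrices. -/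
lemma IsSolution.col_le {p : ℕ} {S V W : Mat p} {lam : ℝ} (hl : 0 ≤ lam)
    (hV : IsSolution S lam V) (hW : Feasible S lam W) (j : Fin p) :
    ∑ i, |V i j| ≤ ∑ i, |W i j| := by
  classical
  let V' : Mat p := V.updateCol j fun i => W i j
  have hmul : ∀ i k, (S * V') i k = if k = j then (S * W) i k else (S * V) i k := by
    intro i k
    rw [Matrix.mul_apply]
    split_ifs with hk
    · subst hk; simp [V', Matrix.mul_apply]
    · simp [V', hk, Matrix.mul_apply, Matrix.updateCol_ne]
  -- The constraint acts on each column separately, so exchanging column `j` of `V` for that of `W`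
  -- preserves feasibility.
  have hfe : Feasible S lam V' := by
    refine maxNorm_le hl fun i k => ?_
    have h1 := (abs_le_maxNorm _ i k).trans hV.1
    have h2 := (abs_le_maxNorm _ i k).trans hW
    simp only [Matrix.sub_apply, Matrix.smul_apply, hmul] at h1 h2 ⊢
    split_ifs <;> assumption
  have h := hV.2 V' hfe
  have hsum : ∀ U : Mat p, elemL1 U = ∑ i, |U i j| + ∑ k ∈ Finset.univ.erase j, ∑ i, |U i k| := by
    intro U
    rw [elemL1, Finset.sum_comm, ← Finset.add_sum_erase _ _ (Finset.mem_univ j)]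
  rw [hsum V, hsum V'] at h
  have h1 : ∑ i, |V' i j| = ∑ i, |W i j| := by simp [V']
  have h2 : ∑ k ∈ Finset.univ.erase j, ∑ i, |V' i k| = ∑ k ∈ Finset.univ.erase j, ∑ i, |V i k| := by
    refine Finset.sum_congr rfl fun k hk => ?_
    simp [V', Matrix.updateCol_ne (Finset.ne_of_mem_erase hk)]
  linarith

/-- Split the minimum as its powers `1 - q` and `q`, bounding the first factor by `t` and the second
by `|x|`. This is how sparsity enters. -/
lemma min_abs_le_rpow_mul_absPow {q t x : ℝ} (hq0 : 0 ≤ q) (hq1 : q < 1) (ht : 0 ≤ t) :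
    min t |x| ≤ t ^ (1 - q) * absPow q x := by
  unfold absPow
  split_ifs with hx
  · simp [hx]
  have hm : 0 ≤ min t |x| := le_min ht (abs_nonneg _)
  calc min t |x| = min t |x| ^ (1 - q) * min t |x| ^ q := by
        rcases hm.eq_or_lt with h | h
        · rw [← h, Real.zero_rpow (by linarith), zero_mul]
        · rw [← Real.rpow_add h]; simp
    _ ≤ t ^ (1 - q) * |x| ^ q :=
        mul_le_mul (Real.rpow_le_rpow hm (min_le_left _ _) (by linarith))
          (Real.rpow_le_rpow hm (min_le_right _ _) hq0) (by positivity) (by positivity)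

/-- If `w` has no larger `ℓ₁` norm than the `ℓ_q`-sparse vector `v` and is close to it in the
maximum norm, it is close to it in the `ℓ₁` norm. -/
lemma sum_abs_sub_le_of_sparse {ι : Type*} [Fintype ι] {q t s : ℝ} (hq0 : 0 ≤ q) (hq1 : q < 1)
    (ht : 0 ≤ t) {v w : ι → ℝ} (hs : ∑ i, absPow q (v i) ≤ s) (hl1 : ∑ i, |w i| ≤ ∑ i, |v i|)
    (hmax : ∀ i, |w i - v i| ≤ t) : ∑ i, |w i - v i| ≤ 2 * t ^ (1 - q) * s := by
  -- Where `|v i| ≥ t` the maximum-norm bound is used, and elsewhere the triangle inequality. The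
  -- terms `|w i| - |v i|` have nonpositive sum by `hl1`.
  have hpt : ∀ i, |w i - v i| ≤ |w i| - |v i| + 2 * (t ^ (1 - q) * absPow q (v i)) := fun i => by
    have h1 := min_abs_le_rpow_mul_absPow (x := v i) hq0 hq1 ht
    have h2 : |w i - v i| ≤ |w i| + |v i| := abs_sub _ _
    have h3 := abs_sub_abs_le_abs_sub (v i) (w i)
    rw [abs_sub_comm] at h3
    rcases min_cases t |v i| with ⟨h, -⟩ | ⟨h, -⟩
    · have := hmax i; linarith
    · linarith
  calc ∑ i, |w i - v i| ≤ ∑ i, (|w i| - |v i| + 2 * (t ^ (1 - q) * absPow q (v i))) :=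
        Finset.sum_le_sum fun i _ => hpt i
    _ = ∑ i, |w i| - ∑ i, |v i| + 2 * t ^ (1 - q) * ∑ i, absPow q (v i) := by
        rw [Finset.sum_add_distrib, Finset.sum_sub_distrib, Finset.mul_sum]
        congr 1; exact Finset.sum_congr rfl fun _ _ => by ring
    _ ≤ 0 + 2 * t ^ (1 - q) * s :=
        add_le_add (by linarith) (mul_le_mul_of_nonneg_left hs (by positivity))
    _ = _ := by ring

/-- The sparse comparison is applied column by column; its factor `2` is at most `1 + 2^{1-q} +
3^{1-q}`. The squared Frobenius norm is at most the entrywise bound times the sum of the `p` column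
norms. -/
lemma errorBounds_of_close {p : ℕ} {T q s₀ R : ℝ} (hT : 0 < T) (hR : 0 < R) (hs : 0 < s₀)
    (hq0 : 0 ≤ q) (hq1 : q < 1) {V V₀ : Mat p} (hV : V.IsSymm) (hV₀ : V₀.IsSymm)
    (hsp : SparseCond T q s₀ V₀) (hcol : ∀ j, ∑ i, |V i j| ≤ ∑ i, |V₀ i j|)
    (hmax : ∀ i j, |V i j - V₀ i j| ≤ 4 * T ^ 2 * R) : ErrorBounds T q s₀ R V V₀ := by
  have ht : 0 ≤ 4 * T ^ 2 * R := by positivity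
  have hc4 : 0 ≤ const4 T q := by unfold const4; positivity
  have hl1 : ∀ j, ∑ i, |(V - V₀) i j| ≤ const4 T q * R ^ (1 - q) * s₀ := fun j => by
    have hs' : ∑ i, absPow q (V₀ i j) ≤ s₀ := by
      simpa only [hV₀.apply] using hsp.sparse j
    refine (sum_abs_sub_le_of_sparse hq0 hq1 ht hs' (hcol j) (fun i => hmax i j)).trans ?_
    refine mul_le_mul_of_nonneg_right ?_ hs.le
    rw [Real.mul_rpow (by positivity) hR.le, const4, ← mul_assoc]
    refine mul_le_mul_of_nonneg_right (mul_le_mul_of_nonneg_right ?_ (by positivity))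
      (by positivity)
    have h2 : (1 : ℝ) ≤ 2 ^ (1 - q) := Real.one_le_rpow (by norm_num) (by linarith)
    have h3 : (1 : ℝ) ≤ 3 ^ (1 - q) := Real.one_le_rpow (by norm_num) (by linarith)
    linarith
  refine ⟨maxNorm_le ht hmax, opNorm_le_matL1 (hV.sub hV₀), matL1_le (by positivity) hl1, ?_⟩
  have hfrob : frobNorm (V - V₀) ^ 2 ≤
      p * (4 * T ^ 2 * R * (const4 T q * R ^ (1 - q) * s₀)) := by
    have h0 : (0 : ℝ) ≤ ∑ i, ∑ j, (V - V₀) i j ^ 2 :=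
      Finset.sum_nonneg fun _ _ => Finset.sum_nonneg fun _ _ => sq_nonneg _
    rw [frobNorm]
    refine (Real.sq_sqrt h0).le.trans ?_
    rw [Finset.sum_comm]
    calc ∑ j, ∑ i, (V - V₀) i j ^ 2
        ≤ ∑ j, ∑ i, 4 * T ^ 2 * R * |(V - V₀) i j| := by
          refine Finset.sum_le_sum fun j _ => Finset.sum_le_sum fun i _ => ?_
          rw [← sq_abs, sq]
          exact mul_le_mul_of_nonneg_right (hmax i j) (abs_nonneg _)
      _ ≤ ∑ _j : Fin p, 4 * T ^ 2 * R * (const4 T q * R ^ (1 - q) * s₀) := by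
          refine Finset.sum_le_sum fun j _ => ?_
          rw [← Finset.mul_sum]
          exact mul_le_mul_of_nonneg_left (hl1 j) ht
      _ = _ := by simp
  have hR2 : R ^ (2 - q) = R * R ^ (1 - q) := by
    rw [show (2 - q : ℝ) = 1 + (1 - q) by ring, Real.rpow_add hR, Real.rpow_one]
  rcases Nat.eq_zero_or_pos p with hp | hp
  · subst hp; simp only [Nat.cast_zero, div_zero, zero_mul]; unfold const5; positivity
  have hp' : (0 : ℝ) < p := by exact_mod_cast hp
  rw [one_div, inv_mul_le_iff₀ hp']
  refine hfrob.trans (le_of_eq ?_)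
  rw [hR2, const5]; ring

lemma IsSymmetrization.abs_le {p : ℕ} {V₁ V : Mat p} (h : IsSymmetrization V₁ V) (i j : Fin p) :
    |V i j| ≤ |V₁ i j| := by
  rcases h.2 i j with ⟨h1, _⟩ | ⟨h1, h2⟩
  · rw [h1]
  · rw [h1]; exact h2

lemma shape_posDef {p : ℕ} (hp : 0 < p) {Sig : Mat p} (hS : Sig.PosDef) : (shape Sig).PosDef := by
  have : Nonempty (Fin p) := ⟨⟨0, hp⟩⟩
  exact hS.smul (div_pos (by exact_mod_cast hp) hS.trace_pos)

lemma precision_isSymm {p : ℕ} {Sig : Mat p} (hS : Sig.PosDef) : (precision Sig).IsSymm := by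
  have h : Sig.IsSymm := by simpa [Matrix.IsHermitian, Matrix.IsSymm] using hS.isHermitian
  unfold precision shape Matrix.IsSymm
  rw [Matrix.transpose_nonsing_inv, Matrix.transpose_smul, h]

/-- If the constraint is void, or if `p Ŝ` estimates the shape matrix with error at most `R`, then
the SCLIME estimator with tuning parameter `T R` exists and satisfies the error bounds. -/
lemma sclime_bounds {n p : ℕ} {T q s₀ R : ℝ} (hn : 0 < n) (hp : 0 < p) (hT : 0 < T) (hR : 0 < R)
    (hs : 0 < s₀) (hq0 : 0 ≤ q) (hq1 : q < 1) {Sig : Mat p} (hS : Sig.PosDef)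
    (hsp : SparseCond T q s₀ (precision Sig)) (x : Fin n → Vec p)
    (h : 1 ≤ T * R ∨ ∀ m, IsSpatialMedian x m →
      ∀ i j, |(p : ℝ) * sampleSSCM x m i j - shape Sig i j| ≤ R) :
    (∃ V, IsSCLIME x (T * R) V) ∧
      ∀ V, IsSCLIME x (T * R) V → ErrorBounds T q s₀ R V (precision Sig) := by
  set V₀ := precision Sig with hV₀
  have hV₀s : V₀.IsSymm := precision_isSymm hS
  have hTR : 0 < T * R := mul_pos hT hR
  have hcolT : ∀ j, ∑ i, |V₀ i j| ≤ T := fun j => (col_sum_le_matL1 V₀ j).trans hsp.l1_le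
  have hunit : IsUnit (shape Sig).det := (shape_posDef hp hS).det_pos.ne'.isUnit
  have hΛV : shape Sig * V₀ = 1 := Matrix.mul_nonsing_inv _ hunit
  have hVΛ : V₀ * shape Sig = 1 := Matrix.nonsing_inv_mul _ hunit
  rcases h with h | h
  -- When `T R ≥ 1` the zero matrix is feasible, so the minimizer vanishes. The entries of `V₀` are
  -- at most `T ≤ 4 T² R`, which is all that is needed.
  · have hfe0 : ∀ S : Mat p, Feasible S (T * R) 0 := fun S => by
      refine maxNorm_le hTR.le fun i j => le_trans ?_ h
      rw [Matrix.mul_zero, smul_zero, zero_sub, Matrix.neg_apply, abs_neg, Matrix.one_apply]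
      split_ifs <;> simp
    constructor
    · obtain ⟨m, hm⟩ := exists_isSpatialMedian hn x
      obtain ⟨V₁, hV₁⟩ := exists_isSolution (hfe0 (sampleSSCM x m))
      obtain ⟨V, hV⟩ := exists_isSymmetrization V₁
      exact ⟨V, m, V₁, hm, hV₁, hV⟩
    · rintro V ⟨m, V₁, -, hV₁, hV⟩
      have h0 : ∀ i j, V i j = 0 := fun i j => by
        have h1 := (hV.abs_le i j).trans ((abs_le_elemL1 V₁ i j).trans (hV₁.2 0 (hfe0 _)))
        simp only [elemL1, Matrix.zero_apply, abs_zero, Finset.sum_const_zero] at h1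
        exact abs_nonpos_iff.1 h1
      refine errorBounds_of_close hT hR hs hq0 hq1 hV.1 hV₀s hsp (fun j => ?_) fun i j => ?_
      · simp only [h0, abs_zero, Finset.sum_const_zero]
        exact Finset.sum_nonneg fun _ _ => abs_nonneg _
      · rw [h0, zero_sub, abs_neg]
        have h1 : |V₀ i j| ≤ T := (Finset.single_le_sum (f := fun i => |V₀ i j|)
          (fun _ _ => abs_nonneg _) (Finset.mem_univ i)).trans (hcolT j)
        nlinarith
  · have hfe : ∀ m, IsSpatialMedian x m → Feasible (sampleSSCM x m) (T * R) V₀ := fun m hm => by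
      refine maxNorm_le hTR.le fun i j => ?_
      rw [← hΛV, ← Matrix.smul_mul, ← Matrix.sub_mul, mul_comm T R]
      refine abs_mul_apply_le hR.le (fun k => ?_) (hcolT j)
      simpa using h m hm i k
    constructor
    · obtain ⟨m, hm⟩ := exists_isSpatialMedian hn x
      obtain ⟨V₁, hV₁⟩ := exists_isSolution (hfe m hm)
      obtain ⟨V, hV⟩ := exists_isSymmetrization V₁
      exact ⟨V, m, V₁, hm, hV₁, hV⟩
    · rintro V ⟨m, V₁, hm, hV₁, hV⟩
      have hcol : ∀ j, ∑ i, |V₁ i j| ≤ ∑ i, |V₀ i j| := hV₁.col_le hTR.le (hfe m hm)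
      -- One `T R` pays for replacing `p Ŝ` by the shape matrix, using the column sums of `V₁`; the
      -- other is the constraint itself.
      have hres : ∀ i j, |(shape Sig * V₁ - 1) i j| ≤ 2 * (T * R) := fun i j => by
        have h1 : |((shape Sig - (p : ℝ) • sampleSSCM x m) * V₁) i j| ≤ R * T := by
          refine abs_mul_apply_le hR.le (fun k => ?_) ((hcol j).trans (hcolT j))
          simpa [abs_sub_comm] using h m hm i k
        have h2 := (abs_le_maxNorm _ i j).trans hV₁.1
        have h3 : shape Sig * V₁ - 1 = (shape Sig - (p : ℝ) • sampleSSCM x m) * V₁ +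
            ((p : ℝ) • (sampleSSCM x m * V₁) - 1) := by
          rw [Matrix.sub_mul, Matrix.smul_mul]; abel
        rw [h3, Matrix.add_apply]
        exact (abs_add_le _ _).trans (by linarith)
      have hclose : ∀ i j, |V₁ i j - V₀ i j| ≤ 4 * T ^ 2 * R := fun i j => by
        -- Transposing puts `V₀` on the right, where its column sums can be used; `V₀` is symmetric.
        let E : Mat p := (shape Sig * V₁ - 1)ᵀ
        have h1 : V₁ - V₀ = (V₀ * (shape Sig * V₁ - 1)) := by
          rw [Matrix.mul_sub, ← Matrix.mul_assoc, hVΛ, Matrix.one_mul, Matrix.mul_one]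
        have h2 : (V₁ - V₀)ᵀ = E * V₀ := by
          rw [h1, Matrix.transpose_mul, hV₀s]
        have h3 : V₁ i j - V₀ i j = (E * V₀) j i := by
          rw [← h2]; rfl
        rw [h3]
        refine (abs_mul_apply_le (A := E) (c := 2 * (T * R)) (by positivity) (fun k => hres k j)
          (hcolT i)).trans ?_
        nlinarith [mul_pos hT hTR]
      refine errorBounds_of_close hT hR hs hq0 hq1 hV.1 hV₀s hsp (fun j => ?_) fun i j => ?_
      · exact (Finset.sum_le_sum fun i _ => hV.abs_le i j).trans (hcol j)
      · rcases hV.2 i j with ⟨h1, -⟩ | ⟨h1, -⟩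
        · rw [h1]; exact hclose i j
        · rw [h1, ← hV₀s.apply]; exact hclose j i

end SCLIME

end

noncomputable section

namespace SCLIME

/-! ### The uniform law on the sphere -/

lemma nontrivial_vec {p : ℕ} (hp : 0 < p) : Nontrivial (Vec p) :=
  Module.nontrivial_of_finrank_pos (R := ℝ) (by simpa using hp)

lemma isProbabilityMeasure_uniformSphere {p : ℕ} (hp : 0 < p) :
    IsProbabilityMeasure (uniformSphere p) := by
  have := nontrivial_vec hp
  refine ⟨?_⟩
  rw [uniformSphere, Measure.smul_apply, smul_eq_mul]
  exact ENNReal.inv_mul_cancel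
    (mt Measure.measure_univ_eq_zero.1 (Measure.toSphere_ne_zero (volume : Measure (Vec p))))
    (measure_ne_top _ _)

lemma integrable_uniformSphere {p : ℕ} (hp : 0 < p) {f : Metric.sphere (0 : Vec p) 1 → ℝ}
    (hf : Continuous f) : Integrable f (uniformSphere p) := by
  have := isProbabilityMeasure_uniformSphere hp
  exact hf.integrable_of_hasCompactSupport (HasCompactSupport.of_compactSpace _)

/-- The action of a linear isometry on the sphere. -/
def sphereMap {p : ℕ} (g : Vec p ≃ₗᵢ[ℝ] Vec p) :
    Metric.sphere (0 : Vec p) 1 → Metric.sphere (0 : Vec p) 1 :=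
  fun u => ⟨g u, by simp⟩

lemma continuous_sphereMap {p : ℕ} (g : Vec p ≃ₗᵢ[ℝ] Vec p) : Continuous (sphereMap g) :=
  (g.continuous.comp continuous_subtype_val).subtype_mk _

-- The surface measure of a set is, up to a constant, the volume of the cone over it, and a linear
-- isometry preserves volume.
open scoped Pointwise in
lemma measurePreserving_sphereMap {p : ℕ} (g : Vec p ≃ₗᵢ[ℝ] Vec p) :
    MeasurePreserving (sphereMap g) (uniformSphere p) (uniformSphere p) := by
  have hm := (continuous_sphereMap g).measurable
  refine ⟨hm, ?_⟩
  ext s hs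
  rw [Measure.map_apply hm hs]
  simp only [uniformSphere, Measure.smul_apply]
  congr 1
  rw [Measure.toSphere_apply' _ (hm hs), Measure.toSphere_apply' _ hs]
  congr 1
  have hg : MeasurePreserving g.toHomeomorph.toMeasurableEquiv volume volume :=
    g.measurePreserving
  rw [← hg.measure_preimage_equiv (Set.Ioo (0 : ℝ) 1 • (Subtype.val '' s))]
  congr 1
  ext x
  simp only [Set.mem_smul, Set.mem_image, Set.mem_preimage]
  constructor
  · rintro ⟨r, hr, -, ⟨u, hu, rfl⟩, rfl⟩
    exact ⟨r, hr, _, ⟨sphereMap g u, hu, rfl⟩, by simp [sphereMap]⟩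
  · rintro ⟨r, hr, -, ⟨u, hu, rfl⟩, hx⟩
    refine ⟨r, hr, _, ⟨sphereMap g.symm u, ?_, rfl⟩, ?_⟩
    · simpa [sphereMap] using hu
    · apply g.injective
      simpa [sphereMap] using hx

lemma integral_sphere_comp {p : ℕ} (g : Vec p ≃ₗᵢ[ℝ] Vec p) {f : Vec p → ℝ} (hf : Continuous f) :
    ∫ u, f (g u) ∂uniformSphere p = ∫ u, f u ∂uniformSphere p := by
  have h := measurePreserving_sphereMap g
  have h2 := integral_map (μ := uniformSphere p) h.measurable.aemeasurable
    (f := fun u : Metric.sphere (0 : Vec p) 1 => f u)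
    (hf.comp continuous_subtype_val).aestronglyMeasurable
  rw [h.map_eq] at h2
  exact h2.symm

/-! ### Exponential moments of the coordinates on the sphere -/

lemma lintegral_polar {p : ℕ} (hp : 0 < p) {F : Vec p → ℝ≥0∞} (hF : Measurable F) :
    ∫⁻ x, F x = ∫⁻ u, ∫⁻ r, F (r.1 • u.1) ∂Measure.volumeIoiPow (p - 1)
      ∂(volume : Measure (Vec p)).toSphere := by
  have := nontrivial_vec hp
  have hmp := (volume : Measure (Vec p)).measurePreserving_homeomorphUnitSphereProd
  rw [finrank_euclideanSpace_fin] at hmp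
  have hF' : Measurable fun y => F ((homeomorphUnitSphereProd (Vec p)).symm y) :=
    hF.comp (measurable_subtype_coe.comp (homeomorphUnitSphereProd (Vec p)).symm.measurable)
  calc ∫⁻ x, F x = ∫⁻ x in ({0}ᶜ : Set (Vec p)), F x := by rw [restrict_compl_singleton]
    _ = ∫⁻ x : ({0}ᶜ : Set (Vec p)), F x ∂(Measure.comap Subtype.val volume) :=
        (lintegral_subtype_comap (measurableSet_singleton _).compl _).symm
    _ = ∫⁻ y, F ((homeomorphUnitSphereProd (Vec p)).symm y)
          ∂((volume : Measure (Vec p)).toSphere.prod (Measure.volumeIoiPow (p - 1))) := by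
        rw [← hmp.lintegral_comp hF']; simp
    _ = _ := by
        rw [lintegral_prod _ hF'.aemeasurable]; simp

/-- Polar coordinates for an isotropic Gaussian. The surface area and the radial integral are only
ever needed through this product, so neither has to be computed. -/
lemma lintegral_radial_gaussian {p : ℕ} (hp : 0 < p) {b : ℝ} (hb : 0 < b) :
    (volume : Measure (Vec p)).toSphere Set.univ *
      ∫⁻ r, ENNReal.ofReal (Real.exp (-b * r.1 ^ 2)) ∂Measure.volumeIoiPow (p - 1) =
      ENNReal.ofReal ((Real.pi / b) ^ ((p : ℝ) / 2)) := by
  have h := lintegral_polar hp (F := fun x : Vec p => ENNReal.ofReal (Real.exp (-b * ‖x‖ ^ 2)))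
    (by fun_prop)
  have hn : ∀ (u : Metric.sphere (0 : Vec p) 1) (r : Set.Ioi (0 : ℝ)), ‖r.1 • u.1‖ = r.1 :=
    fun u r => by
      rw [norm_smul, norm_eq_of_mem_sphere, mul_one, Real.norm_of_nonneg (le_of_lt r.2)]
  simp only [hn, lintegral_const] at h
  have h2 := GaussianFourier.integral_rexp_neg_mul_sq_norm (V := Vec p) hb
  rw [finrank_euclideanSpace_fin] at h2
  have hint : Integrable fun x : Vec p => Real.exp (-b * ‖x‖ ^ 2) := by
    by_contra hc
    rw [integral_undef hc] at h2
    have : 0 < (Real.pi / b) ^ ((p : ℝ) / 2) := by positivity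
    linarith
  rw [mul_comm, ← h, ← ofReal_integral_eq_lintegral_ofReal hint
    (Filter.Eventually.of_forall fun _ => (Real.exp_pos _).le), h2]

/-- The integrand is a product of one-dimensional Gaussians; the tilt changes the coefficient of
coordinate `i₀` from `1/2` to `1/4`, which costs the factor `√2`. -/
lemma lintegral_gaussian_tilted {p : ℕ} (i₀ : Fin p) :
    ∫⁻ x : Vec p, ENNReal.ofReal (Real.exp (-(1 / 2) * ‖x‖ ^ 2 + 1 / 4 * x i₀ ^ 2)) =
      ENNReal.ofReal (Real.sqrt 2 * (2 * Real.pi) ^ ((p : ℝ) / 2)) := by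
  classical
  let b : Fin p → ℝ := fun i => if i = i₀ then 1 / 4 else 1 / 2
  have hb : ∀ i, 0 < b i := fun i => by simp only [b]; split_ifs <;> norm_num
  have hexp : ∀ x : Vec p, Real.exp (-(1 / 2) * ‖x‖ ^ 2 + 1 / 4 * x i₀ ^ 2) =
      ∏ i, Real.exp (-b i * x i ^ 2) := fun x => by
    rw [← Real.exp_sum, EuclideanSpace.real_norm_sq_eq]
    congr 1
    have : ∀ i, -b i * x i ^ 2 = -(1 / 2) * x i ^ 2 + if i = i₀ then 1 / 4 * x i ^ 2 else 0 :=
      fun i => by simp only [b]; split_ifs <;> ring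
    simp only [this, Finset.sum_add_distrib, Finset.mul_sum, Finset.sum_ite_eq', Finset.mem_univ,
      if_true]
  have hmp := PiLp.volume_preserving_ofLp (Fin p)
  have hmeas : Measurable fun y : Fin p → ℝ => ENNReal.ofReal (∏ i, Real.exp (-b i * y i ^ 2)) := by
    fun_prop
  calc _ = ∫⁻ x : Vec p, ENNReal.ofReal (∏ i, Real.exp (-b i * x i ^ 2)) := by simp only [hexp]
    _ = ∫⁻ y : Fin p → ℝ, ENNReal.ofReal (∏ i, Real.exp (-b i * y i ^ 2)) :=
        hmp.lintegral_comp hmeas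
    _ = ENNReal.ofReal (∫ y : Fin p → ℝ, ∏ i, Real.exp (-b i * y i ^ 2)) := by
        rw [ofReal_integral_eq_lintegral_ofReal]
        · exact Integrable.fintype_prod (f := fun i (t : ℝ) => Real.exp (-b i * t ^ 2))
            fun i => integrable_exp_neg_mul_sq (hb i)
        · exact Filter.Eventually.of_forall fun _ =>
            Finset.prod_nonneg fun _ _ => (Real.exp_pos _).le
    _ = _ := by
        rw [integral_fintype_prod_volume_eq_prod (fun i (t : ℝ) => Real.exp (-b i * t ^ 2))]
        congr 1
        have : ∀ i, ∫ t : ℝ, Real.exp (-b i * t ^ 2) =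
            (if i = i₀ then Real.sqrt 2 else 1) * Real.sqrt (2 * Real.pi) := fun i => by
          rw [integral_gaussian]
          simp only [b]
          split_ifs
          · rw [← Real.sqrt_mul (by norm_num)]; congr 1; ring
          · rw [one_mul]; congr 1; ring
        simp only [this, Finset.prod_mul_distrib, Finset.prod_ite_eq', Finset.mem_univ, if_true,
          Finset.prod_const, Finset.card_univ, Fintype.card_fin]
        rw [Real.sqrt_eq_rpow (2 * Real.pi), ← Real.rpow_natCast, ← Real.rpow_mul (by positivity)]
        congr 2; ring

/-- Write the tilted Gaussian integral in polar coordinates. In direction `u` the radial part has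
coefficient `1/2 - u_{i₀}²/4`, hence contributes `(2π)^{p/2} (1 - u_{i₀}²/2)^{-p/2}`, which is at
least `(2π)^{p/2} exp(p u_{i₀}²/4)`. Averaging over directions bounds the exponential moment by
`√2`. -/
lemma lintegral_exp_coord_sq {p : ℕ} (i₀ : Fin p) :
    ∫⁻ u, ENNReal.ofReal (Real.exp (p / 4 * u.1 i₀ ^ 2)) ∂uniformSphere p ≤ 2 := by
  have hp : 0 < p := i₀.pos
  have := nontrivial_vec hp
  set σ := (volume : Measure (Vec p)).toSphere with hσ
  have hσ0 : σ Set.univ ≠ 0 :=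
    mt Measure.measure_univ_eq_zero.1 (Measure.toSphere_ne_zero (volume : Measure (Vec p)))
  have hσt : σ Set.univ ≠ ∞ := measure_ne_top _ _
  have hc : ∀ u : Metric.sphere (0 : Vec p) 1, u.1 i₀ ^ 2 ≤ 1 := fun u => by
    have h1 := PiLp.norm_apply_le (p := 2) u.1 i₀
    rw [norm_eq_of_mem_sphere, Real.norm_eq_abs] at h1
    rw [← sq_abs]; nlinarith [abs_nonneg (u.1 i₀)]
  set G : ℝ := (2 * Real.pi) ^ ((p : ℝ) / 2) with hG
  have hGpos : 0 < G := by positivity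
  have hpol := lintegral_polar hp
    (F := fun x : Vec p => ENNReal.ofReal (Real.exp (-(1 / 2) * ‖x‖ ^ 2 + 1 / 4 * x i₀ ^ 2)))
    (by fun_prop)
  rw [lintegral_gaussian_tilted i₀] at hpol
  have hinner : ∀ u : Metric.sphere (0 : Vec p) 1,
      ENNReal.ofReal G * ENNReal.ofReal (Real.exp (p / 4 * u.1 i₀ ^ 2)) ≤
      σ Set.univ * ∫⁻ r : Set.Ioi (0 : ℝ), ENNReal.ofReal
        (Real.exp (-(1 / 2) * ‖r.1 • u.1‖ ^ 2 + 1 / 4 * (r.1 • u.1) i₀ ^ 2))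
        ∂Measure.volumeIoiPow (p - 1) := fun u => by
    have hb : 0 < 1 / 2 - 1 / 4 * u.1 i₀ ^ 2 := by linarith [hc u]
    have hrw : ∀ r : Set.Ioi (0 : ℝ),
        -(1 / 2) * ‖r.1 • u.1‖ ^ 2 + 1 / 4 * (r.1 • u.1) i₀ ^ 2 =
        -(1 / 2 - 1 / 4 * u.1 i₀ ^ 2) * r.1 ^ 2 := fun r => by
      rw [norm_smul, norm_eq_of_mem_sphere, mul_one, Real.norm_eq_abs, sq_abs]
      simp only [PiLp.smul_apply, smul_eq_mul]; ring
    simp only [hrw]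
    rw [hσ, lintegral_radial_gaussian hp hb, ← ENNReal.ofReal_mul hGpos.le]
    refine ENNReal.ofReal_le_ofReal ?_
    have hx := Real.exp_bound_div_one_sub_of_interval (x := u.1 i₀ ^ 2 / 2) (by positivity)
      (by linarith [hc u])
    have h1 : Real.exp (p / 4 * u.1 i₀ ^ 2) ≤ (1 / (1 - u.1 i₀ ^ 2 / 2)) ^ ((p : ℝ) / 2) := by
      refine le_trans (le_of_eq ?_) (Real.rpow_le_rpow (Real.exp_pos _).le hx (by positivity))
      rw [← Real.exp_mul]; congr 1; ring
    refine (mul_le_mul_of_nonneg_left h1 hGpos.le).trans (le_of_eq ?_)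
    have hpos : 0 < 1 - u.1 i₀ ^ 2 / 2 := by linarith [hc u]
    rw [hG, ← Real.mul_rpow (by positivity) (by positivity)]
    congr 1
    have hpos' : 0 < 2 - u.1 i₀ ^ 2 := by linarith [hc u]
    have hpos2 : 0 < 4 - 2 * u.1 i₀ ^ 2 := by linarith [hc u]
    field_simp
    ring
  have hmeas : Measurable fun u : Metric.sphere (0 : Vec p) 1 =>
      ENNReal.ofReal (Real.exp (p / 4 * u.1 i₀ ^ 2)) := by fun_prop
  have key : ENNReal.ofReal G * ∫⁻ u, ENNReal.ofReal (Real.exp (p / 4 * u.1 i₀ ^ 2)) ∂σ ≤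
      ENNReal.ofReal G * (σ Set.univ * ENNReal.ofReal (Real.sqrt 2)) := by
    rw [← lintegral_const_mul _ hmeas]
    refine (lintegral_mono hinner).trans ?_
    rw [lintegral_const_mul' _ _ hσt, ← hpol, mul_comm (Real.sqrt 2),
      ENNReal.ofReal_mul hGpos.le]
    exact le_of_eq (by ring)
  have key2 := (ENNReal.mul_le_mul_iff_right (by simpa using hGpos) ENNReal.ofReal_ne_top).1 key
  rw [uniformSphere, lintegral_smul_measure, smul_eq_mul]
  calc (σ Set.univ)⁻¹ * ∫⁻ u, ENNReal.ofReal (Real.exp (p / 4 * u.1 i₀ ^ 2)) ∂σ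
      ≤ (σ Set.univ)⁻¹ * (σ Set.univ * ENNReal.ofReal (Real.sqrt 2)) := by gcongr
    _ = ENNReal.ofReal (Real.sqrt 2) := by
        rw [← mul_assoc, ENNReal.inv_mul_cancel hσ0 hσt, one_mul]
    _ ≤ ENNReal.ofReal 2 := ENNReal.ofReal_le_ofReal
        (by rw [Real.sqrt_le_left (by norm_num)]; norm_num)
    _ = 2 := by norm_num

lemma exists_orthonormalBasis_apply_eq {p : ℕ} (i₀ : Fin p) {e : Vec p} (he : ‖e‖ = 1) :
    ∃ b : OrthonormalBasis (Fin p) ℝ (Vec p), b i₀ = e := by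
  obtain ⟨b, hb⟩ := Orthonormal.exists_orthonormalBasis_extension_of_card_eq (𝕜 := ℝ) (E := Vec p)
    (ι := Fin p) (by simp) (v := fun _ => e) (s := {i₀}) (by
      refine ⟨fun _ => he, fun i j hij => absurd (Subsingleton.elim i j) hij⟩)
  exact ⟨b, hb i₀ rfl⟩

/-- The projections of `√p u` on unit directions are uniformly sub-Gaussian. -/
lemma integral_exp_inner_sq {p : ℕ} (hp : 0 < p) {e : Vec p} (he : ‖e‖ ≤ 1) :
    ∫ u, Real.exp (p / 4 * inner ℝ e u.1 ^ 2) ∂uniformSphere p ≤ 2 := by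
  have := isProbabilityMeasure_uniformSphere hp
  let i₀ : Fin p := ⟨0, hp⟩
  have hcoord : ∫ u, Real.exp (p / 4 * u.1 i₀ ^ 2) ∂uniformSphere p ≤ 2 := by
    rw [integral_eq_lintegral_of_nonneg_ae (Filter.Eventually.of_forall fun _ =>
      (Real.exp_pos _).le) (by fun_prop)]
    exact ENNReal.toReal_le_of_le_ofReal (by norm_num)
      ((lintegral_exp_coord_sq i₀).trans (by norm_num))
  obtain ⟨e', he', hee'⟩ : ∃ e' : Vec p, ‖e'‖ = 1 ∧ e = ‖e‖ • e' := by
    by_cases h0 : e = 0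
    · exact ⟨EuclideanSpace.single i₀ 1, by simp, by simp [h0]⟩
    · refine ⟨‖e‖⁻¹ • e, by simp [norm_smul, h0], ?_⟩
      rw [smul_smul, mul_inv_cancel₀ (by simpa using h0), one_smul]
  obtain ⟨b, hb⟩ := exists_orthonormalBasis_apply_eq i₀ he'
  let g : Vec p ≃ₗᵢ[ℝ] Vec p := (EuclideanSpace.basisFun (Fin p) ℝ).equiv b (Equiv.refl _)
  have hg : ∀ u, inner ℝ e' (g u) = u i₀ := fun u => by
    have h1 : g (EuclideanSpace.basisFun (Fin p) ℝ i₀) = e' := by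
      rw [← hb]; exact OrthonormalBasis.equiv_apply_basis _ _ _ _
    rw [← h1, g.inner_map_map]
    simp [EuclideanSpace.inner_single_left]
  have hle : ∀ u : Metric.sphere (0 : Vec p) 1,
      Real.exp (p / 4 * inner ℝ e u.1 ^ 2) ≤ Real.exp (p / 4 * inner ℝ e' u.1 ^ 2) := fun u => by
    refine Real.exp_le_exp.2 (mul_le_mul_of_nonneg_left ?_ (by positivity))
    rw [hee', inner_smul_left, mul_pow]
    simp only [conj_trivial]
    have : ‖e‖ ^ 2 ≤ 1 := by nlinarith [norm_nonneg e]
    nlinarith [sq_nonneg (inner ℝ e' u.1)]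
  refine (integral_mono (integrable_uniformSphere hp (by fun_prop))
    (integrable_uniformSphere hp (by fun_prop)) hle).trans ?_
  rw [← integral_sphere_comp g (f := fun x => Real.exp (p / 4 * inner ℝ e' x ^ 2)) (by fun_prop)]
  simpa only [hg] using hcoord

/-! ### Second and fourth moments on the sphere -/

/-- Apply `x² / 2 ≤ exp x` at `x = p ⟨e, u⟩² / 4` and integrate: the constant is `32 · 2`. -/
lemma integral_inner_pow_four_le {p : ℕ} (hp : 0 < p) {e : Vec p} (he : ‖e‖ ≤ 1) :
    ∫ u, inner ℝ e u.1 ^ 4 ∂uniformSphere p ≤ 64 / (p : ℝ) ^ 2 := by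
  have hp' : (0 : ℝ) < p := by exact_mod_cast hp
  have hle : ∀ u : Metric.sphere (0 : Vec p) 1,
      inner ℝ e u.1 ^ 4 ≤ 32 / (p : ℝ) ^ 2 * Real.exp (p / 4 * inner ℝ e u.1 ^ 2) := fun u => by
    have h1 := Real.quadratic_le_exp_of_nonneg (x := p / 4 * inner ℝ e u.1 ^ 2) (by positivity)
    have h2 : (p / 4 * inner ℝ e u.1 ^ 2) ^ 2 / 2 ≤ Real.exp (p / 4 * inner ℝ e u.1 ^ 2) := by
      have : 0 ≤ p / 4 * inner ℝ e u.1 ^ 2 := by positivity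
      linarith
    refine le_trans (le_of_eq ?_) (mul_le_mul_of_nonneg_left h2 (by positivity))
    field_simp; ring
  refine (integral_mono (integrable_uniformSphere hp (by fun_prop))
    (integrable_uniformSphere hp (by fun_prop)) hle).trans ?_
  rw [integral_const_mul]
  refine (mul_le_mul_of_nonneg_left (integral_exp_inner_sq hp he) (by positivity)).trans
    (le_of_eq (by ring))

section Moments

variable {p : ℕ} (b : OrthonormalBasis (Fin p) ℝ (Vec p))

lemma inner_equiv_swap (i j k : Fin p) (u : Vec p) :
    inner ℝ (b k) (b.equiv b (Equiv.swap i j) u) = inner ℝ (b (Equiv.swap i j k)) u := by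
  have h : b k = b.equiv b (Equiv.swap i j) (b (Equiv.swap i j k)) := by
    rw [OrthonormalBasis.equiv_apply_basis, Equiv.swap_apply_self]
  rw [h, LinearIsometryEquiv.inner_map_map]

lemma sum_inner_sq_sphere (u : Metric.sphere (0 : Vec p) 1) : ∑ k, inner ℝ (b k) u.1 ^ 2 = 1 := by
  have h := b.sum_sq_norm_inner_right u.1
  rw [norm_eq_of_mem_sphere] at h
  simpa using h

/-- The `p` coordinates are exchangeable and their squares add up to one. -/
lemma integral_inner_sq_sphere (hp : 0 < p) (i : Fin p) :
    ∫ u, inner ℝ (b i) u.1 ^ 2 ∂uniformSphere p = 1 / p := by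
  have := isProbabilityMeasure_uniformSphere hp
  have hp' : (0 : ℝ) < p := by exact_mod_cast hp
  have hall : ∀ k, ∫ u, inner ℝ (b k) u.1 ^ 2 ∂uniformSphere p =
      ∫ u, inner ℝ (b i) u.1 ^ 2 ∂uniformSphere p := fun k => by
    rw [← integral_sphere_comp (b.equiv b (Equiv.swap i k)) (f := fun x => inner ℝ (b k) x ^ 2)
      (by fun_prop)]
    simp only [inner_equiv_swap, Equiv.swap_apply_right]
  have hsum : ∑ k, ∫ u, inner ℝ (b k) u.1 ^ 2 ∂uniformSphere p = 1 := by
    rw [← integral_finsetSum _ fun k _ => integrable_uniformSphere hp (by fun_prop)]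
    simp [sum_inner_sq_sphere]
  simp only [hall, Finset.sum_const, Finset.card_univ, Fintype.card_fin, nsmul_eq_mul] at hsum
  field_simp; linarith

/-- The reflection that negates `b i` fixes `b j`, so the integral equals its own negative. -/
lemma integral_inner_mul_inner_sphere {i j : Fin p} (hij : i ≠ j) :
    ∫ u, inner ℝ (b i) u.1 * inner ℝ (b j) u.1 ∂uniformSphere p = 0 := by
  let g : Vec p ≃ₗᵢ[ℝ] Vec p := (ℝ ∙ b i)ᗮ.reflection
  have hgi : g (b i) = -b i := Submodule.reflection_orthogonalComplement_singleton_eq_neg _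
  have hgj : g (b j) = b j := Submodule.reflection_mem_subspace_eq_self
    (Submodule.mem_orthogonal_singleton_iff_inner_right.2 (b.orthonormal.2 hij))
  have hi : ∀ u, inner ℝ (b i) (g u) = -inner ℝ (b i) u := fun u => by
    rw [← g.inner_map_map (b i) u, hgi, inner_neg_left, neg_neg]
  have hj : ∀ u, inner ℝ (b j) (g u) = inner ℝ (b j) u := fun u => by
    rw [← g.inner_map_map (b j) u, hgj]
  have h := integral_sphere_comp g (f := fun x => inner ℝ (b i) x * inner ℝ (b j) x) (by fun_prop)
  simp only [hi, hj, neg_mul, integral_neg] at h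
  linarith

/-- `E ⟨x, u⟩ ⟨y, u⟩ = ⟨x, y⟩ / p`. -/
lemma integral_inner_mul_inner (hp : 0 < p) (x y : Vec p) :
    ∫ u, inner ℝ x u.1 * inner ℝ y u.1 ∂uniformSphere p = inner ℝ x y / p := by
  let b := EuclideanSpace.basisFun (Fin p) ℝ
  have hx : ∀ (x u : Vec p), inner ℝ x u = ∑ i, inner ℝ x (b i) * inner ℝ (b i) u := fun x u =>
    (b.sum_inner_mul_inner x u).symm
  have hexp : ∀ u : Vec p, inner ℝ x u * inner ℝ y u = ∑ i, ∑ j,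
      inner ℝ x (b i) * inner ℝ y (b j) * (inner ℝ (b i) u * inner ℝ (b j) u) := fun u => by
    rw [hx x u, hx y u, Finset.sum_mul_sum]
    exact Finset.sum_congr rfl fun i _ => Finset.sum_congr rfl fun j _ => by ring
  simp only [hexp]
  rw [integral_finsetSum _ fun i _ => integrable_uniformSphere hp (by fun_prop)]
  have hi : ∀ i, ∫ u : Metric.sphere (0 : Vec p) 1, ∑ j, inner ℝ x (b i) * inner ℝ y (b j) *
      (inner ℝ (b i) u.1 * inner ℝ (b j) u.1) ∂uniformSphere p =
      inner ℝ x (b i) * inner ℝ y (b i) * (1 / p) := fun i => by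
    rw [integral_finsetSum _ fun j _ => integrable_uniformSphere hp (by fun_prop),
      Finset.sum_eq_single i]
    · rw [integral_const_mul, ← integral_inner_sq_sphere b hp i]
      simp only [sq]
    · intro j _ hj
      rw [integral_const_mul, integral_inner_mul_inner_sphere b hj.symm, mul_zero]
    · simp
  simp only [hi]
  rw [← Finset.sum_mul, ← b.sum_inner_mul_inner x y]
  simp only [real_inner_comm y, mul_one_div]

/-- The variance bound for a quadratic form with centred spectrum. -/
lemma integral_quadratic_sq_le (hp : 0 < p) {d : Fin p → ℝ} (hd : ∑ k, d k = 0) :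
    ∫ u, (∑ k, d k * inner ℝ (b k) u.1 ^ 2) ^ 2 ∂uniformSphere p ≤
      64 / (p : ℝ) ^ 2 * ∑ k, d k ^ 2 := by
  let m : Fin p → Fin p → ℝ := fun k l =>
    ∫ u, inner ℝ (b k) u.1 ^ 2 * inner ℝ (b l) u.1 ^ 2 ∂uniformSphere p
  have hm0 : ∀ k l, 0 ≤ m k l := fun k l => integral_nonneg fun u => by positivity
  have hmk : ∀ k, m k k ≤ 64 / (p : ℝ) ^ 2 := fun k => by
    refine le_trans (le_of_eq ?_) (integral_inner_pow_four_le hp (e := b k) (by simp))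
    exact integral_congr_ae (Filter.Eventually.of_forall fun u => by ring)
  have hmswap : ∀ k l l', l ≠ k → l' ≠ k → m k l = m k l' := fun k l l' hl hl' => by
    simp only [m]
    rw [← integral_sphere_comp (b.equiv b (Equiv.swap l l'))
      (f := fun x => inner ℝ (b k) x ^ 2 * inner ℝ (b l) x ^ 2) (by fun_prop)]
    simp only [inner_equiv_swap, Equiv.swap_apply_left, Equiv.swap_apply_of_ne_of_ne hl.symm hl'.symm]
  have hexp : ∀ u : Metric.sphere (0 : Vec p) 1, (∑ k, d k * inner ℝ (b k) u.1 ^ 2) ^ 2 =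
      ∑ k, ∑ l, d k * d l * (inner ℝ (b k) u.1 ^ 2 * inner ℝ (b l) u.1 ^ 2) := fun u => by
    rw [sq, Finset.sum_mul_sum]
    exact Finset.sum_congr rfl fun i _ => Finset.sum_congr rfl fun j _ => by ring
  simp only [hexp]
  rw [integral_finsetSum _ fun i _ => integrable_uniformSphere hp (by fun_prop), Finset.mul_sum]
  refine Finset.sum_le_sum fun k _ => ?_
  rw [integral_finsetSum _ fun j _ => integrable_uniformSphere hp (by fun_prop)]
  simp only [integral_const_mul]
  change ∑ l, d k * d l * m k l ≤ _
  by_cases hex : ∃ l, l ≠ k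
  · obtain ⟨l₀, hl₀⟩ := hex
    -- For fixed `k` all mixed moments `m k l` with `l ≠ k` coincide. Since `∑ d = 0`, the row sum
    -- collapses to `d k ^ 2 * (m k k - m k l₀)`, at most `d k ^ 2 * m k k`.
    have h1 : ∀ l, d k * d l * m k l = d k * m k l₀ * d l +
        if l = k then d k * d k * (m k k - m k l₀) else 0 := fun l => by
      split_ifs with h
      · rw [h]; ring
      · rw [hmswap k l l₀ h hl₀]; ring
    simp only [h1, Finset.sum_add_distrib, ← Finset.mul_sum, hd, Finset.sum_ite_eq',
      Finset.mem_univ, if_true]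
    nlinarith [hmk k, hm0 k l₀, sq_nonneg (d k)]
  · push Not at hex
    have h1 : ∀ l, d k * d l * m k l = d k * m k k * d l := fun l => by rw [hex l]; ring
    simp only [h1, ← Finset.mul_sum, hd, mul_zero]
    positivity

end Moments

end SCLIME

end

noncomputable section

namespace SCLIME

/-! ### The square root of the scatter matrix -/

/-- The linear map `Σ^{1/2}`. -/
def sqrtMap {p : ℕ} (Sig : Mat p) : Vec p →L[ℝ] Vec p :=
  Matrix.toEuclideanCLM (n := Fin p) (𝕜 := ℝ) (CFC.sqrt Sig)

section Sqrt

variable {p : ℕ} {Sig : Mat p}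

lemma inner_toEuclideanCLM_comm {A : Mat p} (hA : A.IsHermitian) (x y : Vec p) :
    inner ℝ (Matrix.toEuclideanCLM (n := Fin p) (𝕜 := ℝ) A x) y =
      inner ℝ x (Matrix.toEuclideanCLM (n := Fin p) (𝕜 := ℝ) A y) := by
  have h : IsSelfAdjoint (Matrix.toEuclideanCLM (n := Fin p) (𝕜 := ℝ) A) :=
    IsSelfAdjoint.map (show IsSelfAdjoint A from hA) _
  exact h.isSymmetric x y

lemma inner_sqrtMap_comm (x y : Vec p) :
    inner ℝ (sqrtMap Sig x) y = inner ℝ x (sqrtMap Sig y) :=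
  inner_toEuclideanCLM_comm (Matrix.nonneg_iff_posSemidef.1 (CFC.sqrt_nonneg Sig)).isHermitian x y

lemma inner_sqrtMap_sqrtMap (hS : Sig.PosDef) (x y : Vec p) :
    inner ℝ (sqrtMap Sig x) (sqrtMap Sig y) =
      inner ℝ x (Matrix.toEuclideanCLM (n := Fin p) (𝕜 := ℝ) Sig y) := by
  rw [inner_sqrtMap_comm]
  congr 1
  unfold sqrtMap
  rw [← mul_apply_eq_comp, ← map_mul, CFC.sqrt_mul_sqrt_self _ hS.posSemidef.nonneg]

lemma norm_sqrtMap_sq (hS : Sig.PosDef) (x : Vec p) :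
    ‖sqrtMap Sig x‖ ^ 2 = ∑ k, hS.isHermitian.eigenvalues k *
      inner ℝ (hS.isHermitian.eigenvectorBasis k) x ^ 2 := by
  set b := hS.isHermitian.eigenvectorBasis
  rw [← real_inner_self_eq_norm_sq, inner_sqrtMap_sqrtMap hS, ← b.sum_inner_mul_inner]
  refine Finset.sum_congr rfl fun k _ => ?_
  rw [← inner_toEuclideanCLM_comm hS.isHermitian]
  have h : Matrix.toEuclideanCLM (n := Fin p) (𝕜 := ℝ) Sig (b k) =
      hS.isHermitian.eigenvalues k • b k := by
    ext i
    have := congrFun (hS.isHermitian.mulVec_eigenvectorBasis k) i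
    simpa [b] using this
  rw [h, inner_smul_left, real_inner_comm]
  simp only [conj_trivial]; ring

variable {η : ℝ} (hS : Sig.PosDef)
  (heig : ∀ i, η < hS.isHermitian.eigenvalues i ∧ hS.isHermitian.eigenvalues i < 1 / η)

include heig in
lemma le_norm_sqrtMap_sq (x : Vec p) : η * ‖x‖ ^ 2 ≤ ‖sqrtMap Sig x‖ ^ 2 := by
  rw [norm_sqrtMap_sq hS, ← hS.isHermitian.eigenvectorBasis.sum_sq_norm_inner_right x, Finset.mul_sum]
  refine Finset.sum_le_sum fun k _ => ?_
  rw [Real.norm_eq_abs, sq_abs]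
  exact mul_le_mul_of_nonneg_right (heig k).1.le (sq_nonneg _)

include heig in
lemma norm_sqrtMap_sq_le (x : Vec p) : ‖sqrtMap Sig x‖ ^ 2 ≤ 1 / η * ‖x‖ ^ 2 := by
  rw [norm_sqrtMap_sq hS, ← hS.isHermitian.eigenvectorBasis.sum_sq_norm_inner_right x, Finset.mul_sum]
  refine Finset.sum_le_sum fun k _ => ?_
  rw [Real.norm_eq_abs, sq_abs]
  exact mul_le_mul_of_nonneg_right (heig k).2.le (sq_nonneg _)

lemma inner_sqrtMap_single (hS : Sig.PosDef) (i j : Fin p) :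
    inner ℝ (sqrtMap Sig (EuclideanSpace.single i 1)) (sqrtMap Sig (EuclideanSpace.single j 1)) =
      Sig i j := by
  rw [inner_sqrtMap_sqrtMap hS]
  simp [EuclideanSpace.inner_single_left]

include heig in
lemma mul_le_trace : η * p ≤ Sig.trace ∧ Sig.trace ≤ 1 / η * p := by
  have h : Sig.trace = ∑ i, hS.isHermitian.eigenvalues i := by
    simpa using hS.isHermitian.trace_eq_sum_eigenvalues
  rw [h]
  constructor
  · refine le_trans (le_of_eq ?_) (Finset.sum_le_sum fun i _ => (heig i).1.le)
    simp [mul_comm]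
  · refine (Finset.sum_le_sum fun i _ => (heig i).2.le).trans (le_of_eq ?_)
    simp [mul_comm]

include heig in
/-- Concentration of `u ↦ ‖Σ^{1/2} u‖²` around its mean. -/
lemma integral_norm_sqrtMap_sub_sq_le (hp : 0 < p) (hη : 0 < η) :
    ∫ u, (‖sqrtMap Sig u.1‖ ^ 2 - Sig.trace / p) ^ 2 ∂uniformSphere p ≤ 64 / (p * η ^ 2) := by
  have hp' : (0 : ℝ) < p := by exact_mod_cast hp
  set b := hS.isHermitian.eigenvectorBasis with hb
  set τ := Sig.trace / p with hτ
  have htr : Sig.trace = ∑ i, hS.isHermitian.eigenvalues i := by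
    simpa using hS.isHermitian.trace_eq_sum_eigenvalues
  have hτ1 : η ≤ τ ∧ τ ≤ 1 / η := by
    have := mul_le_trace hS heig
    exact ⟨by rw [hτ, le_div_iff₀ hp']; exact this.1, by rw [hτ, div_le_iff₀ hp']; exact this.2⟩
  let d : Fin p → ℝ := fun k => hS.isHermitian.eigenvalues k - τ
  have hd : ∑ k, d k = 0 := by
    simp only [d, Finset.sum_sub_distrib, ← htr, Finset.sum_const, Finset.card_univ,
      Fintype.card_fin, nsmul_eq_mul, hτ]
    field_simp; ring
  have hd2 : ∀ k, d k ^ 2 ≤ 1 / η ^ 2 := fun k => by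
    have h1 := heig k
    rw [← one_div_pow]
    exact sq_le_sq' (by simp only [d]; linarith) (by simp only [d]; linarith)
  have hrw : ∀ u : Metric.sphere (0 : Vec p) 1, ‖sqrtMap Sig u.1‖ ^ 2 - τ =
      ∑ k, d k * inner ℝ (b k) u.1 ^ 2 := fun u => by
    simp only [d, sub_mul, Finset.sum_sub_distrib, ← Finset.mul_sum, sum_inner_sq_sphere, mul_one]
    rw [norm_sqrtMap_sq hS]
  simp only [hrw]
  refine (integral_quadratic_sq_le b hp hd).trans ?_
  calc 64 / (p : ℝ) ^ 2 * ∑ k, d k ^ 2 ≤ 64 / (p : ℝ) ^ 2 * ∑ _k : Fin p, 1 / η ^ 2 :=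
        mul_le_mul_of_nonneg_left (Finset.sum_le_sum fun k _ => hd2 k) (by positivity)
    _ = _ := by
        simp only [Finset.sum_const, Finset.card_univ, Fintype.card_fin, nsmul_eq_mul]
        field_simp

end Sqrt

/-! ### Spatial signs under the elliptical law -/

lemma measurable_spatialSign {p : ℕ} : Measurable (spatialSign : Vec p → Vec p) := by
  unfold spatialSign; fun_prop

lemma norm_spatialSign {p : ℕ} {x : Vec p} (hx : x ≠ 0) : ‖spatialSign x‖ = 1 := by
  simp [spatialSign, norm_smul, hx]

lemma norm_spatialSign_le {p : ℕ} (x : Vec p) : ‖spatialSign x‖ ≤ 1 := by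
  by_cases hx : x = 0
  · simp [spatialSign, hx]
  · rw [norm_spatialSign hx]

/-- The radial variable may be negative, so the direction determines the sign vector only up to a
factor `±1`; hence the restriction to even functions below. -/
lemma spatialSign_smul {p : ℕ} {r : ℝ} (hr : r ≠ 0) (x : Vec p) :
    spatialSign (r • x) = spatialSign x ∨ spatialSign (r • x) = -spatialSign x := by
  unfold spatialSign
  rw [norm_smul, smul_smul, mul_inv, Real.norm_eq_abs]
  rcases lt_or_gt_of_ne hr with h | h
  · right; rw [abs_of_neg h, inv_neg, neg_mul, neg_mul, mul_right_comm, inv_mul_cancel₀ hr, one_mul,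
      neg_smul]
  · left; rw [abs_of_pos h, mul_right_comm, inv_mul_cancel₀ hr, one_mul]

lemma spatialSign_smul_of_pos {p : ℕ} {r : ℝ} (hr : 0 < r) (x : Vec p) :
    spatialSign (r • x) = spatialSign x := by
  unfold spatialSign
  rw [norm_smul, smul_smul, mul_inv, Real.norm_of_nonneg hr.le, mul_right_comm,
    inv_mul_cancel₀ hr.ne', one_mul]

section Law

variable {p : ℕ} {μ : Vec p} {Sig : Mat p} {ρ : Measure ℝ}

/-- The map `(r, u) ↦ μ + r Σ^{1/2} u`. -/
def ellipticalMap (μ : Vec p) (Sig : Mat p) (z : ℝ × Metric.sphere (0 : Vec p) 1) : Vec p :=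
  μ + z.1 • sqrtMap Sig (z.2 : Vec p)

lemma ellipticalLaw_eq : ellipticalLaw μ Sig ρ =
    (ρ.prod (uniformSphere p)).map (ellipticalMap μ Sig) := rfl

lemma measurable_ellipticalMap : Measurable (ellipticalMap μ Sig) := by
  unfold ellipticalMap; fun_prop

lemma isProbabilityMeasure_ellipticalLaw (hp : 0 < p) [IsProbabilityMeasure ρ] :
    IsProbabilityMeasure (ellipticalLaw μ Sig ρ) := by
  have := isProbabilityMeasure_uniformSphere hp
  rw [ellipticalLaw_eq]
  exact Measure.isProbabilityMeasure_map measurable_ellipticalMap.aemeasurable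

/-- The inverse radius is infinite at the centre, so a finite first inverse moment excludes an atom
there. -/
lemma ae_ne_of_zetaMom_ne_top {L : Measure (Vec p)} (h : zetaMom L μ 1 ≠ ∞) :
    ∀ᵐ x ∂L, x ≠ μ := by
  have hm : Measurable fun x : Vec p => (‖x - μ‖ₑ⁻¹) ^ 1 := by fun_prop
  filter_upwards [ae_lt_top hm h] with x hx hxμ
  simp [hxμ] at hx

/-- The expectation of an even function of the spatial sign. -/
lemma integral_even_spatialSign (hp : 0 < p) [IsProbabilityMeasure ρ]
    (hne : ∀ᵐ x ∂ellipticalLaw μ Sig ρ, x ≠ μ) {F : Vec p → ℝ} (hF : Measurable F)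
    (heven : ∀ x, F (-x) = F x) :
    ∫ x, F (spatialSign (x - μ)) ∂ellipticalLaw μ Sig ρ =
      ∫ u, F (spatialSign (sqrtMap Sig u.1)) ∂uniformSphere p := by
  have := isProbabilityMeasure_uniformSphere hp
  have hFm : Measurable fun x => F (spatialSign (x - μ)) :=
    hF.comp (measurable_spatialSign.comp (measurable_id.sub_const μ))
  rw [ellipticalLaw_eq] at hne ⊢
  rw [integral_map measurable_ellipticalMap.aemeasurable hFm.aestronglyMeasurable]
  have hne' := ae_of_ae_map measurable_ellipticalMap.aemeasurable hne
  have h1 : ∫ z, F (spatialSign (ellipticalMap μ Sig z - μ)) ∂ρ.prod (uniformSphere p) =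
      ∫ z, F (spatialSign (sqrtMap Sig z.2.1)) ∂ρ.prod (uniformSphere p) := by
    refine integral_congr_ae ?_
    filter_upwards [hne'] with z hz
    have hr : z.1 ≠ 0 := fun h0 => hz (by simp [ellipticalMap, h0])
    rw [ellipticalMap, add_sub_cancel_left]
    rcases spatialSign_smul hr (sqrtMap Sig z.2.1) with h | h <;> rw [h]
    rw [heven]
  rw [h1, integral_fun_snd (fun u : Metric.sphere (0 : Vec p) 1 => F (spatialSign (sqrtMap Sig u.1)))]
  simp

/-- The spatial signs are centred. -/
lemma integral_inner_spatialSign (hp : 0 < p) [IsProbabilityMeasure ρ] (e : Vec p) :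
    ∫ x, inner ℝ e (spatialSign (x - μ)) ∂ellipticalLaw μ Sig ρ = 0 := by
  have := isProbabilityMeasure_uniformSphere hp
  have hFm : Measurable fun x : Vec p => inner ℝ e (spatialSign (x - μ)) :=
    Measurable.inner measurable_const (measurable_spatialSign.comp (measurable_id.sub_const μ))
  rw [ellipticalLaw_eq,
    integral_map measurable_ellipticalMap.aemeasurable hFm.aestronglyMeasurable]
  rw [integral_prod]
  · refine integral_eq_zero_of_ae (Filter.Eventually.of_forall fun r => ?_)
    simp only [ellipticalMap, add_sub_cancel_left, Pi.zero_apply]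
    have h := (measurePreserving_sphereMap (LinearIsometryEquiv.neg ℝ (E := Vec p)))
    have hm : Measurable fun u : Metric.sphere (0 : Vec p) 1 =>
        inner ℝ e (spatialSign (r • sqrtMap Sig u.1)) :=
      Measurable.inner measurable_const (measurable_spatialSign.comp (by fun_prop))
    have h2 := integral_map (μ := uniformSphere p) h.measurable.aemeasurable
      (f := fun u : Metric.sphere (0 : Vec p) 1 => inner ℝ e (spatialSign (r • sqrtMap Sig u.1)))
      hm.aestronglyMeasurable
    rw [h.map_eq] at h2
    have h3 : ∀ u : Metric.sphere (0 : Vec p) 1, inner ℝ e (spatialSign (r • sqrtMap Sig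
        (sphereMap (LinearIsometryEquiv.neg ℝ (E := Vec p)) u).1)) =
        -inner ℝ e (spatialSign (r • sqrtMap Sig u.1)) := fun u => by
      simp [sphereMap, spatialSign]
    simp only [h3, integral_neg] at h2
    linarith
  · refine Integrable.of_bound (C := ‖e‖) (hFm.comp measurable_ellipticalMap).aestronglyMeasurable
      (Filter.Eventually.of_forall fun z => ?_)
    refine (norm_inner_le_norm _ _).trans ?_
    exact mul_le_of_le_one_right (norm_nonneg _) (norm_spatialSign_le _)

variable {η : ℝ} (hS : Sig.PosDef)
  (heig : ∀ i, η < hS.isHermitian.eigenvalues i ∧ hS.isHermitian.eigenvalues i < 1 / η)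

include heig in
/-- The spatial signs are uniformly sub-Gaussian at the scale `1 / √p`. -/
lemma integral_exp_inner_spatialSign_sq (hp : 0 < p) (hη : 0 < η) [IsProbabilityMeasure ρ]
    (hne : ∀ᵐ x ∂ellipticalLaw μ Sig ρ, x ≠ μ) {e : Vec p} (he : ‖e‖ ≤ 1) :
    ∫ x, Real.exp (η ^ 2 / 4 * p * inner ℝ e (spatialSign (x - μ)) ^ 2) ∂ellipticalLaw μ Sig ρ ≤
      2 := by
  rw [integral_even_spatialSign hp hne
    (F := fun y => Real.exp (η ^ 2 / 4 * p * inner ℝ e y ^ 2)) (by fun_prop) (by simp)]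
  -- One factor `η` of the exponent normalizes `Σ^{1/2} e` here; the other comes from `‖Σ^{1/2} u‖²
  -- ≥ η` in the denominator of the sign.
  have hnorm : ‖Real.sqrt η • sqrtMap Sig e‖ ≤ 1 := by
    have h1 := norm_sqrtMap_sq_le hS heig e
    rw [norm_smul, Real.norm_of_nonneg (Real.sqrt_nonneg _)]
    refine (sq_le_one_iff₀ (by positivity)).1 ?_
    rw [mul_pow, Real.sq_sqrt hη.le]
    calc η * ‖sqrtMap Sig e‖ ^ 2 ≤ η * (1 / η * ‖e‖ ^ 2) := mul_le_mul_of_nonneg_left h1 hη.le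
      _ = ‖e‖ ^ 2 := by field_simp
      _ ≤ 1 := by nlinarith [norm_nonneg e]
  refine le_trans ?_ (integral_exp_inner_sq hp hnorm)
  refine integral_mono_of_nonneg (Filter.Eventually.of_forall fun _ => (Real.exp_pos _).le)
    (integrable_uniformSphere hp (by fun_prop)) (Filter.Eventually.of_forall fun u => ?_)
  refine Real.exp_le_exp.2 ?_
  have hlow := le_norm_sqrtMap_sq hS heig u.1
  rw [norm_eq_of_mem_sphere, one_pow, mul_one] at hlow
  rw [spatialSign, inner_smul_right, inner_smul_left, inner_sqrtMap_comm, mul_pow, mul_pow, inv_pow]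
  simp only [conj_trivial]
  rw [Real.sq_sqrt hη.le]
  have hpos : 0 < ‖sqrtMap Sig u.1‖ ^ 2 := hη.trans_le hlow
  have hinv : (‖sqrtMap Sig u.1‖ ^ 2)⁻¹ ≤ η⁻¹ := inv_anti₀ hη hlow
  calc η ^ 2 / 4 * p * ((‖sqrtMap Sig u.1‖ ^ 2)⁻¹ * inner ℝ e (sqrtMap Sig u.1) ^ 2)
      ≤ η ^ 2 / 4 * p * (η⁻¹ * inner ℝ e (sqrtMap Sig u.1) ^ 2) := by gcongr
    _ = p / 4 * (η * inner ℝ e (sqrtMap Sig u.1) ^ 2) := by field_simp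

include heig in
/-- The bias of the rescaled population spatial-sign covariance matrix. -/
lemma abs_popSSCM_sub_shape_le (hp : 0 < p) (hη : 0 < η) [IsProbabilityMeasure ρ]
    (hne : ∀ᵐ x ∂ellipticalLaw μ Sig ρ, x ≠ μ) (i j : Fin p) :
    |p * popSSCM (ellipticalLaw μ Sig ρ) μ i j - shape Sig i j| ≤ 64 / η ^ 4 / Real.sqrt p := by
  have hp' : (0 : ℝ) < p := by exact_mod_cast hp
  have hsp : 0 < Real.sqrt p := Real.sqrt_pos.2 hp'
  set τ := Sig.trace / p with hτ
  have hτη : η ≤ τ := by rw [hτ, le_div_iff₀ hp']; exact (mul_le_trace hS heig).1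
  have hτ0 : 0 < τ := hη.trans_le hτη
  set x := sqrtMap Sig (EuclideanSpace.single i 1) with hx
  set y := sqrtMap Sig (EuclideanSpace.single j 1) with hy
  have hcoord : ∀ (k : Fin p) (u : Vec p), (sqrtMap Sig u) k =
      inner ℝ (sqrtMap Sig (EuclideanSpace.single k 1)) u := fun k u => by
    rw [inner_sqrtMap_comm]; simp [EuclideanSpace.inner_single_left]
  have hS1 : popSSCM (ellipticalLaw μ Sig ρ) μ i j =
      ∫ u, inner ℝ x u.1 * inner ℝ y u.1 / ‖sqrtMap Sig u.1‖ ^ 2 ∂uniformSphere p := by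
    rw [popSSCM, Matrix.of_apply, integral_even_spatialSign hp hne
      (F := fun w : Vec p => w i * w j) (by fun_prop) (by simp)]
    refine integral_congr_ae (Filter.Eventually.of_forall fun u => ?_)
    simp only [spatialSign, PiLp.smul_apply, smul_eq_mul, hcoord i, hcoord j]
    rw [← hx, ← hy]
    field_simp
  -- The shape matrix is the same average as in `hS1` with the random denominator replaced by its
  -- mean `τ`.
  have hS2 : shape Sig i j = p * ∫ u, inner ℝ x u.1 * inner ℝ y u.1 / τ ∂uniformSphere p := by
    rw [integral_div, integral_inner_mul_inner hp, hx, hy, inner_sqrtMap_single hS, shape,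
      Matrix.smul_apply, smul_eq_mul, hτ]
    have htr : Sig.trace ≠ 0 := fun h0 => by rw [hτ, h0] at hτ0; simp at hτ0
    field_simp
  have hlow : ∀ u : Metric.sphere (0 : Vec p) 1, η ≤ ‖sqrtMap Sig u.1‖ ^ 2 := fun u => by
    have h := le_norm_sqrtMap_sq hS heig u.1
    rwa [norm_eq_of_mem_sphere, one_pow, mul_one] at h
  have hcont : Continuous fun u : Metric.sphere (0 : Vec p) 1 =>
      inner ℝ x u.1 * inner ℝ y u.1 / ‖sqrtMap Sig u.1‖ ^ 2 :=
    Continuous.div (by fun_prop) (by fun_prop) fun u => (hη.trans_le (hlow u)).ne'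
  rw [hS1, hS2, ← mul_sub, ← integral_sub (integrable_uniformSphere hp hcont)
    (integrable_uniformSphere hp (by fun_prop)), ← integral_const_mul]
  rw [← Real.norm_eq_abs]
  have hfour : ∀ k : Fin p, ∫ u, inner ℝ (sqrtMap Sig (EuclideanSpace.single k 1)) u.1 ^ 4
      ∂uniformSphere p ≤ 64 / (η ^ 2 * (p : ℝ) ^ 2) := fun k => by
    set w := sqrtMap Sig (EuclideanSpace.single k 1)
    have hw : ‖Real.sqrt η • w‖ ≤ 1 := by
      have h1 := norm_sqrtMap_sq_le hS heig (EuclideanSpace.single k 1)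
      rw [norm_smul, Real.norm_of_nonneg (Real.sqrt_nonneg _)]
      refine (sq_le_one_iff₀ (by positivity)).1 ?_
      rw [mul_pow, Real.sq_sqrt hη.le]
      calc η * ‖w‖ ^ 2 ≤ η * (1 / η * ‖(EuclideanSpace.single k 1 : Vec p)‖ ^ 2) :=
            mul_le_mul_of_nonneg_left h1 hη.le
        _ = 1 := by simp [hη.ne']
    have h2 := integral_inner_pow_four_le hp hw
    have h3 : ∀ u : Vec p, inner ℝ (Real.sqrt η • w) u ^ 4 = η ^ 2 * inner ℝ w u ^ 4 := fun u => by
      rw [inner_smul_left, mul_pow]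
      simp only [conj_trivial]
      rw [show (4 : ℕ) = 2 * 2 from rfl, pow_mul (Real.sqrt η), Real.sq_sqrt hη.le]
    simp only [h3, integral_const_mul] at h2
    rw [le_div_iff₀ (by positivity)]
    rw [le_div_iff₀ (by positivity)] at h2
    linarith
  have hvar := integral_norm_sqrtMap_sub_sq_le hS heig hp hη
  rw [← hτ] at hvar
  -- The product of `p ⟨x, u⟩ ⟨y, u⟩`, of order one, and `‖Σ^{1/2} u‖² - τ`, of order `1 / √p`, is
  -- split by the arithmetic-geometric mean inequality with weight `√p`, so that both parts
  -- integrate to order `1 / √p`.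
  let B : Metric.sphere (0 : Vec p) 1 → ℝ := fun u =>
    (p ^ 2 / Real.sqrt p * ((inner ℝ x u.1 ^ 4 + inner ℝ y u.1 ^ 4) / 2) +
      Real.sqrt p * (‖sqrtMap Sig u.1‖ ^ 2 - τ) ^ 2) / (2 * η ^ 2)
  refine (norm_integral_le_of_norm_le (g := B) (integrable_uniformSphere hp (by fun_prop))
    (Filter.Eventually.of_forall fun u => ?_)).trans ?_
  · rw [Real.norm_eq_abs]
    set α := inner ℝ x u.1 with hα
    set β := inner ℝ y u.1 with hβ
    set s := ‖sqrtMap Sig u.1‖ ^ 2 with hs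
    have hs0 : η ≤ s := hlow u
    have hspos : 0 < s := hη.trans_le hs0
    have e1 : (p : ℝ) * (α * β / s - α * β / τ) = p * (α * β) * (τ - s) / (s * τ) := by
      field_simp
    rw [e1, abs_div, abs_mul, abs_of_pos (mul_pos hspos hτ0)]
    have e2 : |(p : ℝ) * (α * β)| * |τ - s| ≤
        (p ^ 2 / Real.sqrt p * ((α ^ 4 + β ^ 4) / 2) + Real.sqrt p * (s - τ) ^ 2) / 2 := by
      have h1 : |(p : ℝ) * (α * β)| ^ 2 ≤ p ^ 2 * ((α ^ 4 + β ^ 4) / 2) := by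
        rw [sq_abs, mul_pow]
        refine mul_le_mul_of_nonneg_left ?_ (by positivity)
        nlinarith [sq_nonneg (α ^ 2 - β ^ 2)]
      have h2 : |τ - s| ^ 2 = (s - τ) ^ 2 := by rw [sq_abs]; ring
      have h3 := sq_nonneg (|(p : ℝ) * (α * β)| - Real.sqrt p * |τ - s|)
      have h4 : 2 * (|(p : ℝ) * (α * β)| * |τ - s|) ≤
          |(p : ℝ) * (α * β)| ^ 2 / Real.sqrt p + Real.sqrt p * |τ - s| ^ 2 := by
        rw [← sub_nonneg]
        have : |(p : ℝ) * (α * β)| ^ 2 / Real.sqrt p + Real.sqrt p * |τ - s| ^ 2 -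
          2 * (|(p : ℝ) * (α * β)| * |τ - s|) =
          (|(p : ℝ) * (α * β)| - Real.sqrt p * |τ - s|) ^ 2 / Real.sqrt p := by
          generalize |(p : ℝ) * (α * β)| = A
          field_simp
          ring
        rw [this]; positivity
      have h5 : |(p : ℝ) * (α * β)| ^ 2 / Real.sqrt p ≤
          p ^ 2 / Real.sqrt p * ((α ^ 4 + β ^ 4) / 2) := by
        rw [div_mul_eq_mul_div]
        exact div_le_div_of_nonneg_right h1 hsp.le
      rw [h2] at h4
      linarith
    have e3 : η ^ 2 ≤ s * τ := by rw [sq]; exact mul_le_mul hs0 hτη hη.le hspos.le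
    calc |(p : ℝ) * (α * β)| * |τ - s| / (s * τ) ≤ |(p : ℝ) * (α * β)| * |τ - s| / η ^ 2 :=
          div_le_div_of_nonneg_left (by positivity) (by positivity) e3
      _ ≤ _ := (div_le_div_of_nonneg_right e2 (by positivity)).trans (le_of_eq (by
          simp only [B, ← hα, ← hβ, ← hs]; field_simp))
  · simp only [B]
    rw [integral_div, integral_add (integrable_uniformSphere hp (by fun_prop))
      (integrable_uniformSphere hp (by fun_prop)), integral_const_mul, integral_const_mul,
      integral_div, integral_add (integrable_uniformSphere hp (by fun_prop))
      (integrable_uniformSphere hp (by fun_prop))]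
    have h1 := hfour i
    have h2 := hfour j
    rw [← hx] at h1
    rw [← hy] at h2
    have hss : Real.sqrt p * Real.sqrt p = p := Real.mul_self_sqrt hp'.le
    calc _ ≤ ((p : ℝ) ^ 2 / Real.sqrt p * ((64 / (η ^ 2 * (p : ℝ) ^ 2) +
            64 / (η ^ 2 * (p : ℝ) ^ 2)) / 2) + Real.sqrt p * (64 / (p * η ^ 2))) / (2 * η ^ 2) := by
          gcongr
      _ = _ := by
          have : (64 : ℝ) / (p * η ^ 2) = 64 / (Real.sqrt p * Real.sqrt p * η ^ 2) := by rw [hss]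
          rw [this]
          field_simp
          ring

end Law

/-! ### The standardized inverse radius -/

section InvRadius

variable {p : ℕ} {μ : Vec p} {L : Measure (Vec p)}

lemma measurable_invRadius : Measurable (invRadius L μ) := by
  unfold invRadius; fun_prop

lemma invRadius_nonneg (x : Vec p) : 0 ≤ invRadius L μ x := by
  unfold invRadius; positivity

lemma lintegral_invRadius (h0 : zetaMom L μ 1 ≠ 0) (ht : zetaMom L μ 1 ≠ ∞) :
    ∫⁻ x, ENNReal.ofReal (invRadius L μ x) ∂L = 1 := by
  have hz : 0 < (zetaMom L μ 1).toReal := ENNReal.toReal_pos h0 ht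
  have h1 : ∀ᵐ x ∂L, ENNReal.ofReal (invRadius L μ x) =
      (zetaMom L μ 1)⁻¹ * (‖x - μ‖ₑ⁻¹) ^ 1 := by
    filter_upwards [ae_ne_of_zetaMom_ne_top ht] with x hx
    have hx' : 0 < ‖x - μ‖ := norm_pos_iff.2 (sub_ne_zero.2 hx)
    rw [invRadius, ENNReal.ofReal_mul (by positivity), ENNReal.ofReal_inv_of_pos hz,
      ENNReal.ofReal_inv_of_pos hx', ENNReal.ofReal_toReal ht, pow_one, ofReal_norm]
  rw [lintegral_congr_ae h1, lintegral_const_mul' _ _ (ENNReal.inv_ne_top.2 h0)]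
  exact ENNReal.inv_mul_cancel h0 ht

/-- The `ψ₂` norm read at the even order `2 k`: the moment is at most `(K √(2k))^{2k}`. -/
lemma lintegral_invRadius_pow_le {K : ℝ} (hK : 0 < K)
    (h : psi2Norm (invRadius L μ) L ≤ ENNReal.ofReal K) {k : ℕ} (hk : 1 ≤ k) :
    ∫⁻ x, ENNReal.ofReal (invRadius L μ x ^ (2 * k)) ∂L ≤
      ENNReal.ofReal ((2 * K ^ 2 * k) ^ k) := by
  have h1 := (le_iSup₂ (f := fun (k : ℕ) (_ : 1 ≤ k) => ENNReal.ofReal ((k : ℝ) ^ (-(1 / 2) : ℝ)) *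
    eLpNorm (invRadius L μ) (k : ℝ≥0∞) L) (2 * k) (by lia)).trans h
  have hk' : (0 : ℝ) < k := by exact_mod_cast hk
  have hk2 : (0 : ℝ) < ((2 * k : ℕ) : ℝ) := by push_cast; positivity
  have h2 : eLpNorm (invRadius L μ) ((2 * k : ℕ) : ℝ≥0∞) L ≤
      ENNReal.ofReal (K * ((2 * k : ℕ) : ℝ) ^ (1 / 2 : ℝ)) := by
    calc eLpNorm (invRadius L μ) ((2 * k : ℕ) : ℝ≥0∞) L
        = ENNReal.ofReal (((2 * k : ℕ) : ℝ) ^ (1 / 2 : ℝ)) *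
          (ENNReal.ofReal (((2 * k : ℕ) : ℝ) ^ (-(1 / 2) : ℝ)) *
            eLpNorm (invRadius L μ) ((2 * k : ℕ) : ℝ≥0∞) L) := by
          rw [← mul_assoc, ← ENNReal.ofReal_mul (by positivity), ← Real.rpow_add hk2]
          simp
      _ ≤ ENNReal.ofReal (((2 * k : ℕ) : ℝ) ^ (1 / 2 : ℝ)) * ENNReal.ofReal K := by gcongr
      _ = _ := by rw [← ENNReal.ofReal_mul (by positivity), mul_comm]
  have hne : ((2 * k : ℕ) : ℝ≥0∞) ≠ 0 := by exact_mod_cast (by lia : 2 * k ≠ 0)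
  rw [eLpNorm_eq_lintegral_rpow_enorm_toReal hne (ENNReal.natCast_ne_top _)] at h2
  rw [ENNReal.toReal_natCast] at h2
  have h3 := ENNReal.rpow_le_rpow h2 hk2.le
  rw [← ENNReal.rpow_mul, one_div_mul_cancel hk2.ne', ENNReal.rpow_one, ENNReal.rpow_natCast,
    ← ENNReal.ofReal_pow (by positivity)] at h3
  calc ∫⁻ x, ENNReal.ofReal (invRadius L μ x ^ (2 * k)) ∂L
      = ∫⁻ x, ‖invRadius L μ x‖ₑ ^ ((2 * k : ℕ) : ℝ) ∂L := by
        refine lintegral_congr fun x => ?_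
        rw [ENNReal.rpow_natCast, Real.enorm_of_nonneg (invRadius_nonneg x),
          ENNReal.ofReal_pow (invRadius_nonneg x)]
    _ ≤ _ := h3
    _ = _ := by
        congr 1
        rw [pow_mul, mul_pow, ← Real.rpow_natCast (_ ^ (1 / 2 : ℝ)) 2, ← Real.rpow_mul hk2.le]
        norm_num
        ring

/-- The standardized inverse radius is sub-Gaussian. -/
lemma lintegral_exp_invRadius_sq_le {K : ℝ} (hK : 0 < K) [IsProbabilityMeasure L]
    (h : psi2Norm (invRadius L μ) L ≤ ENNReal.ofReal K) :
    ∫⁻ x, ENNReal.ofReal (Real.exp (1 / (4 * Real.exp 1 * K ^ 2) * invRadius L μ x ^ 2)) ∂L ≤ 2 := by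
  set θ := 1 / (4 * Real.exp 1 * K ^ 2) with hθ
  have hθ0 : 0 < θ := by positivity
  have hexp : ∀ x, ENNReal.ofReal (Real.exp (θ * invRadius L μ x ^ 2)) =
      ∑' k : ℕ, ENNReal.ofReal ((θ * invRadius L μ x ^ 2) ^ k / k.factorial) := fun x => by
    have hnn : ∀ k : ℕ, 0 ≤ (θ * invRadius L μ x ^ 2) ^ k / k.factorial := fun k => by positivity
    rw [← ENNReal.ofReal_tsum_of_nonneg hnn (Real.summable_pow_div_factorial _)]
    rw [Real.exp_eq_exp_ℝ, NormedSpace.exp_eq_tsum_div]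
  simp only [hexp]
  have hmν := measurable_invRadius (L := L) (μ := μ)
  rw [lintegral_tsum fun k => by fun_prop]
  -- The value of `θ` makes the exponential series geometric: by `k^k / k! ≤ e^k` the term of order
  -- `k` is at most `(2 e θ K²)^k = 2^{-k}`.
  have hterm : ∀ k : ℕ, ∫⁻ x, ENNReal.ofReal ((θ * invRadius L μ x ^ 2) ^ k / k.factorial) ∂L ≤
      (2⁻¹ : ℝ≥0∞) ^ k := fun k => by
    rcases Nat.eq_zero_or_pos k with rfl | hk
    · simp
    have hf : (0 : ℝ) < k.factorial := by exact_mod_cast k.factorial_pos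
    have e1 : ∀ x, ENNReal.ofReal ((θ * invRadius L μ x ^ 2) ^ k / k.factorial) =
        ENNReal.ofReal (θ ^ k / k.factorial) * ENNReal.ofReal (invRadius L μ x ^ (2 * k)) :=
      fun x => by
        rw [← ENNReal.ofReal_mul (by positivity)]
        congr 1; rw [mul_pow, ← pow_mul]; ring
    simp only [e1]
    rw [lintegral_const_mul' _ _ ENNReal.ofReal_ne_top]
    refine (mul_le_mul_right (lintegral_invRadius_pow_le hK h hk) _).trans ?_
    rw [← ENNReal.ofReal_mul (by positivity)]
    have e2 : (2⁻¹ : ℝ≥0∞) ^ k = ENNReal.ofReal ((1 / 2) ^ k) := by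
      rw [ENNReal.ofReal_pow (by norm_num), one_div, ENNReal.ofReal_inv_of_pos (by norm_num)]
      norm_num
    rw [e2]
    refine ENNReal.ofReal_le_ofReal ?_
    have e3 := Real.pow_div_factorial_le_exp (k : ℝ) (Nat.cast_nonneg k) k
    have e4 : Real.exp (k : ℝ) = Real.exp 1 ^ k := by rw [← Real.exp_nat_mul, mul_one]
    rw [e4] at e3
    calc θ ^ k / k.factorial * (2 * K ^ 2 * k) ^ k
        = (θ * (2 * K ^ 2)) ^ k * ((k : ℝ) ^ k / k.factorial) := by
          rw [mul_pow (2 * K ^ 2), mul_pow θ]; ring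
      _ ≤ (θ * (2 * K ^ 2)) ^ k * Real.exp 1 ^ k := by gcongr
      _ = (1 / 2) ^ k := by
          rw [← mul_pow]; congr 1; rw [hθ]; field_simp; norm_num
  refine (ENNReal.tsum_le_tsum hterm).trans ?_
  rw [ENNReal.tsum_geometric]
  norm_num

end InvRadius

end SCLIME

end

noncomputable section

namespace SCLIME

/-! ### Standardized spatial medians -/

/-- `z` minimizes the weighted sum of distances `∑ ν_i⁻¹ ‖a_i - ν_i z‖`. -/
def IsScaledMedian {n : ℕ} {E : Type*} [NormedAddCommGroup E] [NormedSpace ℝ E]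
    (a : Fin n → E) (ν : Fin n → ℝ) (z : E) : Prop :=
  ∀ z', ∑ i, (ν i)⁻¹ * ‖a i - ν i • z‖ ≤ ∑ i, (ν i)⁻¹ * ‖a i - ν i • z'‖

/-- The reparametrization on which the analysis of the median rests: the scalar factor is `‖x - μ‖`,
the bracket is `a - ν z` with `z = c (m - μ)`, and `c` will be `ζ₁`. -/
lemma sub_eq_smul_scaled {p : ℕ} {x μ m : Vec p} {c : ℝ} (hc : 0 < c) (hx : x ≠ μ) :
    x - m = (c⁻¹ * (c⁻¹ * ‖x - μ‖⁻¹)⁻¹) •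
      (spatialSign (x - μ) - (c⁻¹ * ‖x - μ‖⁻¹) • (c • (m - μ))) := by
  have hx' : ‖x - μ‖ ≠ 0 := norm_ne_zero_iff.2 (sub_ne_zero.2 hx)
  have h1 : c⁻¹ * (c⁻¹ * ‖x - μ‖⁻¹)⁻¹ = ‖x - μ‖ := by field_simp
  have h2 : ‖x - μ‖ * (c⁻¹ * ‖x - μ‖⁻¹) * c = 1 := by field_simp
  rw [h1, smul_sub, spatialSign, smul_smul, mul_inv_cancel₀ hx', one_smul, smul_smul, smul_smul, h2,
    one_smul]
  abel

lemma IsSpatialMedian.isScaledMedian {n p : ℕ} {x : Fin n → Vec p} {m μ : Vec p} {c : ℝ}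
    (hc : 0 < c) (hx : ∀ i, x i ≠ μ) (h : IsSpatialMedian x m) :
    IsScaledMedian (fun i => spatialSign (x i - μ)) (fun i => c⁻¹ * ‖x i - μ‖⁻¹) (c • (m - μ)) := by
  have key : ∀ m', ∑ i, ‖x i - m'‖ = c⁻¹ * ∑ i, (c⁻¹ * ‖x i - μ‖⁻¹)⁻¹ *
      ‖spatialSign (x i - μ) - (c⁻¹ * ‖x i - μ‖⁻¹) • (c • (m' - μ))‖ := fun m' => by
    rw [Finset.mul_sum]
    refine Finset.sum_congr rfl fun i _ => ?_
    conv_lhs => rw [sub_eq_smul_scaled (m := m') hc (hx i), norm_smul,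
      Real.norm_of_nonneg (by positivity)]
    rw [mul_assoc]
  intro z'
  have h1 := h (c⁻¹ • z' + μ)
  rw [key, key, mul_le_mul_iff_right₀ (by positivity)] at h1
  simpa [smul_smul, hc.ne'] using h1

/-! ### Convexity and subgradient estimates for scaled medians -/

section Inner

variable {E : Type*} [NormedAddCommGroup E] [InnerProductSpace ℝ E]

/-- A quantitative convexity estimate for the norm at a unit vector. -/
lemma norm_sub_lower {a b : E} (ha : ‖a‖ = 1) :
    1 - inner ℝ a b + (‖b‖ ^ 2 - inner ℝ a b ^ 2) / (2 * (1 + ‖b‖)) ≤ ‖a - b‖ := by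
  set t := inner ℝ a b with ht
  have habs : |t| ≤ ‖b‖ := by
    have := abs_real_inner_le_norm a b
    rwa [ha, one_mul] at this
  have hb := norm_nonneg b
  set y := ‖b‖ ^ 2 - t ^ 2 with hy
  have hy0 : 0 ≤ y := by
    rw [hy, sub_nonneg, ← sq_abs t]; exact pow_le_pow_left₀ (abs_nonneg _) habs 2
  have hsq : ‖a - b‖ ^ 2 = (1 - t) ^ 2 + y := by
    rw [norm_sub_sq_real, ha, hy]; ring
  have hle : ‖a - b‖ ≤ 1 + ‖b‖ := by
    have := norm_sub_le a b; rwa [ha] at this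
  have ht1 : 1 - t ≤ 1 + ‖b‖ := by have := neg_abs_le t; linarith
  have hge : 1 - t ≤ ‖a - b‖ := by
    refine le_of_abs_le ?_
    rw [← abs_of_nonneg (norm_nonneg (a - b))]
    exact sq_le_sq.1 (by rw [hsq]; linarith)
  -- Here `y` is the squared length of the part of `b` orthogonal to `a`; dividing by the second
  -- factor, at most `2 (1 + ‖b‖)`, gives the gain over linearity.
  have hprod : (‖a - b‖ - (1 - t)) * (‖a - b‖ + (1 - t)) = y := by
    have : ‖a - b‖ * ‖a - b‖ = (1 - t) ^ 2 + y := by rw [← sq, hsq]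
    linear_combination this
  have : y ≤ (‖a - b‖ - (1 - t)) * (2 * (1 + ‖b‖)) := by
    rw [← hprod]
    exact mul_le_mul_of_nonneg_left (by linarith) (by linarith)
  have := (div_le_iff₀ (by positivity : 0 < 2 * (1 + ‖b‖))).2 this
  linarith

/-- Curvature can thus be bounded below through the truncated radii `min ν 1`, which are bounded and
concentrate easily. -/
lemma min_div_le_div {ν t : ℝ} (hν : 0 < ν) (ht : 0 ≤ t) : min ν 1 / (1 + t) ≤ ν / (1 + ν * t) := by
  rw [div_le_div_iff₀ (by positivity) (by positivity)]
  rcases le_total ν 1 with h | h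
  · rw [min_eq_left h]
    exact mul_le_mul_of_nonneg_left (by nlinarith) hν.le
  · rw [min_eq_right h]; nlinarith

variable {n : ℕ} {a : Fin n → E} {ν : Fin n → ℝ} {z : E}

/-- Consistency of a scaled median in the Euclidean norm. -/
lemma IsScaledMedian.norm_le (hz : IsScaledMedian a ν z) (hn : 0 < n) (ha : ∀ i, ‖a i‖ = 1)
    (hν : ∀ i, 0 < ν i) {c α : ℝ} (hc : 0 < c) (hmin : n * c ≤ ∑ i, min (ν i) 1)
    (hop : ∑ i, inner ℝ (a i) z ^ 2 ≤ n * (c / 2) * ‖z‖ ^ 2) (hα : ‖∑ i, a i‖ ≤ n * α)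
    (hαc : α ≤ c / 8) : ‖z‖ ≤ 8 / c * α ∧ ‖z‖ ≤ 1 := by
  have hn' : (0 : ℝ) < n := by exact_mod_cast hn
  set r := ‖z‖ with hr
  have hr0 : 0 ≤ r := norm_nonneg z
  have h0 := hz 0
  -- The minimizer is compared with the origin. Summed over `i`, the linear terms give at most `n α
  -- r`, while the quadratic terms are at least of order `n c r² / (1 + r)`.
  have hterm : ∀ i, (ν i)⁻¹ * ‖a i - ν i • (0 : E)‖ - inner ℝ (a i) z +
      (min (ν i) 1 * r ^ 2 - inner ℝ (a i) z ^ 2) / (2 * (1 + r)) ≤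
      (ν i)⁻¹ * ‖a i - ν i • z‖ := fun i => by
    have h1 := norm_sub_lower (b := ν i • z) (ha i)
    rw [inner_smul_right, norm_smul, Real.norm_of_nonneg (hν i).le, ← hr] at h1
    have h2 := mul_le_mul_of_nonneg_left h1 (inv_nonneg.2 (hν i).le)
    refine le_trans ?_ h2
    rw [smul_zero, sub_zero, ha i]
    set t := inner ℝ (a i) z with ht
    have hrt : t ^ 2 ≤ r ^ 2 := by
      have h3 := abs_real_inner_le_norm (a i) z
      rw [ha i, one_mul, ← hr] at h3
      rw [← sq_abs t]; exact pow_le_pow_left₀ (abs_nonneg _) h3 2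
    have e1 : (ν i)⁻¹ * (1 - ν i * t + ((ν i * r) ^ 2 - (ν i * t) ^ 2) / (2 * (1 + ν i * r))) =
        (ν i)⁻¹ * 1 - t + (ν i / (1 + ν i * r)) * ((r ^ 2 - t ^ 2) / 2) := by
      have := (hν i).ne'
      have h4 : 1 + ν i * r ≠ 0 := by have := hν i; positivity
      field_simp
    rw [e1]
    have h5 := mul_le_mul_of_nonneg_right (min_div_le_div (hν i) hr0)
      (by linarith : 0 ≤ (r ^ 2 - t ^ 2) / 2)
    have h6 : (min (ν i) 1 * r ^ 2 - t ^ 2) / (2 * (1 + r)) ≤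
        min (ν i) 1 / (1 + r) * ((r ^ 2 - t ^ 2) / 2) := by
      rw [div_mul_div_comm, mul_comm (1 + r) 2]
      refine div_le_div_of_nonneg_right ?_ (by positivity)
      have : min (ν i) 1 ≤ 1 := min_le_right _ _
      nlinarith [sq_nonneg t]
    linarith
  have hsum := Finset.sum_le_sum fun i (_ : i ∈ Finset.univ) => hterm i
  rw [Finset.sum_add_distrib, Finset.sum_sub_distrib, ← Finset.sum_div, Finset.sum_sub_distrib,
    ← Finset.sum_mul, ← sum_inner] at hsum
  have h1 : inner ℝ (∑ i, a i) z ≤ n * α * r :=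
    (real_inner_le_norm _ _).trans (mul_le_mul_of_nonneg_right hα hr0)
  have h2 : n * (c / 2) * r ^ 2 / (2 * (1 + r)) ≤ n * α * r := by
    refine le_trans (div_le_div_of_nonneg_right (c := 2 * (1 + r)) ?_ (by positivity))
      ((by linarith : _ ≤ inner ℝ (∑ i, a i) z).trans h1)
    have := mul_le_mul_of_nonneg_right hmin (sq_nonneg r)
    linarith
  rw [div_le_iff₀ (by positivity)] at h2
  -- With `α ≤ c / 8` this first forces `r ≤ 1`, and reinserting `1 + r ≤ 2` gives `r ≤ 8 α / c`.
  have h3 : r * (c * r) ≤ r * (4 * α * (1 + r)) := by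
    have : (n : ℝ) * (r * (c * r)) ≤ n * (r * (4 * α * (1 + r))) := by linarith
    exact le_of_mul_le_mul_left this hn'
  rcases hr0.eq_or_lt with h | h
  · have hα0 : 0 ≤ α := by
      have := (norm_nonneg _).trans hα
      exact nonneg_of_mul_nonneg_right (by linarith) hn'
    rw [← h]; exact ⟨by positivity, zero_le_one⟩
  · have h4 := le_of_mul_le_mul_left h3 h
    have h5 : r ≤ 1 := by nlinarith
    refine ⟨?_, h5⟩
    have hα0 : 0 ≤ α := by
      have := (norm_nonneg _).trans hα
      exact nonneg_of_mul_nonneg_right (by linarith) hn'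
    rw [div_mul_eq_mul_div, le_div_iff₀ hc]
    nlinarith

/-- The inequality `2 ‖y - w‖ ‖y‖ ≤ ‖y - w‖² + ‖y‖²`, rearranged: a second-order expansion of the
norm with an explicit remainder. -/
lemma norm_sub_upper {y w : E} (hy : y ≠ 0) :
    ‖y - w‖ ≤ ‖y‖ - inner ℝ y w / ‖y‖ + ‖w‖ ^ 2 / (2 * ‖y‖) := by
  have hpos : 0 < ‖y‖ := norm_pos_iff.2 hy
  have h1 := norm_sub_sq_real y w
  have h2 : ‖y‖ - inner ℝ y w / ‖y‖ + ‖w‖ ^ 2 / (2 * ‖y‖) =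
      (‖y - w‖ ^ 2 + ‖y‖ ^ 2) / (2 * ‖y‖) := by
    rw [h1]; field_simp; ring
  rw [h2, le_div_iff₀ (by positivity)]
  nlinarith [sq_nonneg (‖y - w‖ - ‖y‖)]

/-- The subgradient condition: the sum of the spatial signs over any set of regular indices has
norm at most the number of remaining indices. -/
lemma IsScaledMedian.norm_sum_sign_le (hz : IsScaledMedian a ν z) (hν : ∀ i, 0 < ν i)
    (G : Finset (Fin n)) (hG : ∀ i ∈ G, a i - ν i • z ≠ 0) :
    ‖∑ i ∈ G, ‖a i - ν i • z‖⁻¹ • (a i - ν i • z)‖ ≤ (Gᶜ.card : ℝ) := by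
  set h := ∑ i ∈ G, ‖a i - ν i • z‖⁻¹ • (a i - ν i • z) with hh
  by_contra hlt
  rw [not_le] at hlt
  have hpos : 0 < ‖h‖ := lt_of_le_of_lt (Nat.cast_nonneg _) hlt
  set A := ∑ i ∈ G, ν i * ‖h‖ ^ 2 / (2 * ‖a i - ν i • z‖) with hA
  have hA0 : 0 ≤ A := Finset.sum_nonneg fun i _ => by have := hν i; positivity
  -- Perturb `z` to `z + t h`. The indices in `G` gain `t ‖h‖²` up to a remainder `t² A`, each other
  -- index loses at most `t ‖h‖`, and minimality forbids a net gain. A small `t` then contradicts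
  -- `‖h‖ > |Gᶜ|`.
  have key : ∀ t : ℝ, 0 < t → ‖h‖ ^ 2 - Gᶜ.card * ‖h‖ ≤ t * A := fun t ht => by
    have h1 := hz (z + t • h)
    have hin : ∀ i ∈ G, (ν i)⁻¹ * ‖a i - ν i • (z + t • h)‖ ≤ (ν i)⁻¹ * ‖a i - ν i • z‖ -
        t * inner ℝ (‖a i - ν i • z‖⁻¹ • (a i - ν i • z)) h +
        t ^ 2 * (ν i * ‖h‖ ^ 2 / (2 * ‖a i - ν i • z‖)) := fun i hi => by
      have h2 := norm_sub_upper (w := (ν i * t) • h) (hG i hi)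
      have h3 : a i - ν i • (z + t • h) = a i - ν i • z - (ν i * t) • h := by
        rw [smul_add, smul_smul]; abel
      rw [h3]
      refine (mul_le_mul_of_nonneg_left h2 (inv_nonneg.2 (hν i).le)).trans (le_of_eq ?_)
      rw [inner_smul_left, inner_smul_right, norm_smul, Real.norm_of_nonneg (by
        have := hν i; positivity)]
      simp only [conj_trivial]
      have := (hν i).ne'
      have := norm_ne_zero_iff.2 (hG i hi)
      field_simp
    have hout : ∀ i ∈ Gᶜ, (ν i)⁻¹ * ‖a i - ν i • (z + t • h)‖ ≤ (ν i)⁻¹ * ‖a i - ν i • z‖ +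
        t * ‖h‖ := fun i _ => by
      have h3 : a i - ν i • (z + t • h) = a i - ν i • z - (ν i * t) • h := by
        rw [smul_add, smul_smul]; abel
      rw [h3]
      refine (mul_le_mul_of_nonneg_left (norm_sub_le _ _) (inv_nonneg.2 (hν i).le)).trans
        (le_of_eq ?_)
      rw [norm_smul, Real.norm_of_nonneg (by have := hν i; positivity)]
      have := (hν i).ne'
      field_simp
    have h4 := add_le_add (Finset.sum_le_sum hin) (Finset.sum_le_sum hout)
    rw [Finset.sum_add_sum_compl] at h4
    rw [Finset.sum_add_distrib, Finset.sum_add_distrib, Finset.sum_sub_distrib, ← Finset.mul_sum,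
      ← Finset.mul_sum, ← sum_inner, ← hh, real_inner_self_eq_norm_sq, Finset.sum_const,
      nsmul_eq_mul, ← hA] at h4
    have h5 := Finset.sum_add_sum_compl G fun i => (ν i)⁻¹ * ‖a i - ν i • z‖
    have h6 : t * (‖h‖ ^ 2 - Gᶜ.card * ‖h‖) ≤ t * (t * A) := by nlinarith
    exact le_of_mul_le_mul_left h6 ht
  have hgap : 0 < ‖h‖ ^ 2 - Gᶜ.card * ‖h‖ := by
    have : 0 < ‖h‖ * (‖h‖ - Gᶜ.card) := mul_pos hpos (by linarith)
    nlinarith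
  have h7 := key ((‖h‖ ^ 2 - Gᶜ.card * ‖h‖) / (2 * (A + 1))) (by positivity)
  rw [div_mul_eq_mul_div, le_div_iff₀ (by positivity)] at h7
  nlinarith

/-- The estimating equation of a scaled median away from the sample points. -/
lemma IsScaledMedian.sum_eq (hz : IsScaledMedian a ν z) (hν : ∀ i, 0 < ν i)
    (hD : ∀ i, a i - ν i • z ≠ 0) :
    ∑ i, ‖a i - ν i • z‖⁻¹ • a i = (∑ i, ν i * ‖a i - ν i • z‖⁻¹) • z := by
  have h := hz.norm_sum_sign_le hν Finset.univ fun i _ => hD i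
  simp only [Finset.compl_univ, Finset.card_empty, Nat.cast_zero, norm_le_zero_iff, smul_sub,
    Finset.sum_sub_distrib, sub_eq_zero] at h
  rw [h, Finset.sum_smul]
  exact Finset.sum_congr rfl fun i _ => by rw [smul_smul, mul_comm]

lemma norm_sub_smul_le (ha : ∀ i, ‖a i‖ = 1) (hν : ∀ i, 0 < ν i) (i : Fin n) :
    ‖a i - ν i • z‖ ≤ 1 + ν i * ‖z‖ := by
  refine (norm_sub_le _ _).trans (le_of_eq ?_)
  rw [ha i, norm_smul, Real.norm_of_nonneg (hν i).le]

/-- This sum is the coefficient of `z` in the estimating equation; its lower bound permits solving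
for `z`. -/
lemma le_sum_mul_inv_norm (ha : ∀ i, ‖a i‖ = 1) (hν : ∀ i, 0 < ν i) {c : ℝ}
    (hmin : n * c ≤ ∑ i, min (ν i) 1) (hz1 : ‖z‖ ≤ 1) (hD : ∀ i, a i - ν i • z ≠ 0) :
    n * c / 2 ≤ ∑ i, ν i * ‖a i - ν i • z‖⁻¹ := by
  refine (div_le_div_of_nonneg_right hmin (by norm_num)).trans ?_
  rw [Finset.sum_div]
  refine Finset.sum_le_sum fun i _ => ?_
  have hm : 0 ≤ min (ν i) 1 := le_min (hν i).le zero_le_one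
  calc min (ν i) 1 / 2 ≤ min (ν i) 1 / (1 + ‖z‖) :=
        div_le_div_of_nonneg_left hm (by positivity) (by linarith)
    _ ≤ ν i / (1 + ν i * ‖z‖) := min_div_le_div (hν i) (norm_nonneg _)
    _ ≤ ν i / ‖a i - ν i • z‖ := div_le_div_of_nonneg_left (hν i).le
        (norm_pos_iff.2 (hD i)) (norm_sub_smul_le ha hν i)

/-! ### Nearly orthogonal samples -/

lemma norm_sum_sq_le_of_inner_le (ha : ∀ i, ‖a i‖ = 1) {ε : ℝ} (hε : 0 ≤ ε)
    (ho : ∀ i l, i ≠ l → |inner ℝ (a i) (a l)| ≤ ε) (G : Finset (Fin n)) :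
    ‖∑ i ∈ G, a i‖ ^ 2 ≤ n + n ^ 2 * ε := by
  have hcard : (G.card : ℝ) ≤ n := by exact_mod_cast (card_finset_fin_le G)
  rw [← real_inner_self_eq_norm_sq, sum_inner]
  calc ∑ i ∈ G, inner ℝ (a i) (∑ l ∈ G, a l) ≤ ∑ i ∈ G, (1 + n * ε) := by
        refine Finset.sum_le_sum fun i hi => ?_
        rw [inner_sum, ← Finset.add_sum_erase _ _ hi, real_inner_self_eq_norm_sq, ha i, one_pow]
        refine add_le_add le_rfl ?_
        calc ∑ l ∈ G.erase i, inner ℝ (a i) (a l) ≤ ∑ l ∈ G.erase i, ε :=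
              Finset.sum_le_sum fun l hl => le_of_abs_le (ho i l (Finset.ne_of_mem_erase hl).symm)
          _ ≤ n * ε := by
              rw [Finset.sum_const, nsmul_eq_mul]
              exact mul_le_mul_of_nonneg_right (by exact_mod_cast (card_finset_fin_le _)) hε
    _ = G.card * (1 + n * ε) := by rw [Finset.sum_const, nsmul_eq_mul]
    _ ≤ n * (1 + n * ε) := mul_le_mul_of_nonneg_right hcard (by positivity)
    _ = _ := by ring

set_option maxHeartbeats 800000 in
/-- A scaled median of a nearly orthogonal sample keeps away from the sample points. -/
lemma IsScaledMedian.le_norm_sub_of_inner_le (hz : IsScaledMedian a ν z) (hn : 32 ≤ n)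
    (ha : ∀ i, ‖a i‖ = 1) (hν : ∀ i, 0 < ν i) {ε A Z : ℝ} (hε : 0 ≤ ε) (hZ : 0 ≤ Z)
    (ho : ∀ i l, i ≠ l → |inner ℝ (a i) (a l)| ≤ ε) (hνA : ∑ i, ν i ≤ n * A) (hzZ : ‖z‖ ≤ Z)
    (hnε : n * ε ≤ 1) (hεs : ε ≤ 1 / 8)
    (hcond : 1 + n * A * Z + 2 * n ^ 2 * ε + 4 * n ^ 2 * A * Z * ε ≤ n / 2) (k : Fin n) :
    1 / 4 ≤ ‖a k - ν k • z‖ ∨ n / 4 ≤ Real.sqrt (2 * n) * (4 * n * A * Z * ‖a k - ν k • z‖) := by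
  by_cases hk : 1 / 4 ≤ ‖a k - ν k • z‖
  · exact Or.inl hk
  right
  rw [not_le] at hk
  have hn' : (32 : ℝ) ≤ n := by exact_mod_cast hn
  have hA0 : 0 ≤ A := by
    have : 0 ≤ ∑ i, ν i := Finset.sum_nonneg fun i _ => (hν i).le
    exact nonneg_of_mul_nonneg_right (this.trans hνA) (by linarith)
  set d := a k - ν k • z with hd
  have hνz : 3 / 4 ≤ ν k * ‖z‖ := by
    have h1 : ‖a k‖ ≤ ‖d‖ + ‖ν k • z‖ := by
      have : a k = d + ν k • z := by rw [hd]; abel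
      conv_lhs => rw [this]
      exact norm_add_le _ _
    rw [ha k, norm_smul, Real.norm_of_nonneg (hν k).le] at h1
    linarith
  have hzpos : 0 < ‖z‖ := by
    by_contra h
    have : ‖z‖ = 0 := le_antisymm (not_lt.1 h) (norm_nonneg _)
    rw [this, mul_zero] at hνz; linarith
  -- If `ν k • z` is close to `a k`, then `z` points nearly along `a k`. Every other `a i` is nearly
  -- orthogonal to that direction, so at most one residual can be small.
  have hD : ∀ i, i ≠ k → 1 / 2 ≤ ‖a i - ν i • z‖ := fun i hi => by
    have h1 : ν k * inner ℝ (a i) z ≤ ν k * (‖z‖ / 2) := by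
      have h2 : ν k * inner ℝ (a i) z = inner ℝ (a i) (a k) - inner ℝ (a i) d := by
        rw [hd, inner_sub_right, inner_smul_right]; ring
      have h3 := le_of_abs_le (ho i k hi)
      have h4 : -inner ℝ (a i) d ≤ 1 / 4 := by
        have := (neg_le_abs _).trans (abs_real_inner_le_norm (a i) d)
        rw [ha i, one_mul] at this
        linarith
      rw [h2]; linarith
    have h5 := le_of_mul_le_mul_left h1 (hν k)
    have h6 : ‖a i - ν i • z‖ ^ 2 = 1 - 2 * (ν i * inner ℝ (a i) z) + (ν i * ‖z‖) ^ 2 := by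
      rw [norm_sub_sq_real, ha i, inner_smul_right, norm_smul, Real.norm_of_nonneg (hν i).le]; ring
    have h7 : ν i * inner ℝ (a i) z ≤ ν i * (‖z‖ / 2) := mul_le_mul_of_nonneg_left h5 (hν i).le
    have h8 : (1 / 2) ^ 2 ≤ ‖a i - ν i • z‖ ^ 2 := by
      rw [h6]; nlinarith [sq_nonneg (ν i * ‖z‖ - 1 / 2)]
    exact le_of_sq_le_sq h8 (norm_nonneg _)
  set G : Finset (Fin n) := Finset.univ.erase k with hG
  have hGm : ∀ i ∈ G, i ≠ k := fun i hi => Finset.ne_of_mem_erase hi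
  have hGc : (Gᶜ.card : ℝ) = 1 := by
    rw [Finset.card_compl, hG, Finset.card_erase_of_mem (Finset.mem_univ _), Finset.card_univ]
    rw [Fintype.card_fin, Nat.sub_sub_self (by lia), Nat.cast_one]
  have hsub := hz.norm_sum_sign_le hν G fun i hi h0 => by
    have := hD i (hGm i hi); rw [h0, norm_zero] at this; linarith
  rw [hGc] at hsub
  set h := ∑ i ∈ G, ‖a i - ν i • z‖⁻¹ • a i with hh
  set W := ∑ i ∈ G, ν i * ‖a i - ν i • z‖⁻¹ with hW
  have hsplit : ∑ i ∈ G, ‖a i - ν i • z‖⁻¹ • (a i - ν i • z) = h - W • z := by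
    simp only [smul_sub, Finset.sum_sub_distrib, hh, hW, Finset.sum_smul, smul_smul]
    congr 1
    exact Finset.sum_congr rfl fun i _ => by rw [mul_comm]
  rw [hsplit] at hsub
  have hDinv : ∀ i ∈ G, ‖a i - ν i • z‖⁻¹ ≤ 2 := fun i hi => by
    rw [show (2 : ℝ) = (1 / 2)⁻¹ by norm_num]
    exact inv_anti₀ (by norm_num) (hD i (hGm i hi))
  have hW0 : 0 ≤ W := Finset.sum_nonneg fun i _ => by have := hν i; positivity
  have hWle : W ≤ 2 * (n * A) := by
    calc W ≤ ∑ i ∈ G, ν i * 2 := Finset.sum_le_sum fun i hi =>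
          mul_le_mul_of_nonneg_left (hDinv i hi) (hν i).le
      _ = 2 * ∑ i ∈ G, ν i := by rw [← Finset.sum_mul, mul_comm]
      _ ≤ 2 * ∑ i, ν i := by
          refine mul_le_mul_of_nonneg_left ?_ (by norm_num)
          exact Finset.sum_le_sum_of_subset_of_nonneg (Finset.subset_univ _)
            fun i _ _ => (hν i).le
      _ ≤ _ := by linarith
  set R := W * (ν k)⁻¹ with hR
  have hR0 : 0 ≤ R := mul_nonneg hW0 (inv_nonneg.2 (hν k).le)
  have hRle : R ≤ 4 * n * A * Z := by
    have h1 : (ν k)⁻¹ ≤ 2 * ‖z‖ := by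
      rw [inv_le_iff_one_le_mul₀ (hν k)]; linarith
    calc R ≤ 2 * (n * A) * (2 * ‖z‖) := mul_le_mul hWle h1 (inv_nonneg.2 (hν k).le) (by positivity)
      _ ≤ 2 * (n * A) * (2 * Z) := by gcongr
      _ = _ := by ring
  -- Since `ν k • z = a k - d`, the vector `W • z` equals `R • a k - R • d`; the subgradient
  -- condition over the indices other than `k` contributes the `1`.
  have hdist : ‖h - R • a k‖ ≤ 1 + R * ‖d‖ := by
    have h1 : h - R • a k = (h - W • z) - R • d := by
      have h2 : W • z = (R * ν k) • z := by
        rw [hR, mul_assoc, inv_mul_cancel₀ (hν k).ne', mul_one]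
      rw [h2, hd, smul_sub, smul_smul]; abel
    rw [h1]
    refine (norm_sub_le _ _).trans (add_le_add hsub ?_)
    rw [norm_smul, Real.norm_of_nonneg hR0]
  set v := ∑ i ∈ G, a i with hv
  have hvn : ‖v‖ ≤ Real.sqrt (2 * n) := by
    refine Real.le_sqrt_of_sq_le ((norm_sum_sq_le_of_inner_le ha hε ho G).trans ?_)
    nlinarith
  have hGcard : (G.card : ℝ) = n - 1 := by
    rw [hG, Finset.card_erase_of_mem (Finset.mem_univ _), Finset.card_univ, Fintype.card_fin,
      Nat.cast_sub (by lia)]; simp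
  -- Test against `v`, the sum of the other signs. By near orthogonality the inner product is at
  -- least `n / 2` under `hcond`, whereas `‖v‖ ≤ √(2n)`. Hence `R ‖d‖` cannot be small.
  have hinner : (n : ℝ) - 1 - n * A * Z - 2 * n ^ 2 * ε - R * (n * ε) ≤
      inner ℝ (h - R • a k) v := by
    rw [inner_sub_left, inner_smul_left, hh, sum_inner]
    simp only [conj_trivial]
    have h1 : inner ℝ (a k) v ≤ n * ε := by
      rw [hv, inner_sum]
      calc ∑ i ∈ G, inner ℝ (a k) (a i) ≤ ∑ i ∈ G, ε :=
            Finset.sum_le_sum fun i hi => le_of_abs_le (ho k i (hGm i hi).symm)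
        _ ≤ n * ε := by
            rw [Finset.sum_const, nsmul_eq_mul]
            exact mul_le_mul_of_nonneg_right (by linarith) hε
    have h2 : ∀ i ∈ G, 1 - ν i * Z - 2 * (n * ε) ≤ inner ℝ (‖a i - ν i • z‖⁻¹ • a i) v :=
      fun i hi => by
        rw [inner_smul_left]
        simp only [conj_trivial]
        have h3 : 1 - n * ε ≤ inner ℝ (a i) v := by
          rw [hv, inner_sum, ← Finset.add_sum_erase _ _ hi, real_inner_self_eq_norm_sq, ha i,
            one_pow]
          have : -(n * ε) ≤ ∑ l ∈ G.erase i, inner ℝ (a i) (a l) := by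
            calc -(n * ε) ≤ ∑ l ∈ G.erase i, (-ε) := by
                  rw [Finset.sum_const, nsmul_eq_mul, mul_neg, neg_le_neg_iff]
                  exact mul_le_mul_of_nonneg_right (by exact_mod_cast (card_finset_fin_le _)) hε
              _ ≤ _ := Finset.sum_le_sum fun l hl =>
                  (abs_le.1 (ho i l (Finset.ne_of_mem_erase hl).symm)).1
          linarith
        have hDpos : 0 < ‖a i - ν i • z‖ := by linarith [hD i (hGm i hi)]
        have h4 : 1 - ν i * Z ≤ ‖a i - ν i • z‖⁻¹ := by
          have h5 := norm_sub_smul_le (z := z) ha hν i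
          have h6 : ν i * ‖z‖ ≤ ν i * Z := mul_le_mul_of_nonneg_left hzZ (hν i).le
          rcases le_or_gt (1 - ν i * Z) 0 with h7 | h7
          · exact h7.trans (inv_nonneg.2 hDpos.le)
          · rw [le_inv_comm₀ h7 hDpos]
            refine (h5.trans (add_le_add le_rfl h6)).trans ?_
            rw [le_inv_comm₀ (by have := hν i; positivity) h7, inv_eq_one_div,
              le_div_iff₀ (by have := hν i; positivity)]
            nlinarith [sq_nonneg (ν i * Z)]
        have h8 := hDinv i hi
        have h9 : 0 ≤ ‖a i - ν i • z‖⁻¹ := inv_nonneg.2 hDpos.le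
        have h10 : 0 ≤ (n : ℝ) * ε := by positivity
        nlinarith
    have h3 := Finset.sum_le_sum h2
    rw [Finset.sum_sub_distrib, Finset.sum_sub_distrib, ← Finset.sum_mul, Finset.sum_const,
      Finset.sum_const, nsmul_eq_mul, nsmul_eq_mul, hGcard] at h3
    have h4 : ∑ i ∈ G, ν i ≤ n * A := le_trans (Finset.sum_le_sum_of_subset_of_nonneg
      (Finset.subset_univ _) fun i _ _ => (hν i).le) hνA
    have h5 : (∑ i ∈ G, ν i) * Z ≤ n * A * Z := mul_le_mul_of_nonneg_right h4 hZ
    have h6 := mul_le_mul_of_nonneg_left h1 hR0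
    nlinarith
  have hup : inner ℝ (h - R • a k) v ≤ (1 + R * ‖d‖) * Real.sqrt (2 * n) :=
    (real_inner_le_norm _ _).trans (mul_le_mul hdist hvn (norm_nonneg _) (by positivity))
  have hRε : R * (n * ε) ≤ 4 * n * A * Z * (n * ε) := mul_le_mul_of_nonneg_right hRle (by positivity)
  have hRd : R * ‖d‖ ≤ 4 * n * A * Z * ‖d‖ := mul_le_mul_of_nonneg_right hRle (norm_nonneg _)
  have hsq : Real.sqrt (2 * n) ≤ n / 4 := by
    rw [Real.sqrt_le_left (by positivity)]; nlinarith
  have hs0 := Real.sqrt_nonneg (2 * (n : ℝ))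
  have hlast := mul_le_mul_of_nonneg_left hRd hs0
  have hcomm : 4 * n * A * Z * (n * ε) = 4 * n ^ 2 * A * Z * ε := by ring
  have hexp : (1 + R * ‖d‖) * Real.sqrt (2 * n) =
      Real.sqrt (2 * n) + Real.sqrt (2 * n) * (R * ‖d‖) := by ring
  linarith

/-- In a nearly orthogonal sample, a scaled median is nearly orthogonal to the sample. -/
lemma IsScaledMedian.abs_inner_le (hz : IsScaledMedian a ν z) (hn : 0 < n)
    (ha : ∀ i, ‖a i‖ = 1) (hν : ∀ i, 0 < ν i) {ε c g : ℝ} (hε : 0 ≤ ε) (hg : 0 < g) (hc : 0 < c)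
    (ho : ∀ i l, i ≠ l → |inner ℝ (a i) (a l)| ≤ ε) (hmin : n * c ≤ ∑ i, min (ν i) 1)
    (hz1 : ‖z‖ ≤ 1) (hD : ∀ i, g ≤ ‖a i - ν i • z‖) (hnε : n * ε ≤ 1) (k : Fin n) :
    |inner ℝ (a k) z| ≤ 4 / (g * c * n) := by
  have hn' : (0 : ℝ) < n := by exact_mod_cast hn
  have hD0 : ∀ i, a i - ν i • z ≠ 0 := fun i h0 => by
    have := hD i; rw [h0, norm_zero] at this; linarith
  -- In the estimating equation paired with `a k`, the diagonal term and the sum of the `ε` terms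
  -- are each at most `1 / g`, while the coefficient of `⟨a k, z⟩` is at least `n c / 2`.
  have heq := congrArg (fun y => inner ℝ (a k) y) (hz.sum_eq hν hD0)
  simp only [inner_sum, inner_smul_right] at heq
  set W := ∑ i, ν i * ‖a i - ν i • z‖⁻¹
  have hW : n * c / 2 ≤ W := le_sum_mul_inv_norm ha hν hmin hz1 hD0
  have hinv : ∀ i, ‖a i - ν i • z‖⁻¹ ≤ g⁻¹ := fun i => inv_anti₀ hg (hD i)
  have h1 : |∑ i, ‖a i - ν i • z‖⁻¹ * inner ℝ (a k) (a i)| ≤ g⁻¹ * 2 := by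
    rw [← Finset.add_sum_erase _ _ (Finset.mem_univ k), real_inner_self_eq_norm_sq, ha k, one_pow,
      mul_one]
    refine (abs_add_le _ _).trans ?_
    have h2 : |∑ i ∈ Finset.univ.erase k, ‖a i - ν i • z‖⁻¹ * inner ℝ (a k) (a i)| ≤
        g⁻¹ * (n * ε) := by
      refine (Finset.abs_sum_le_sum_abs _ _).trans ?_
      calc ∑ i ∈ Finset.univ.erase k, |‖a i - ν i • z‖⁻¹ * inner ℝ (a k) (a i)|
          ≤ ∑ i ∈ Finset.univ.erase k, g⁻¹ * ε := by
            refine Finset.sum_le_sum fun i hi => ?_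
            rw [abs_mul, abs_of_nonneg (inv_nonneg.2 (norm_nonneg _))]
            exact mul_le_mul (hinv i) (ho k i (Finset.ne_of_mem_erase hi).symm) (abs_nonneg _)
              (by positivity)
        _ ≤ n * (g⁻¹ * ε) := by
            rw [Finset.sum_const, nsmul_eq_mul]
            exact mul_le_mul_of_nonneg_right (by exact_mod_cast (card_finset_fin_le _))
              (by positivity)
        _ = _ := by ring
    rw [abs_of_nonneg (inv_nonneg.2 (norm_nonneg _))]
    have h3 : g⁻¹ * (n * ε) ≤ g⁻¹ * 1 := mul_le_mul_of_nonneg_left hnε (by positivity)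
    linarith [hinv k]
  rw [heq, abs_mul, abs_of_nonneg (by linarith [show 0 < n * c / 2 by positivity])] at h1
  have h4 := (mul_le_mul_of_nonneg_right hW (abs_nonneg (inner ℝ (a k) z))).trans h1
  rw [le_div_iff₀ (by positivity)]
  have h5 : g * (n * c / 2 * |inner ℝ (a k) z|) ≤ g * (g⁻¹ * 2) := mul_le_mul_of_nonneg_left h4 hg.le
  rw [← mul_assoc g g⁻¹, mul_inv_cancel₀ hg.ne', one_mul] at h5
  linarith

end Inner

end SCLIME

end

noncomputable section

namespace SCLIME

/-! ### Effect of estimating the centre -/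

section Centre

variable {n p : ℕ} {a : Fin n → Vec p} {ν : Fin n → ℝ} {z : Vec p}

/-- Deterministic comparison of the spatial-sign covariance matrices with estimated and with known
centre. -/
lemma IsScaledMedian.abs_sum_sign_sub_le (hz : IsScaledMedian a ν z) (hn : 0 < n) (hp : 0 < p)
    (ha : ∀ i, ‖a i‖ = 1) (hν : ∀ i, 0 < ν i) {c g s A₁ A₂ A₃ A₄ A₅ : ℝ} {β : Fin n → ℝ}
    (hc : 0 < c) (hg : 0 < g) (hs0 : 0 ≤ s) (hs1 : s ≤ 1) (hA₁ : 0 ≤ A₁) (hA₂ : 0 ≤ A₂)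
    (hA₅ : 0 ≤ A₅) (hmin : n * c ≤ ∑ i, min (ν i) 1) (hz1 : ‖z‖ ≤ 1)
    (hD : ∀ i, g ≤ ‖a i - ν i • z‖) (hβ1 : ∀ i, |‖a i - ν i • z‖⁻¹ - 1| ≤ β i)
    (hβ2 : ∀ i, |(‖a i - ν i • z‖ ^ 2)⁻¹ - 1| ≤ β i)
    (h1 : ∀ j, |∑ i, a i j| ≤ n * (A₁ * s / Real.sqrt p))
    (h2 : ∀ j, ∑ i, |a i j| * β i ≤ n * (A₂ * s / Real.sqrt p))
    (h3 : ∀ j k, ∑ i, |a i j * a i k| * β i ≤ n * (A₃ * s / p))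
    (h4 : ∀ j, ∑ i, ν i * |a i j| ≤ n * (A₄ / Real.sqrt p))
    (h5 : ∑ i, ν i ^ 2 ≤ n * A₅) (j k : Fin p) :
    |∑ i, (spatialSign (a i - ν i • z) j * spatialSign (a i - ν i • z) k - a i j * a i k)| ≤
      n * ((A₃ + (2 * A₄ * (2 / c * (A₁ + A₂)) + A₅ * (2 / c * (A₁ + A₂)) ^ 2) / g ^ 2) * s / p) := by
  have hn' : (0 : ℝ) < n := by exact_mod_cast hn
  have hp' : (0 : ℝ) < p := by exact_mod_cast hp
  set P := Real.sqrt p with hP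
  have hP0 : 0 < P := Real.sqrt_pos.2 hp'
  have hPP : P ^ 2 = p := Real.sq_sqrt hp'.le
  have hD0 : ∀ i, a i - ν i • z ≠ 0 := fun i h0 => by
    have := hD i; rw [h0, norm_zero] at this; linarith
  set A₆ := 2 / c * (A₁ + A₂) with hA₆
  have hA₆0 : 0 ≤ A₆ := by positivity
  set Z := A₆ * s / P with hZ
  have hZ0 : 0 ≤ Z := by positivity
  -- Coordinates of `z` come from the estimating equation: its left side is `∑ a i j` plus the
  -- correction from the weights `‖a i - ν i • z‖⁻¹ - 1`.
  have hzc : ∀ j, |z j| ≤ Z := fun j => by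
    have heq := congrArg (fun y : Vec p => y j) (hz.sum_eq hν hD0)
    simp only [WithLp.ofLp_sum, Finset.sum_apply, PiLp.smul_apply, smul_eq_mul] at heq
    have hW := le_sum_mul_inv_norm ha hν hmin hz1 hD0
    set W := ∑ i, ν i * ‖a i - ν i • z‖⁻¹
    have e1 : |∑ i, ‖a i - ν i • z‖⁻¹ * a i j| ≤ n * ((A₁ + A₂) * s / P) := by
      have e2 : ∑ i, ‖a i - ν i • z‖⁻¹ * a i j =
          ∑ i, a i j + ∑ i, a i j * (‖a i - ν i • z‖⁻¹ - 1) := by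
        rw [← Finset.sum_add_distrib]; exact Finset.sum_congr rfl fun i _ => by ring
      rw [e2]
      have e3 : |∑ i, a i j * (‖a i - ν i • z‖⁻¹ - 1)| ≤ n * (A₂ * s / P) := by
        refine ((Finset.abs_sum_le_sum_abs _ _).trans (Finset.sum_le_sum fun i _ => ?_)).trans (h2 j)
        rw [abs_mul]
        exact mul_le_mul_of_nonneg_left (hβ1 i) (abs_nonneg _)
      have e4 : n * ((A₁ + A₂) * s / P) = n * (A₁ * s / P) + n * (A₂ * s / P) := by ring
      rw [e4]
      exact (abs_add_le _ _).trans (add_le_add (h1 j) e3)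
    rw [heq, abs_mul] at e1
    have hWpos : 0 < n * c / 2 := by positivity
    rw [abs_of_pos (hWpos.trans_le hW)] at e1
    have e3 := (mul_le_mul_of_nonneg_right hW (abs_nonneg (z j))).trans e1
    have e4 : |z j| = (n * c / 2 * |z j|) / (n * c / 2) := by field_simp
    rw [e4, div_le_iff₀ hWpos]
    refine e3.trans (le_of_eq ?_)
    rw [hZ, hA₆]; field_simp
  have hterm : ∀ i, |spatialSign (a i - ν i • z) j * spatialSign (a i - ν i • z) k -
      a i j * a i k| ≤ |a i j * a i k| * β i +
      (g ^ 2)⁻¹ * (Z * (ν i * |a i j|) + Z * (ν i * |a i k|) + Z ^ 2 * ν i ^ 2) := fun i => by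
    have hDi : 0 < ‖a i - ν i • z‖ := hg.trans_le (hD i)
    set D := ‖a i - ν i • z‖ with hDdef
    have e1 : spatialSign (a i - ν i • z) j * spatialSign (a i - ν i • z) k - a i j * a i k =
        a i j * a i k * ((D ^ 2)⁻¹ - 1) +
        (D ^ 2)⁻¹ * (-(ν i * a i j * z k) - ν i * a i k * z j + ν i ^ 2 * (z j * z k)) := by
      simp only [spatialSign, PiLp.smul_apply, PiLp.sub_apply, smul_eq_mul, ← hDdef]
      rw [← inv_pow]; ring
    rw [e1]
    refine (abs_add_le _ _).trans (add_le_add ?_ ?_)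
    · rw [abs_mul]; exact mul_le_mul_of_nonneg_left (hβ2 i) (abs_nonneg _)
    · rw [abs_mul, abs_of_pos (by positivity : 0 < (D ^ 2)⁻¹)]
      refine mul_le_mul (inv_anti₀ (by positivity) (pow_le_pow_left₀ hg.le (hD i) 2)) ?_
        (abs_nonneg _) (by positivity)
      refine (abs_add_le _ _).trans (add_le_add ((abs_sub _ _).trans (add_le_add ?_ ?_)) ?_)
      · rw [abs_neg, abs_mul, abs_mul, abs_of_pos (hν i), mul_comm]
        exact mul_le_mul_of_nonneg_right (hzc k) (by have := hν i; positivity)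
      · rw [abs_mul, abs_mul, abs_of_pos (hν i), mul_comm]
        exact mul_le_mul_of_nonneg_right (hzc j) (by have := hν i; positivity)
      · rw [abs_mul, abs_mul, abs_of_nonneg (sq_nonneg _), mul_comm, sq Z]
        exact mul_le_mul_of_nonneg_right (mul_le_mul (hzc j) (hzc k) (abs_nonneg _) hZ0)
          (sq_nonneg _)
  calc |∑ i, (spatialSign (a i - ν i • z) j * spatialSign (a i - ν i • z) k - a i j * a i k)|
      ≤ ∑ i, (|a i j * a i k| * β i +
          (g ^ 2)⁻¹ * (Z * (ν i * |a i j|) + Z * (ν i * |a i k|) + Z ^ 2 * ν i ^ 2)) :=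
        (Finset.abs_sum_le_sum_abs _ _).trans (Finset.sum_le_sum fun i _ => hterm i)
    _ = ∑ i, |a i j * a i k| * β i + (g ^ 2)⁻¹ * (Z * ∑ i, ν i * |a i j| +
          Z * ∑ i, ν i * |a i k| + Z ^ 2 * ∑ i, ν i ^ 2) := by
        simp only [Finset.sum_add_distrib, ← Finset.mul_sum]
    _ ≤ n * (A₃ * s / p) + (g ^ 2)⁻¹ * (Z * (n * (A₄ / P)) + Z * (n * (A₄ / P)) +
          Z ^ 2 * (n * A₅)) := by
        have := h3 j k; have := h4 j; have := h4 k
        gcongr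
    _ = n * ((A₃ + (2 * A₄ * A₆ + A₅ * A₆ ^ 2 * s) / g ^ 2) * s / p) := by
        rw [hZ, ← hPP]; field_simp; ring
    _ ≤ _ := by
        have : A₅ * A₆ ^ 2 * s ≤ A₅ * A₆ ^ 2 := mul_le_of_le_one_right (by positivity) hs1
        gcongr

/-- The average signs are small in the Euclidean norm if they are small coordinatewise. -/
lemma norm_le_of_coord_le {v : Vec p} {B : ℝ} (hB : 0 ≤ B) (hp : 0 < p)
    (h : ∀ j, |v j| ≤ B / Real.sqrt p) : ‖v‖ ≤ B := by
  have hp' : (0 : ℝ) < p := by exact_mod_cast hp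
  refine abs_le_of_sq_le_sq' ?_ hB |>.2
  rw [EuclideanSpace.real_norm_sq_eq]
  calc ∑ j, v j ^ 2 ≤ ∑ _j : Fin p, B ^ 2 / p := by
        refine Finset.sum_le_sum fun j _ => ?_
        rw [← sq_abs]
        refine (pow_le_pow_left₀ (abs_nonneg _) (h j) 2).trans (le_of_eq ?_)
        rw [div_pow, Real.sq_sqrt hp'.le]
    _ = B ^ 2 := by simp; field_simp

/-- Arithmetic-geometric mean inequality with weight `√p`, balancing radii of order one against
coordinates of order `1 / √p`. -/
lemma sum_mul_abs_coord_le (hp : 0 < p) {A : ℝ} (h5 : ∑ i, ν i ^ 2 ≤ n * A) {j : Fin p}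
    (h6 : ∑ i, a i j ^ 2 ≤ n * (A / p)) : ∑ i, ν i * |a i j| ≤ n * (A / Real.sqrt p) := by
  have hp' : (0 : ℝ) < p := by exact_mod_cast hp
  set P := Real.sqrt p with hP
  have hP0 : 0 < P := Real.sqrt_pos.2 hp'
  have hPP : P ^ 2 = p := Real.sq_sqrt hp'.le
  have hi : ∀ i, ν i * |a i j| ≤ ν i ^ 2 / (2 * P) + P * a i j ^ 2 / 2 := fun i => by
    have h1 : ν i ^ 2 / (2 * P) + P * a i j ^ 2 / 2 - ν i * |a i j| =
        (ν i - P * |a i j|) ^ 2 / (2 * P) := by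
      rw [← sq_abs (a i j)]; field_simp; ring
    have h2 : 0 ≤ (ν i - P * |a i j|) ^ 2 / (2 * P) := by positivity
    linarith
  refine (Finset.sum_le_sum fun i _ => hi i).trans ?_
  rw [Finset.sum_add_distrib, ← Finset.sum_div, ← Finset.sum_div, ← Finset.mul_sum]
  calc _ ≤ n * A / (2 * P) + P * (n * (A / p)) / 2 := by gcongr
    _ = _ := by rw [← hPP]; field_simp; ring

/-- Effect of the estimated centre when no inverse radius is large. -/
lemma exists_centre_bound_of_small_radius {c A : ℝ} (hc : 0 < c) (hA : 1 ≤ A) :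
    ∃ B : ℝ, 0 < B ∧ ∀ {n p : ℕ} {a : Fin n → Vec p} {ν : Fin n → ℝ} {z : Vec p} {s : ℝ},
      IsScaledMedian a ν z → 0 < n → 0 < p → (∀ i, ‖a i‖ = 1) → (∀ i, 0 < ν i) → 0 ≤ s → s ≤ 1 →
      A * s ≤ c / 8 → n * c ≤ ∑ i, min (ν i) 1 →
      (∑ i, inner ℝ (a i) z ^ 2 ≤ n * (c / 2) * ‖z‖ ^ 2) →
      (∀ j, |∑ i, a i j| ≤ n * (A * s / Real.sqrt p)) → (∑ i, ν i ^ 2 ≤ n * A) →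
      (∀ j, ∑ i, a i j ^ 2 ≤ n * (A / p)) → (∀ j, ∑ i, (p * a i j ^ 2) ^ 2 ≤ n * A) →
      (∀ i, ν i * (8 / c * (A * s)) ≤ 1 / 2) → ∀ j k,
      |∑ i, (spatialSign (a i - ν i • z) j * spatialSign (a i - ν i • z) k - a i j * a i k)| ≤
        n * (B * s / p) := by
  have hA0 : 0 < A := by linarith
  -- The output of `abs_sum_sign_sub_le` for `g = 1/2` and `β i = 10 ν_i ‖z‖`; the bound `‖z‖ ≤ 8 A
  -- s / c` makes both `A₂` and `A₃` at most `80 A² / c`, with the latter majorization of `A₃`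
  -- inserted here.
  refine ⟨80 * A ^ 2 / c + (2 * A * (2 / c * (A + 80 * A ^ 2 / c)) +
    A * (2 / c * (A + 80 * A ^ 2 / c)) ^ 2) / (1 / 2) ^ 2, by positivity, ?_⟩
  intro n p a ν z s hz hn hp ha hν hs0 hs1 hsc hmin hop h1 h5 h6 h8 hsmall j k
  have hn' : (0 : ℝ) < n := by exact_mod_cast hn
  have hp' : (0 : ℝ) < p := by exact_mod_cast hp
  have hP0 : 0 < Real.sqrt p := Real.sqrt_pos.2 hp'
  have hPP : Real.sqrt p ^ 2 = p := Real.sq_sqrt hp'.le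
  have hsumn : ‖∑ i, a i‖ ≤ n * (A * s) := by
    refine norm_le_of_coord_le (by positivity) hp fun j => ?_
    simp only [WithLp.ofLp_sum, Finset.sum_apply]
    exact (h1 j).trans (le_of_eq (by ring))
  obtain ⟨hzn, hz1⟩ := hz.norm_le hn ha hν hc hmin hop hsumn hsc
  have hνz : ∀ i, ν i * ‖z‖ ≤ 1 / 2 := fun i =>
    (mul_le_mul_of_nonneg_left hzn (hν i).le).trans (hsmall i)
  have hdev : ∀ i, |‖a i - ν i • z‖ - 1| ≤ ν i * ‖z‖ := fun i => by
    have h := abs_norm_sub_norm_le (a i - ν i • z) (a i)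
    rw [ha i, sub_sub_cancel_left, norm_neg, norm_smul, Real.norm_of_nonneg (hν i).le] at h
    exact h
  have hD : ∀ i, 1 / 2 ≤ ‖a i - ν i • z‖ := fun i => by
    have := abs_le.1 (hdev i); linarith [hνz i]
  have hD2 : ∀ i, ‖a i - ν i • z‖ ≤ 3 / 2 := fun i => by
    have := abs_le.1 (hdev i); linarith [hνz i]
  have hβ0 : ∀ i, 0 ≤ ν i * ‖z‖ := fun i => mul_nonneg (hν i).le (norm_nonneg _)
  have h4 := fun j => sum_mul_abs_coord_le (n := n) (a := a) hp h5 (h6 j)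
  refine hz.abs_sum_sign_sub_le hn hp ha hν (β := fun i => 10 * (ν i * ‖z‖)) (A₁ := A)
    (A₂ := 80 * A ^ 2 / c) (A₄ := A) (A₅ := A) hc (by norm_num : (0 : ℝ) < 1 / 2) hs0 hs1 hA0.le
    (by positivity) hA0.le hmin hz1 hD (fun i => ?_) (fun i => ?_) h1 (fun j => ?_) (fun j k => ?_)
    h4 h5 j k
  · have hDi := hD i
    have hpos : 0 < ‖a i - ν i • z‖ := by linarith
    have e : ‖a i - ν i • z‖⁻¹ - 1 = -(‖a i - ν i • z‖ - 1) / ‖a i - ν i • z‖ := by field_simp; ring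
    rw [e, abs_div, abs_neg, abs_of_pos hpos, div_le_iff₀ hpos]
    nlinarith [hdev i, hβ0 i]
  · have hDi := hD i
    have hpos : 0 < ‖a i - ν i • z‖ := by linarith
    have e : (‖a i - ν i • z‖ ^ 2)⁻¹ - 1 =
        -((‖a i - ν i • z‖ - 1) * (‖a i - ν i • z‖ + 1)) / ‖a i - ν i • z‖ ^ 2 := by
      field_simp; ring
    rw [e, abs_div, abs_neg, abs_mul, abs_of_pos (by positivity : 0 < ‖a i - ν i • z‖ ^ 2),
      abs_of_pos (by positivity : 0 < ‖a i - ν i • z‖ + 1), div_le_iff₀ (by positivity)]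
    have e1 : |‖a i - ν i • z‖ - 1| * (‖a i - ν i • z‖ + 1) ≤ ν i * ‖z‖ * (5 / 2) :=
      mul_le_mul (hdev i) (by linarith [hD2 i]) (by positivity) (hβ0 i)
    have e2 : 1 / 4 ≤ ‖a i - ν i • z‖ ^ 2 := by nlinarith
    nlinarith [hβ0 i, mul_le_mul_of_nonneg_left e2 (hβ0 i)]
  · have e : ∑ i, |a i j| * (10 * (ν i * ‖z‖)) = 10 * ‖z‖ * ∑ i, ν i * |a i j| := by
      rw [Finset.mul_sum]; exact Finset.sum_congr rfl fun i _ => by ring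
    rw [e]
    calc 10 * ‖z‖ * ∑ i, ν i * |a i j| ≤ 10 * (8 / c * (A * s)) * (n * (A / Real.sqrt p)) := by
          have := h4 j
          gcongr
          exact Finset.sum_nonneg fun i _ => by have := hν i; positivity
      _ = _ := by ring
  · have hi : ∀ i, |a i j * a i k| * (10 * (ν i * ‖z‖)) ≤ 10 * ‖z‖ * (((p * a i j ^ 2) ^ 2 / 4 +
        (p * a i k ^ 2) ^ 2 / 4 + ν i ^ 2 / 2) / p) := fun i => by
      have e1 : p * |a i j * a i k| * ν i ≤ (p * a i j ^ 2) ^ 2 / 4 + (p * a i k ^ 2) ^ 2 / 4 +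
          ν i ^ 2 / 2 := by
        have e2 : (p * |a i j * a i k|) ^ 2 = (p * a i j ^ 2) * (p * a i k ^ 2) := by
          rw [mul_pow, sq_abs]; ring
        nlinarith [sq_nonneg (p * a i j ^ 2 - p * a i k ^ 2), sq_nonneg (p * |a i j * a i k| - ν i)]
      have e3 : |a i j * a i k| * (10 * (ν i * ‖z‖)) =
          10 * ‖z‖ * ((p * |a i j * a i k| * ν i) / p) := by field_simp
      rw [e3]
      gcongr
    refine (Finset.sum_le_sum fun i _ => hi i).trans ?_
    rw [← Finset.mul_sum, ← Finset.sum_div, Finset.sum_add_distrib, Finset.sum_add_distrib,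
      ← Finset.sum_div, ← Finset.sum_div, ← Finset.sum_div]
    calc _ ≤ 10 * (8 / c * (A * s)) * ((n * A / 4 + n * A / 4 + n * A / 2) / p) := by
          have := h8 j; have := h8 k
          gcongr
      _ = _ := by field_simp; ring

/-- The quantity is `‖a - ν z‖² - 1`. Since `⟨a, z⟩ = O(1/n)` and `‖z‖² = O(1/n)`, it is of order
`(1 + ν²) / n`, however large `ν` is. -/
lemma abs_quadratic_le {n g c ν t r : ℝ} (hn : 0 < n) (hg : 0 < g) (hc : 0 < c) (hν : 0 ≤ ν)
    (hr : 0 ≤ r) (hrZ : r ≤ 12 / (c * Real.sqrt n)) (ht : |t| ≤ 4 / (g * c * n)) :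
    |-(2 * (ν * t)) + (ν * r) ^ 2| ≤
      2 * (8 / (g * c) + 144 / c ^ 2) * (1 + ν ^ 2) / n := by
  have hNN : Real.sqrt n ^ 2 = n := Real.sq_sqrt hn.le
  have e2 : (ν * r) ^ 2 ≤ ν ^ 2 * (144 / c ^ 2 / n) := by
    rw [mul_pow]
    refine mul_le_mul_of_nonneg_left ?_ (sq_nonneg _)
    refine (pow_le_pow_left₀ hr hrZ 2).trans (le_of_eq ?_)
    rw [div_pow, mul_pow, hNN]; field_simp; norm_num
  have e3 : |2 * (ν * t)| ≤ ν * (8 / (g * c) / n) := by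
    rw [abs_mul, abs_mul, abs_of_nonneg hν, abs_of_pos (by norm_num : (0 : ℝ) < 2)]
    have := mul_le_mul_of_nonneg_left ht hν
    have e4 : ν * (8 / (g * c) / n) = 2 * (ν * (4 / (g * c * n))) := by field_simp; ring
    rw [e4]; linarith
  refine (abs_add_le _ _).trans ?_
  rw [abs_neg, abs_of_nonneg (sq_nonneg (ν * r))]
  have e5 : ν ≤ 2 * (1 + ν ^ 2) := by nlinarith [sq_nonneg (ν - 1)]
  have e6 : ν ^ 2 ≤ 2 * (1 + ν ^ 2) := by nlinarith [sq_nonneg ν]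
  have e7 : 0 ≤ 8 / (g * c) / n := by positivity
  have e8 : 0 ≤ 144 / c ^ 2 / n := by positivity
  calc _ ≤ ν * (8 / (g * c) / n) + ν ^ 2 * (144 / c ^ 2 / n) := add_le_add e3 e2
    _ ≤ 2 * (1 + ν ^ 2) * (8 / (g * c) / n) + 2 * (1 + ν ^ 2) * (144 / c ^ 2 / n) :=
        add_le_add (mul_le_mul_of_nonneg_right e5 e7) (mul_le_mul_of_nonneg_right e6 e8)
    _ = _ := by ring

set_option maxHeartbeats 800000 in
/-- Effect of the estimated centre when the signs are nearly orthogonal. -/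
lemma exists_centre_bound_of_orthogonal {c A : ℝ} (hc : 0 < c) (hc1 : c ≤ 1) (hA : 1 ≤ A) :
    ∃ B : ℝ, 0 < B ∧ ∀ {n p : ℕ} {a : Fin n → Vec p} {ν : Fin n → ℝ} {z : Vec p} {s ε : ℝ},
      IsScaledMedian a ν z → 32 ≤ n → 0 < p → (∀ i, ‖a i‖ = 1) → (∀ i, 0 < ν i) → 0 ≤ s → s ≤ 1 →
      n * c ≤ ∑ i, min (ν i) 1 →
      (∑ i, inner ℝ (a i) z ^ 2 ≤ n * (c / 2) * ‖z‖ ^ 2) →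
      (∀ j, |∑ i, a i j| ≤ n * (A * s / Real.sqrt p)) → (∑ i, ν i ^ 2 ≤ n * A) →
      (∀ j, ∑ i, a i j ^ 2 ≤ n * (A / p)) →
      (∀ i j, |a i j| ≤ A * (Real.sqrt n * s) / Real.sqrt p) →
      0 ≤ ε → (∀ i l, i ≠ l → |inner ℝ (a i) (a l)| ≤ ε) →
      12 / (c * Real.sqrt n) ≤ 1 → n * ε ≤ 1 → ε ≤ 1 / 8 →
      1 + n * A * (12 / (c * Real.sqrt n)) + 2 * n ^ 2 * ε +
        4 * n ^ 2 * A * (12 / (c * Real.sqrt n)) * ε ≤ n / 2 → ∀ j k,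
      |∑ i, (spatialSign (a i - ν i • z) j * spatialSign (a i - ν i • z) k - a i j * a i k)| ≤
        n * (B * s / p) := by
  have hA0 : 0 < A := by linarith
  -- Lower bound for the residuals: `√(2n) ≤ 35/24 √n` and `Z = 12 / (c √n)` turn the alternative of
  -- `le_norm_sub_of_inner_le` into `n / 4 ≤ 70 n A ‖a i - ν i • z‖ / c`.
  set g := c / (280 * A) with hg
  have hg0 : 0 < g := by positivity
  have hg1 : g ≤ 1 / 4 := by rw [hg, div_le_iff₀ (by positivity)]; linarith
  set Cq := 8 / (g * c) + 144 / c ^ 2 with hCq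
  have hCq0 : 0 < Cq := by positivity
  set Cβ := 2 * Cq * (1 + A) / g ^ 2 with hCβ
  have hCβ0 : 0 < Cβ := by positivity
  refine ⟨A ^ 2 * Cβ + (2 * A * (2 / c * (A + A * Cβ)) + A * (2 / c * (A + A * Cβ)) ^ 2) / g ^ 2,
    by positivity, ?_⟩
  intro n p a ν z s ε hz hn32 hp ha hν hs0 hs1 hmin hop h1 h5 h6 h7 hε ho hZ1 hnε hε8 hcond j k
  have hn : 0 < n := by lia
  have hn' : (32 : ℝ) ≤ n := by exact_mod_cast hn32
  have hn0 : (0 : ℝ) < n := by linarith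
  have hp' : (0 : ℝ) < p := by exact_mod_cast hp
  have hP0 : 0 < Real.sqrt p := Real.sqrt_pos.2 hp'
  have hPP : Real.sqrt p ^ 2 = p := Real.sq_sqrt hp'.le
  have hN0 : 0 < Real.sqrt n := Real.sqrt_pos.2 hn0
  have hNN : Real.sqrt n ^ 2 = n := Real.sq_sqrt hn0.le
  set N := Real.sqrt n with hN
  have hsumn : ‖∑ i, a i‖ ≤ n * (3 / 2 / N) := by
    refine abs_le_of_sq_le_sq' ?_ (by positivity) |>.2
    refine (norm_sum_sq_le_of_inner_le ha hε ho Finset.univ).trans ?_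
    have e : (n * (3 / 2 / N)) ^ 2 = 9 / 4 * (n : ℝ) := by
      rw [mul_pow, div_pow, hNN]; field_simp; norm_num
    rw [e]; nlinarith
  have hα : 3 / 2 / N ≤ c / 8 := by
    rw [div_le_one (by positivity)] at hZ1
    rw [div_le_div_iff₀ hN0 (by norm_num)]
    linarith
  obtain ⟨hzn, hz1⟩ := hz.norm_le hn ha hν hc hmin hop hsumn hα
  have hzZ : ‖z‖ ≤ 12 / (c * N) := hzn.trans (le_of_eq (by field_simp; norm_num))
  set Z := 12 / (c * N) with hZ
  have hZ0 : 0 ≤ Z := by positivity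
  have hνA : ∑ i, ν i ≤ n * A := by
    calc ∑ i, ν i ≤ ∑ i, (1 + ν i ^ 2) / 2 :=
          Finset.sum_le_sum fun i _ => by nlinarith [sq_nonneg (ν i - 1)]
      _ = (n + ∑ i, ν i ^ 2) / 2 := by rw [← Finset.sum_div, Finset.sum_add_distrib]; simp
      _ ≤ _ := by nlinarith
  have hD : ∀ i, g ≤ ‖a i - ν i • z‖ := fun i => by
    rcases hz.le_norm_sub_of_inner_le hn32 ha hν hε hZ0 ho hνA hzZ hnε hε8 hcond i with h | h
    · linarith
    · have h2 : Real.sqrt (2 * n) ≤ 35 / 24 * N := by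
        rw [Real.sqrt_le_left (by positivity), mul_pow, hNN]; linarith
      have h3 : Real.sqrt (2 * n) * (4 * n * A * Z * ‖a i - ν i • z‖) ≤
          35 / 24 * N * (4 * n * A * Z * ‖a i - ν i • z‖) :=
        mul_le_mul_of_nonneg_right h2 (by positivity)
      have h4 : 35 / 24 * N * (4 * n * A * Z * ‖a i - ν i • z‖) =
          n / 4 * (‖a i - ν i • z‖ * (280 * A) / c) := by rw [hZ]; field_simp; ring
      rw [h4] at h3
      have h5 : (n : ℝ) / 4 * 1 ≤ n / 4 * (‖a i - ν i • z‖ * (280 * A) / c) := by linarith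
      have h6 := le_of_mul_le_mul_left h5 (by positivity)
      rw [le_div_iff₀ hc, one_mul] at h6
      rw [hg, div_le_iff₀ (by positivity)]
      exact h6
  have hin := hz.abs_inner_le hn ha hν hε hg0 hc ho hmin hz1 hD hnε
  have hdev : ∀ i, |‖a i - ν i • z‖ ^ 2 - 1| ≤ 2 * Cq * (1 + ν i ^ 2) / n := fun i => by
    have e1 : ‖a i - ν i • z‖ ^ 2 - 1 = -(2 * (ν i * inner ℝ (a i) z)) + (ν i * ‖z‖) ^ 2 := by
      rw [norm_sub_sq_real, ha i, inner_smul_right, norm_smul, Real.norm_of_nonneg (hν i).le]; ring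
    rw [e1, hCq]
    exact abs_quadratic_le hn0 hg0 hc (hν i).le (norm_nonneg z) hzZ (hin i)
  -- The total relative deviation stays bounded independently of `n`. The crude bound `√n s / √p`
  -- for the coordinates therefore suffices, a factor `√n` or `n` being available in the sums over
  -- the sample.
  have hβsum : ∑ i, 2 * Cq * (1 + ν i ^ 2) / n / g ^ 2 ≤ Cβ := by
    have e : ∑ i, 2 * Cq * (1 + ν i ^ 2) / n / g ^ 2 =
        2 * Cq / n / g ^ 2 * (n + ∑ i, ν i ^ 2) := by
      have : ∀ i, 2 * Cq * (1 + ν i ^ 2) / n / g ^ 2 = 2 * Cq / n / g ^ 2 * (1 + ν i ^ 2) :=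
        fun i => by ring
      simp only [this]
      rw [← Finset.mul_sum, Finset.sum_add_distrib]; simp
    rw [e]
    calc _ ≤ 2 * Cq / n / g ^ 2 * (n + n * A) := by gcongr
      _ = Cβ := by rw [hCβ]; field_simp
  have hβ0 : ∀ i, 0 ≤ 2 * Cq * (1 + ν i ^ 2) / n / g ^ 2 := fun i => by positivity
  have hNs : N * s ≤ n * s := by
    refine mul_le_mul_of_nonneg_right ?_ hs0
    rw [← hNN]; nlinarith [show (1 : ℝ) ≤ N by
      rw [hN]; exact Real.one_le_sqrt.2 (by linarith)]
  refine hz.abs_sum_sign_sub_le hn hp ha hν (β := fun i => 2 * Cq * (1 + ν i ^ 2) / n / g ^ 2)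
    (A₁ := A) (A₂ := A * Cβ) (A₄ := A) (A₅ := A) hc hg0 hs0 hs1 hA0.le (by positivity) hA0.le hmin
    hz1 hD (fun i => ?_) (fun i => ?_) h1 (fun j => ?_) (fun j k => ?_)
    (fun j => sum_mul_abs_coord_le hp h5 (h6 j)) h5 j k
  · have hpos : 0 < ‖a i - ν i • z‖ := hg0.trans_le (hD i)
    set D := ‖a i - ν i • z‖
    have e : D⁻¹ - 1 = -(D ^ 2 - 1) / (D * (1 + D)) := by field_simp; ring
    rw [e, abs_div, abs_neg, abs_of_pos (by positivity : 0 < D * (1 + D))]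
    have e2 : g ^ 2 ≤ D * (1 + D) := by nlinarith [hD i]
    exact div_le_div₀ (by positivity) (hdev i) (by positivity) e2
  · have hpos : 0 < ‖a i - ν i • z‖ := hg0.trans_le (hD i)
    set D := ‖a i - ν i • z‖
    have e : (D ^ 2)⁻¹ - 1 = -(D ^ 2 - 1) / D ^ 2 := by field_simp; ring
    rw [e, abs_div, abs_neg, abs_of_pos (by positivity : 0 < D ^ 2)]
    exact div_le_div₀ (by positivity) (hdev i) (by positivity) (pow_le_pow_left₀ hg0.le (hD i) 2)
  · calc ∑ i, |a i j| * (2 * Cq * (1 + ν i ^ 2) / n / g ^ 2)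
        ≤ ∑ i, A * (N * s) / Real.sqrt p * (2 * Cq * (1 + ν i ^ 2) / n / g ^ 2) :=
          Finset.sum_le_sum fun i _ => mul_le_mul_of_nonneg_right (h7 i j) (hβ0 i)
      _ ≤ A * (N * s) / Real.sqrt p * Cβ := by
          rw [← Finset.mul_sum]; gcongr
      _ ≤ A * (n * s) / Real.sqrt p * Cβ := by gcongr
      _ = _ := by ring
  · calc ∑ i, |a i j * a i k| * (2 * Cq * (1 + ν i ^ 2) / n / g ^ 2)
        ≤ ∑ i, (A * (N * s) / Real.sqrt p) ^ 2 * (2 * Cq * (1 + ν i ^ 2) / n / g ^ 2) := by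
          refine Finset.sum_le_sum fun i _ => mul_le_mul_of_nonneg_right ?_ (hβ0 i)
          rw [abs_mul, sq]
          exact mul_le_mul (h7 i j) (h7 i k) (abs_nonneg _) (by positivity)
      _ ≤ (A * (N * s) / Real.sqrt p) ^ 2 * Cβ := by
          rw [← Finset.mul_sum]; gcongr
      _ = A ^ 2 * Cβ * n * s ^ 2 / p := by
          rw [div_pow, hPP, mul_pow, mul_pow, hNN]; ring
      _ ≤ A ^ 2 * Cβ * n * s / p := by
          have : s ^ 2 ≤ s := by nlinarith
          gcongr
      _ = _ := by ring

end Centre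

end SCLIME

end

noncomputable section

namespace SCLIME

/-! ### Exponential inequalities for independent samples -/

section Chernoff

variable {α : Type*} [MeasurableSpace α] {L : Measure α} [IsProbabilityMeasure L] {n : ℕ}

/-- The law of an i.i.d. sample of size `n`. -/
abbrev sampleLaw (L : Measure α) (n : ℕ) : Measure (Fin n → α) := Measure.pi fun _ => L

/-- Chernoff's bound for a sum over an i.i.d. sample. -/
lemma measureReal_sum_ge_le {F : α → ℝ} {κ τ : ℝ} (hint : Integrable (fun x => Real.exp (F x)) L)
    (hκ : ∫ x, Real.exp (F x) ∂L ≤ Real.exp κ) :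
    (sampleLaw L n).real {x | n * (κ + τ) ≤ ∑ i, F (x i)} ≤ Real.exp (-(n * τ)) := by
  have hi : Integrable (fun x : Fin n → α => ∏ i, Real.exp (F (x i))) (sampleLaw L n) :=
    Integrable.fintype_prod (f := fun _ x => Real.exp (F x)) fun _ => hint
  have hexp : ∀ x : Fin n → α, Real.exp (1 * ∑ i, F (x i)) = ∏ i, Real.exp (F (x i)) := fun x => by
    rw [one_mul, Real.exp_sum]
  have h := measure_ge_le_exp_mul_mgf (μ := sampleLaw L n) (X := fun x => ∑ i, F (x i))
    (n * (κ + τ)) zero_le_one (by simpa only [hexp] using hi)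
  refine h.trans ?_
  rw [mgf]
  simp only [hexp]
  rw [integral_fintype_prod_eq_prod (fun (_ : Fin n) x => Real.exp (F x)), Finset.prod_const,
    Finset.card_univ, Fintype.card_fin]
  have h0 : 0 ≤ ∫ x, Real.exp (F x) ∂L := integral_nonneg fun _ => (Real.exp_pos _).le
  calc _ ≤ Real.exp (-1 * (n * (κ + τ))) * Real.exp κ ^ n := by gcongr
    _ = _ := by rw [← Real.exp_nat_mul, ← Real.exp_add]; congr 1; ring

lemma measureReal_coord_ge_le {F : α → ℝ} (hint : Integrable (fun x => Real.exp (F x)) L)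
    (h2 : ∫ x, Real.exp (F x) ∂L ≤ 2) (t : ℝ) (i : Fin n) :
    (sampleLaw L n).real {x | t ≤ F (x i)} ≤ 2 * Real.exp (-t) := by
  have hmp := measurePreserving_eval (fun _ : Fin n => L) i
  have hint' : Integrable (fun x : Fin n → α => Real.exp (1 * F (x i))) (sampleLaw L n) := by
    simp only [one_mul]
    exact hmp.integrable_comp_of_integrable hint
  refine (measure_ge_le_exp_mul_mgf t zero_le_one hint').trans ?_
  have : mgf (fun x : Fin n → α => F (x i)) (sampleLaw L n) 1 = ∫ x, Real.exp (F x) ∂L := by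
    rw [mgf]
    simp only [one_mul]
    have h := integral_map (μ := sampleLaw L n) hmp.measurable.aemeasurable
      (f := fun x => Real.exp (F x)) (by rw [hmp.map_eq]; exact hint.aestronglyMeasurable)
    rw [hmp.map_eq] at h
    exact h.symm
  rw [this, neg_one_mul, mul_comm]
  exact mul_le_mul_of_nonneg_right h2 (Real.exp_pos _).le

lemma map_pair_sampleLaw {i l : Fin n} (hil : i ≠ l) :
    (sampleLaw L n).map (fun x => (x i, x l)) = L.prod L := by
  have hind : iIndepFun (fun (i : Fin n) (x : Fin n → α) => x i) (sampleLaw L n) :=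
    iIndepFun_pi (X := fun (_ : Fin n) (y : α) => y) fun _ => aemeasurable_id
  have h := (indepFun_iff_map_prod_eq_prod_map_map (measurable_pi_apply i).aemeasurable
    (measurable_pi_apply l).aemeasurable).1 (hind.indepFun hil)
  rw [h, (measurePreserving_eval (fun _ : Fin n => L) i).map_eq,
    (measurePreserving_eval (fun _ : Fin n => L) l).map_eq]

lemma measureReal_pair_ge_le {F : α × α → ℝ} (hF : Measurable F)
    (hint : Integrable (fun x => Real.exp (F x)) (L.prod L))
    (h2 : ∫ x, Real.exp (F x) ∂(L.prod L) ≤ 2) (t : ℝ) {i l : Fin n} (hil : i ≠ l) :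
    (sampleLaw L n).real {x | t ≤ F (x i, x l)} ≤ 2 * Real.exp (-t) := by
  have hm : Measurable fun x : Fin n → α => (x i, x l) := by fun_prop
  have h0 : (sampleLaw L n).real {x | t ≤ F (x i, x l)} = (L.prod L).real {y | t ≤ F y} := by
    rw [← map_pair_sampleLaw hil, map_measureReal_apply hm (measurableSet_le measurable_const hF)]
    rfl
  rw [h0]
  refine (measure_ge_le_exp_mul_mgf (X := F) t zero_le_one (by simpa using hint)).trans ?_
  rw [mgf, neg_one_mul, mul_comm]
  simp only [one_mul]
  exact mul_le_mul_of_nonneg_right h2 (Real.exp_pos _).le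

lemma exp_le_one_add_add_sq_mul_exp_abs (x : ℝ) :
    Real.exp x ≤ 1 + x + x ^ 2 * Real.exp |x| := by
  have h := Complex.norm_exp_sub_sum_le_norm_mul_exp (x : ℂ) 2
  have e : Complex.exp x - ∑ m ∈ Finset.range 2, (x : ℂ) ^ m / m.factorial =
      ((Real.exp x - 1 - x : ℝ) : ℂ) := by
    simp [Finset.sum_range_succ]; ring
  rw [e, Complex.norm_real, Complex.norm_real, Real.norm_eq_abs, Real.norm_eq_abs, sq_abs] at h
  have := le_of_abs_le h
  linarith

/-- One half of `exp |F|` absorbs `exp |s F|` and the other half absorbs `F²`, by `F² ≤ 8 exp (|F| /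
2)`. -/
lemma exp_mul_le {F s : ℝ} (hs : |s| ≤ 1 / 2) :
    Real.exp (s * F) ≤ 1 + s * F + 8 * s ^ 2 * Real.exp |F| := by
  refine (exp_le_one_add_add_sq_mul_exp_abs (s * F)).trans ?_
  have h1 : |s * F| ≤ |F| / 2 := by
    rw [abs_mul]; nlinarith [abs_nonneg F]
  have h2 : F ^ 2 ≤ 8 * Real.exp (|F| / 2) := by
    have h := Real.quadratic_le_exp_of_nonneg (x := |F| / 2) (by positivity)
    rw [← sq_abs]; nlinarith [abs_nonneg F]
  have h3 : Real.exp |F| = Real.exp (|F| / 2) * Real.exp (|F| / 2) := by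
    rw [← Real.exp_add]; congr 1; ring
  have h4 : (s * F) ^ 2 * Real.exp |s * F| ≤ 8 * s ^ 2 * Real.exp |F| := by
    rw [h3, mul_pow]
    calc s ^ 2 * F ^ 2 * Real.exp |s * F|
        ≤ s ^ 2 * (8 * Real.exp (|F| / 2)) * Real.exp (|F| / 2) := by gcongr
      _ = _ := by ring
  linarith

/-- Bernstein's inequality for sub-exponential observations. -/
lemma measureReal_abs_sum_sub_ge_le {F : α → ℝ} (hF : Measurable F)
    (hint : Integrable (fun x => Real.exp |F x|) L) (h3 : ∫ x, Real.exp |F x| ∂L ≤ 3) {s : ℝ}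
    (hs0 : 0 < s) (hs : s ≤ 1 / 2) :
    (sampleLaw L n).real {x | n * (32 * s) ≤ |∑ i, F (x i) - n * ∫ x, F x ∂L|} ≤
      2 * Real.exp (-(8 * (n * s ^ 2))) := by
  have hFi : Integrable F L := hint.mono' hF.aestronglyMeasurable
    (Filter.Eventually.of_forall fun x => by
      rw [Real.norm_eq_abs]; linarith [Real.add_one_le_exp |F x|])
  set m := ∫ x, F x ∂L with hm
  -- Centring removes the linear term, leaving `24 t²` with `24 = 8 · 3`. Chernoff at `t = ±s` with
  -- margin `8 s²` yields the threshold `32 s`.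
  have key : ∀ t : ℝ, |t| ≤ 1 / 2 → Integrable (fun x => Real.exp (t * (F x - m))) L ∧
      ∫ x, Real.exp (t * (F x - m)) ∂L ≤ Real.exp (24 * t ^ 2) := fun t ht => by
    have hdom : Integrable (fun x => 1 + t * F x + 8 * t ^ 2 * Real.exp |F x|) L :=
      ((integrable_const _).add (hFi.const_mul _)).add (hint.const_mul _)
    have hi : Integrable (fun x => Real.exp (t * F x)) L :=
      hdom.mono' (by fun_prop) (Filter.Eventually.of_forall fun x => by
        rw [Real.norm_of_nonneg (Real.exp_pos _).le]; exact exp_mul_le ht)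
    have e : ∀ x, Real.exp (t * (F x - m)) = Real.exp (-(t * m)) * Real.exp (t * F x) := fun x => by
      rw [← Real.exp_add]; congr 1; ring
    simp only [e]
    refine ⟨hi.const_mul _, ?_⟩
    rw [integral_const_mul]
    have h1 : ∫ x, Real.exp (t * F x) ∂L ≤ 1 + t * m + 24 * t ^ 2 := by
      refine (integral_mono hi hdom fun x => exp_mul_le ht).trans ?_
      have hlin : Integrable (fun x => 1 + t * F x) L :=
        (integrable_const _).add (hFi.const_mul _)
      rw [integral_add hlin (hint.const_mul _), integral_add (integrable_const _)
        (hFi.const_mul _), integral_const_mul, integral_const_mul]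
      simp only [integral_const, probReal_univ, smul_eq_mul, mul_one]
      nlinarith [sq_nonneg t]
    have h2 : 1 + t * m + 24 * t ^ 2 ≤ Real.exp (t * m + 24 * t ^ 2) := by
      have := Real.add_one_le_exp (t * m + 24 * t ^ 2); linarith
    calc _ ≤ Real.exp (-(t * m)) * Real.exp (t * m + 24 * t ^ 2) := by
          gcongr; exact h1.trans h2
      _ = _ := by rw [← Real.exp_add]; congr 1; ring
  have hside : ∀ t : ℝ, |t| ≤ 1 / 2 → t ^ 2 = s ^ 2 →
      (sampleLaw L n).real {x | n * (24 * t ^ 2 + 8 * s ^ 2) ≤ ∑ i, t * (F (x i) - m)} ≤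
      Real.exp (-(8 * (n * s ^ 2))) := fun t ht _ => by
    refine (measureReal_sum_ge_le (κ := 24 * t ^ 2) (τ := 8 * s ^ 2) (key t ht).1
      (key t ht).2).trans (le_of_eq ?_)
    congr 1; ring
  have hsub : {x : Fin n → α | n * (32 * s) ≤ |∑ i, F (x i) - n * m|} ⊆
      {x | n * (24 * s ^ 2 + 8 * s ^ 2) ≤ ∑ i, s * (F (x i) - m)} ∪
      {x | n * (24 * (-s) ^ 2 + 8 * s ^ 2) ≤ ∑ i, -s * (F (x i) - m)} := fun x hx => by
    simp only [Set.mem_ofPred_eq, Set.mem_union] at hx ⊢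
    have e : ∀ t : ℝ, ∑ i, t * (F (x i) - m) = t * (∑ i, F (x i) - n * m) := fun t => by
      rw [← Finset.mul_sum, Finset.sum_sub_distrib]; simp
    rw [e, e]
    rcases le_abs'.1 hx with h | h
    · right; nlinarith
    · left; nlinarith
  refine (measureReal_mono hsub).trans ((measureReal_union_le _ _).trans ?_)
  have h1 := hside s (by rw [abs_of_pos hs0]; exact hs) rfl
  have h2 := hside (-s) (by rw [abs_neg, abs_of_pos hs0]; exact hs) (by ring)
  linarith

end Chernoff

/-! ### Typical samples -/

/-- The properties of the signs `a_i` and of the standardized inverse radii `ν_i` of a typical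
sample. -/
structure GoodSample {n p : ℕ} (θ κ c : ℝ) (S : Mat p) (a : Fin n → Vec p) (ν : Fin n → ℝ) :
    Prop where
  unit : ∀ i, ‖a i‖ = 1
  pos : ∀ i, 0 < ν i
  cov : ∀ j k, |∑ i, a i j * a i k - n * S j k| ≤ n * (32 * Real.sqrt (Real.log p / n)) / (θ * p)
  mean : ∀ j, |∑ i, a i j| ≤ n * (32 * Real.sqrt (Real.log p / n)) / Real.sqrt (θ * p)
  sq : ∑ i, ν i ^ 2 ≤ n * (3 / κ)
  lower : n * (c / 4) ≤ ∑ i, min (ν i) 1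
  max_radius : ∀ i, κ * ν i ^ 2 ≤ 4 * Real.log (n * p)
  max_coord : ∀ i j, θ * p * a i j ^ 2 ≤ 4 * Real.log (n * p)
  orth : ∀ i l, i ≠ l → θ * p * inner ℝ (a i) (a l) ^ 2 ≤ 4 * Real.log (n * p)
  four : 16 * Real.log (n * p) ^ 2 * Real.log p ≤ n → ∀ j, ∑ i, (θ * p * a i j ^ 2) ^ 2 ≤ 16 * n

/-- The standing assumptions on the signs `a` and the standardized inverse radii `ν` under a law. -/
structure SignModel {α : Type*} [MeasurableSpace α] {p : ℕ} (θ κ c : ℝ) (L : Measure α)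
    (a : α → Vec p) (ν : α → ℝ) : Prop where
  meas_a : Measurable a
  meas_ν : Measurable ν
  unit : ∀ᵐ x ∂L, ‖a x‖ = 1
  pos : ∀ᵐ x ∂L, 0 < ν x
  le_one : ∀ x, ‖a x‖ ≤ 1
  exp_a : ∀ e : Vec p, ‖e‖ ≤ 1 → ∫ x, Real.exp (θ * p * inner ℝ e (a x) ^ 2) ∂L ≤ 2
  mean : ∀ e : Vec p, ∫ x, inner ℝ e (a x) ∂L = 0
  int_ν : Integrable (fun x => Real.exp (κ * ν x ^ 2)) L
  exp_ν : ∫ x, Real.exp (κ * ν x ^ 2) ∂L ≤ 2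
  lower : c ≤ ∫ x, min (ν x) 1 ∂L

/-! ### Probabilities of the individual exceptional events -/

section Events

variable {α : Type*} [MeasurableSpace α] {L : Measure α} [IsProbabilityMeasure L] {n p : ℕ}
  {θ κ c : ℝ} {a : α → Vec p} {ν : α → ℝ}

lemma SignModel.integrable_exp (h : SignModel θ κ c L a ν) (hθ : 0 < θ) {e : Vec p} (he : ‖e‖ ≤ 1) :
    Integrable (fun x => Real.exp (θ * p * inner ℝ e (a x) ^ 2)) L := by
  have := h.meas_a
  refine Integrable.of_bound (C := Real.exp (θ * p * 1)) (by fun_prop)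
    (Filter.Eventually.of_forall fun x => ?_)
  rw [Real.norm_of_nonneg (Real.exp_pos _).le]
  refine Real.exp_le_exp.2 (mul_le_mul_of_nonneg_left ?_ (by positivity))
  rw [sq_le_one_iff_abs_le_one]
  refine (abs_real_inner_le_norm _ _).trans ?_
  exact mul_le_one₀ he (norm_nonneg _) (h.le_one x)

lemma inner_single_coord (j : Fin p) (v : Vec p) :
    inner ℝ (EuclideanSpace.single j 1 : Vec p) v = v j := by
  simp [EuclideanSpace.inner_single_left]

lemma SignModel.exp_coord (h : SignModel θ κ c L a ν) (hθ : 0 < θ) (j : Fin p) :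
    Integrable (fun x => Real.exp (θ * p * a x j ^ 2)) L ∧
      ∫ x, Real.exp (θ * p * a x j ^ 2) ∂L ≤ 2 := by
  have he : ‖(EuclideanSpace.single j 1 : Vec p)‖ ≤ 1 := by simp
  have h1 := h.integrable_exp hθ he
  have h2 := h.exp_a _ he
  simp only [inner_single_coord] at h1 h2
  exact ⟨h1, h2⟩

/-- Products of sub-Gaussian variables are sub-exponential: `exp |x y| ≤ (exp x² + exp y²) / 2`.
Bernstein's inequality is applied after scaling by `θ p`. -/
lemma SignModel.measureReal_cov (h : SignModel θ κ c L a ν) (hθ : 0 < θ) (hp : 0 < p) {s : ℝ}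
    (hs0 : 0 < s) (hs : s ≤ 1 / 2) (j k : Fin p) :
    (sampleLaw L n).real {x | n * (32 * s) / (θ * p) <
      |∑ i, a (x i) j * a (x i) k - n * ∫ y, a y j * a y k ∂L|} ≤
      2 * Real.exp (-(8 * (n * s ^ 2))) := by
  have hp' : (0 : ℝ) < p := by exact_mod_cast hp
  have hma := h.meas_a
  have hm : Measurable fun x => θ * p * (a x j * a x k) := by fun_prop
  obtain ⟨ij, bj⟩ := h.exp_coord hθ j
  obtain ⟨ik, bk⟩ := h.exp_coord hθ k
  have hle : ∀ x, Real.exp |θ * p * (a x j * a x k)| ≤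
      Real.exp (θ * p * a x j ^ 2) + Real.exp (θ * p * a x k ^ 2) := fun x => by
    have h1 : |θ * p * (a x j * a x k)| ≤ max (θ * p * a x j ^ 2) (θ * p * a x k ^ 2) := by
      rw [abs_mul, abs_of_pos (by positivity : 0 < θ * p), ← mul_max_of_nonneg _ _ (by positivity)]
      refine mul_le_mul_of_nonneg_left ?_ (by positivity)
      rw [abs_mul, ← sq_abs (a x j), ← sq_abs (a x k)]
      rcases le_total |a x j| |a x k| with hh | hh
      · exact le_max_of_le_right (by nlinarith [abs_nonneg (a x j), abs_nonneg (a x k)])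
      · exact le_max_of_le_left (by nlinarith [abs_nonneg (a x j), abs_nonneg (a x k)])
    refine (Real.exp_le_exp.2 h1).trans ?_
    rcases max_cases (θ * p * a x j ^ 2) (θ * p * a x k ^ 2) with ⟨hh, -⟩ | ⟨hh, -⟩ <;> rw [hh]
    · linarith [Real.exp_pos (θ * p * a x k ^ 2)]
    · linarith [Real.exp_pos (θ * p * a x j ^ 2)]
  have hle' : ∀ x, Real.exp |θ * p * (a x j * a x k)| ≤
      (Real.exp (θ * p * a x j ^ 2) + Real.exp (θ * p * a x k ^ 2)) / 2 := fun x => by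
    have h1 : |θ * p * (a x j * a x k)| ≤ (θ * p * a x j ^ 2) / 2 + (θ * p * a x k ^ 2) / 2 := by
      rw [abs_mul, abs_of_pos (by positivity : 0 < θ * p), abs_mul, ← sq_abs (a x j),
        ← sq_abs (a x k)]
      have : 0 < θ * p := by positivity
      nlinarith [sq_nonneg (|a x j| - |a x k|)]
    refine (Real.exp_le_exp.2 h1).trans ?_
    rw [Real.exp_add]
    have e1 : Real.exp (θ * p * a x j ^ 2) = Real.exp (θ * p * a x j ^ 2 / 2) ^ 2 := by
      rw [← Real.exp_nat_mul]; congr 1; push_cast; ring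
    have e2 : Real.exp (θ * p * a x k ^ 2) = Real.exp (θ * p * a x k ^ 2 / 2) ^ 2 := by
      rw [← Real.exp_nat_mul]; congr 1; push_cast; ring
    rw [e1, e2]
    nlinarith [sq_nonneg (Real.exp (θ * p * a x j ^ 2 / 2) - Real.exp (θ * p * a x k ^ 2 / 2))]
  have hint : Integrable (fun x => Real.exp |θ * p * (a x j * a x k)|) L :=
    (ij.add ik).mono' (by fun_prop) (Filter.Eventually.of_forall fun x => by
      rw [Real.norm_of_nonneg (Real.exp_pos _).le]; exact hle x)
  have h3 : ∫ x, Real.exp |θ * p * (a x j * a x k)| ∂L ≤ 3 := by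
    refine (integral_mono hint ((ij.add ik).div_const 2) hle').trans ?_
    simp only [Pi.add_apply]
    rw [integral_div, integral_add ij ik]
    linarith
  refine (measureReal_mono fun x hx => ?_).trans (measureReal_abs_sum_sub_ge_le hm hint h3 hs0 hs)
  simp only [Set.mem_ofPred_eq] at hx ⊢
  rw [integral_const_mul, ← Finset.mul_sum]
  have e : θ * p * ∑ i, a (x i) j * a (x i) k - n * (θ * p * ∫ y, a y j * a y k ∂L) =
      θ * p * (∑ i, a (x i) j * a (x i) k - n * ∫ y, a y j * a y k ∂L) := by ring
  rw [e, abs_mul, abs_of_pos (by positivity : 0 < θ * p)]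
  rw [div_lt_iff₀ (by positivity)] at hx
  linarith

/-- Bernstein's inequality after scaling by `√(θ p)`; `|t| ≤ 1/4 + t²` and `exp (1/4) ≤ 3/2` supply
the required moment bound `3`. -/
lemma SignModel.measureReal_mean (h : SignModel θ κ c L a ν) (hθ : 0 < θ) (hp : 0 < p) {s : ℝ}
    (hs0 : 0 < s) (hs : s ≤ 1 / 2) (j : Fin p) :
    (sampleLaw L n).real {x | n * (32 * s) / Real.sqrt (θ * p) < |∑ i, a (x i) j|} ≤
      2 * Real.exp (-(8 * (n * s ^ 2))) := by
  have hp' : (0 : ℝ) < p := by exact_mod_cast hp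
  have hma := h.meas_a
  have hr : 0 < Real.sqrt (θ * p) := Real.sqrt_pos.2 (by positivity)
  have hm : Measurable fun x => Real.sqrt (θ * p) * a x j := by fun_prop
  obtain ⟨ij, bj⟩ := h.exp_coord hθ j
  have he : Real.exp (1 / 4) ≤ 3 / 2 := by
    have := Real.exp_bound_div_one_sub_of_interval (x := 1 / 4) (by norm_num) (by norm_num)
    norm_num at this ⊢; linarith
  have hle : ∀ x, Real.exp |Real.sqrt (θ * p) * a x j| ≤
      3 / 2 * Real.exp (θ * p * a x j ^ 2) := fun x => by
    have h1 : |Real.sqrt (θ * p) * a x j| ≤ 1 / 4 + θ * p * a x j ^ 2 := by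
      have h2 : |Real.sqrt (θ * p) * a x j| ^ 2 = θ * p * a x j ^ 2 := by
        rw [sq_abs, mul_pow, Real.sq_sqrt (by positivity)]
      nlinarith [sq_nonneg (|Real.sqrt (θ * p) * a x j| - 1 / 2)]
    refine (Real.exp_le_exp.2 h1).trans ?_
    rw [Real.exp_add]
    exact mul_le_mul_of_nonneg_right he (Real.exp_pos _).le
  have hint : Integrable (fun x => Real.exp |Real.sqrt (θ * p) * a x j|) L :=
    (ij.const_mul (3 / 2)).mono' (by fun_prop) (Filter.Eventually.of_forall fun x => by
      rw [Real.norm_of_nonneg (Real.exp_pos _).le]; exact hle x)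
  have h3 : ∫ x, Real.exp |Real.sqrt (θ * p) * a x j| ∂L ≤ 3 := by
    refine (integral_mono hint (ij.const_mul _) hle).trans ?_
    rw [integral_const_mul]; linarith
  have hmean : ∫ x, Real.sqrt (θ * p) * a x j ∂L = 0 := by
    have := h.mean (EuclideanSpace.single j 1)
    simp only [inner_single_coord] at this
    rw [integral_const_mul, this, mul_zero]
  refine (measureReal_mono fun x hx => ?_).trans (measureReal_abs_sum_sub_ge_le hm hint h3 hs0 hs)
  simp only [Set.mem_ofPred_eq] at hx ⊢
  rw [hmean, mul_zero, sub_zero, ← Finset.mul_sum, abs_mul, abs_of_pos hr]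
  rw [div_lt_iff₀ hr] at hx
  linarith

lemma SignModel.measureReal_sq (h : SignModel θ κ c L a ν) (hκ : 0 < κ) :
    (sampleLaw L n).real {x | n * (3 / κ) < ∑ i, ν (x i) ^ 2} ≤ Real.exp (-(n * 2)) := by
  have h2 : ∫ x, Real.exp (κ * ν x ^ 2) ∂L ≤ Real.exp 1 :=
    h.exp_ν.trans (by have := Real.add_one_le_exp (1 : ℝ); linarith)
  refine (measureReal_mono fun x hx => ?_).trans (measureReal_sum_ge_le (τ := 2) h.int_ν h2)
  simp only [Set.mem_ofPred_eq] at hx ⊢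
  rw [← Finset.mul_sum]
  have := mul_le_mul_of_nonneg_left hx.le hκ.le
  have e : κ * (n * (3 / κ)) = n * (1 + 2) := by field_simp; ring
  linarith

/-- Lower tail of a bounded variable: `exp (-t) ≤ 1 - t / 2` on `[0, 1]` gives a moment at most `exp
(-c / 2)`, half of which is spent on the threshold. -/
lemma SignModel.measureReal_lower (h : SignModel θ κ c L a ν) :
    (sampleLaw L n).real {x | ∑ i, min (ν (x i)) 1 < n * (c / 4)} ≤ Real.exp (-(n * (c / 4))) := by
  have hmν := h.meas_ν
  have hb : ∀ᵐ x ∂L, 0 ≤ min (ν x) 1 := by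
    filter_upwards [h.pos] with x hx using le_min hx.le zero_le_one
  have hint : Integrable (fun x => Real.exp (-min (ν x) 1)) L := by
    refine Integrable.of_bound (C := 1) (by fun_prop) ?_
    filter_upwards [hb] with x hx
    rw [Real.norm_of_nonneg (Real.exp_pos _).le]
    exact Real.exp_le_one_iff.2 (by linarith)
  have hminint : Integrable (fun x => min (ν x) 1) L := by
    refine Integrable.of_bound (C := 1) (by fun_prop) ?_
    filter_upwards [hb] with x hx
    rw [Real.norm_of_nonneg hx]; exact min_le_right _ _
  have hle : ∫ x, Real.exp (-min (ν x) 1) ∂L ≤ Real.exp (-(c / 2)) := by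
    have h1 : ∫ x, Real.exp (-min (ν x) 1) ∂L ≤ ∫ x, (1 - min (ν x) 1 / 2) ∂L := by
      refine integral_mono_ae hint ((integrable_const _).sub (hminint.div_const 2)) ?_
      filter_upwards [hb] with x hx
      set t := min (ν x) 1
      have ht1 : t ≤ 1 := min_le_right _ _
      have h2 : Real.exp (-t) ≤ 1 / (1 + t) := by
        rw [Real.exp_neg, ← one_div]
        exact one_div_le_one_div_of_le (by linarith) (by linarith [Real.add_one_le_exp t])
      refine h2.trans ?_
      rw [div_le_iff₀ (by linarith)]; nlinarith
    rw [integral_sub (integrable_const _) (hminint.div_const 2), integral_div] at h1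
    simp only [integral_const, probReal_univ, smul_eq_mul, mul_one] at h1
    have := Real.add_one_le_exp (-(c / 2))
    linarith [h.lower]
  refine (measureReal_mono fun x hx => ?_).trans
    (measureReal_sum_ge_le (τ := c / 4) hint hle)
  simp only [Set.mem_ofPred_eq] at hx ⊢
  rw [Finset.sum_neg_distrib]
  linarith

/-- With one of the two independent signs fixed as the direction, the other has a sub-Gaussian
projection on it. -/
lemma SignModel.measureReal_orth (h : SignModel θ κ c L a ν) (hθ : 0 < θ) (t : ℝ) {i l : Fin n}
    (hil : i ≠ l) :
    (sampleLaw L n).real {x | t < θ * p * inner ℝ (a (x i)) (a (x l)) ^ 2} ≤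
      2 * Real.exp (-t) := by
  have hma := h.meas_a
  have hm : Measurable fun y : α × α => θ * p * inner ℝ (a y.1) (a y.2) ^ 2 := by fun_prop
  have hint : Integrable (fun y : α × α => Real.exp (θ * p * inner ℝ (a y.1) (a y.2) ^ 2))
      (L.prod L) := by
    refine Integrable.of_bound (C := Real.exp (θ * p * 1)) (by fun_prop)
      (Filter.Eventually.of_forall fun y => ?_)
    rw [Real.norm_of_nonneg (Real.exp_pos _).le]
    refine Real.exp_le_exp.2 (mul_le_mul_of_nonneg_left ?_ (by positivity))
    rw [sq_le_one_iff_abs_le_one]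
    refine (abs_real_inner_le_norm _ _).trans ?_
    exact mul_le_one₀ (h.le_one _) (norm_nonneg _) (h.le_one _)
  have h2 : ∫ y, Real.exp (θ * p * inner ℝ (a y.1) (a y.2) ^ 2) ∂(L.prod L) ≤ 2 := by
    rw [integral_prod _ hint]
    refine (integral_mono hint.integral_prod_left (integrable_const 2)
      fun y => h.exp_a (a y) (h.le_one y)).trans ?_
    simp
  refine (measureReal_mono fun x hx => ?_).trans (measureReal_pair_ge_le hm hint h2 t hil)
  simp only [Set.mem_ofPred_eq] at hx ⊢
  exact hx.le

/-- Squares of sub-exponential variables need not have exponential moments, so they are truncated at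
`B`. Divided by `B` they lie in `[0, 1]`, where `exp F ≤ 1 + 2 F`, and `x² ≤ 2 exp x` bounds their
mean. -/
lemma SignModel.measureReal_four (h : SignModel θ κ c L a ν) (hθ : 0 < θ) {B τ : ℝ} (hB : 0 < B)
    (j : Fin p) :
    (sampleLaw L n).real {x | n * (8 + B * τ) < ∑ i, min ((θ * p * a (x i) j ^ 2) ^ 2) B} ≤
      Real.exp (-(n * τ)) := by
  have hma := h.meas_a
  obtain ⟨ij, bj⟩ := h.exp_coord hθ j
  let F : α → ℝ := fun x => min ((θ * p * a x j ^ 2) ^ 2) B / B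
  have hF0 : ∀ x, 0 ≤ F x := fun x => div_nonneg (le_min (by positivity) hB.le) hB.le
  have hF1 : ∀ x, F x ≤ 1 := fun x => (div_le_one hB).2 (min_le_right _ _)
  have hexp : ∀ x, Real.exp (F x) ≤ 1 + 4 / B * Real.exp (θ * p * a x j ^ 2) := fun x => by
    have h1 : Real.exp (F x) ≤ 1 + 2 * F x := by
      have h2 := Real.abs_exp_sub_one_le (x := F x) (by rw [abs_of_nonneg (hF0 x)]; exact hF1 x)
      rw [abs_of_nonneg (hF0 x)] at h2
      linarith [le_of_abs_le h2]
    have h3 : F x ≤ 2 * Real.exp (θ * p * a x j ^ 2) / B := by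
      refine div_le_div_of_nonneg_right ((min_le_left _ _).trans ?_) hB.le
      have h4 : 0 ≤ θ * p * a x j ^ 2 := by positivity
      have h5 := Real.quadratic_le_exp_of_nonneg h4
      linarith
    calc Real.exp (F x) ≤ 1 + 2 * (2 * Real.exp (θ * p * a x j ^ 2) / B) := by linarith
      _ = _ := by ring
  have hint : Integrable (fun x => Real.exp (F x)) L := by
    refine Integrable.of_bound (C := Real.exp 1) (by fun_prop)
      (Filter.Eventually.of_forall fun x => ?_)
    rw [Real.norm_of_nonneg (Real.exp_pos _).le]
    exact Real.exp_le_exp.2 (hF1 x)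
  have hle : ∫ x, Real.exp (F x) ∂L ≤ Real.exp (8 / B) := by
    have hdom : Integrable (fun x => 1 + 4 / B * Real.exp (θ * p * a x j ^ 2)) L :=
      (integrable_const _).add (ij.const_mul _)
    refine (integral_mono hint hdom hexp).trans ?_
    rw [integral_add (integrable_const _) (ij.const_mul _), integral_const_mul]
    simp only [integral_const, probReal_univ, smul_eq_mul, mul_one]
    have h1 : 4 / B * ∫ x, Real.exp (θ * p * a x j ^ 2) ∂L ≤ 4 / B * 2 := by gcongr
    have h2 : 4 / B * 2 = 8 / B := by ring
    linarith [Real.add_one_le_exp (8 / B)]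
  refine (measureReal_mono fun x hx => ?_).trans (measureReal_sum_ge_le (τ := τ) hint hle)
  simp only [Set.mem_ofPred_eq, F] at hx ⊢
  rw [← Finset.sum_div, le_div_iff₀ hB]
  refine le_trans (le_of_eq ?_) hx.le
  field_simp

end Events

end SCLIME

end

noncomputable section

namespace SCLIME

/-! ### Union bound over the exceptional events -/

section Union

variable {α : Type*} [MeasurableSpace α] {L : Measure α} [IsProbabilityMeasure L] {n p : ℕ}
  {θ κ c : ℝ} {a : α → Vec p} {ν : α → ℝ}

lemma measureReal_iUnion_le_card_mul {β ι : Type*} [MeasurableSpace β] [Fintype ι]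
    {μ : Measure β} {E : ι → Set β} {b : ℝ} (hE : ∀ i, μ.real (E i) ≤ b) :
    μ.real (⋃ i, E i) ≤ Fintype.card ι * b := by
  refine (measureReal_iUnion_fintype_le E).trans ((Finset.sum_le_sum fun i _ => hE i).trans ?_)
  simp

lemma SignModel.ae_sample (h : SignModel θ κ c L a ν) :
    ∀ᵐ x ∂(sampleLaw L n), ∀ i, ‖a (x i)‖ = 1 ∧ 0 < ν (x i) := by
  rw [ae_all_iff]
  intro i
  exact (measurePreserving_eval (fun _ : Fin n => L) i).quasiMeasurePreserving.ae
    (h.unit.and h.pos)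

/-- A sample is typical with probability at least `1 - 16 / p ^ 3`. -/
lemma SignModel.measureReal_not_goodSample_le (h : SignModel θ κ c L a ν) (hθ : 0 < θ)
    (hκ : 0 < κ) (hc1 : c ≤ 1) (hn : 0 < n) (hp : 2 ≤ p) (hnp : Real.log p ≤ n * (c / 32)) :
    (sampleLaw L n).real {x | ¬GoodSample θ κ c
      (Matrix.of fun j k => ∫ y, a y j * a y k ∂L) (fun i => a (x i)) (fun i => ν (x i))} ≤
      16 / (p : ℝ) ^ 3 := by
  have hn0 : (0 : ℝ) < n := by exact_mod_cast hn
  have hn1 : (1 : ℝ) ≤ n := by exact_mod_cast hn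
  have hp2 : (2 : ℝ) ≤ p := by exact_mod_cast hp
  have hp0 : (0 : ℝ) < p := by linarith
  have hp1 : (1 : ℝ) ≤ p := by linarith
  have hℓ : 0 < Real.log p := Real.log_pos (by linarith)
  set ℓ := Real.log p with hℓdef
  set s := Real.sqrt (ℓ / n) with hs
  have hs0 : 0 < s := Real.sqrt_pos.2 (by positivity)
  have hs2 : n * s ^ 2 = ℓ := by rw [hs, Real.sq_sqrt (by positivity)]; field_simp
  have hsle : s ≤ 1 / 2 := by
    rw [hs, Real.sqrt_le_left (by norm_num), div_le_iff₀ hn0]; nlinarith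
  have hexpℓ : Real.exp (-(8 * ℓ)) = 1 / (p : ℝ) ^ 8 := by
    rw [Real.exp_neg, show 8 * ℓ = ((8 : ℕ) : ℝ) * ℓ by norm_num, Real.exp_nat_mul,
      Real.exp_log hp0, one_div]
  have hpow : ∀ k : ℕ, 3 ≤ k → 1 / (p : ℝ) ^ k ≤ 1 / (p : ℝ) ^ 3 := fun k hk =>
    one_div_le_one_div_of_le (by positivity) (pow_le_pow_right₀ hp1 hk)
  have hexpnp : Real.exp (-(4 * Real.log (n * p))) = 1 / (n * p : ℝ) ^ 4 := by
    rw [Real.exp_neg, show 4 * Real.log (n * p) = ((4 : ℕ) : ℝ) * Real.log (n * p) by norm_num,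
      Real.exp_nat_mul, Real.exp_log (by positivity), one_div]
  have hnp4 : (n : ℝ) * p * (1 / (n * p : ℝ) ^ 4) ≤ 1 / (p : ℝ) ^ 3 := by
    rw [show (n : ℝ) * p * (1 / (n * p : ℝ) ^ 4) = 1 / (n * p : ℝ) ^ 3 by field_simp]
    refine one_div_le_one_div_of_le (by positivity) (pow_le_pow_left₀ hp0.le ?_ 3)
    nlinarith
  have hnn4 : (n : ℝ) * n * (1 / (n * p : ℝ) ^ 4) ≤ 1 / (p : ℝ) ^ 3 := by
    rw [show (n : ℝ) * n * (1 / (n * p : ℝ) ^ 4) = 1 / (n ^ 2 * p ^ 4 : ℝ) by field_simp]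
    refine one_div_le_one_div_of_le (by positivity) ?_
    calc (p : ℝ) ^ 3 ≤ p ^ 4 := pow_le_pow_right₀ hp1 (by norm_num)
      _ ≤ n ^ 2 * p ^ 4 := le_mul_of_one_le_left (by positivity) (one_le_pow₀ hn1)
  have hn4 : (n : ℝ) * (1 / (n * p : ℝ) ^ 4) ≤ 1 / (p : ℝ) ^ 3 :=
    le_trans (mul_le_mul_of_nonneg_right (by nlinarith) (by positivity)) hnn4
  have hb0 : (0 : ℝ) < 1 / p ^ 3 := by positivity
  let μ := sampleLaw L n
  -- Each of the first eight events has probability at most `2 / p³`, and the last is null.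
  let E₁ : Set (Fin n → α) := ⋃ jk : Fin p × Fin p, {x | n * (32 * s) / (θ * p) <
      |∑ i, a (x i) jk.1 * a (x i) jk.2 - n * ∫ y, a y jk.1 * a y jk.2 ∂L|}
  let E₂ : Set (Fin n → α) := ⋃ j : Fin p, {x | n * (32 * s) / Real.sqrt (θ * p) <
      |∑ i, a (x i) j|}
  let E₃ : Set (Fin n → α) := {x | n * (3 / κ) < ∑ i, ν (x i) ^ 2}
  let E₄ : Set (Fin n → α) := {x | ∑ i, min (ν (x i)) 1 < n * (c / 4)}
  let E₅ : Set (Fin n → α) := ⋃ i : Fin n, {x | 4 * Real.log (n * p) < κ * ν (x i) ^ 2}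
  let E₆ : Set (Fin n → α) := ⋃ ij : Fin n × Fin p,
    {x | 4 * Real.log (n * p) < θ * p * a (x ij.1) ij.2 ^ 2}
  let E₇ : Set (Fin n → α) := ⋃ il : Fin n × Fin n, {x | il.1 ≠ il.2 ∧
    4 * Real.log (n * p) < θ * p * inner ℝ (a (x il.1)) (a (x il.2)) ^ 2}
  let B := 16 * Real.log (n * p) ^ 2
  let E₈ : Set (Fin n → α) := ⋃ j : Fin p, {x | n * (8 + B * (8 * ℓ / n)) <
    ∑ i, min ((θ * p * a (x i) j ^ 2) ^ 2) B}
  let E₉ : Set (Fin n → α) := {x | ¬∀ i, ‖a (x i)‖ = 1 ∧ 0 < ν (x i)}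
  have hlog : 0 < Real.log (n * p) := Real.log_pos (by nlinarith)
  have hB : 0 < B := by positivity
  have hp86 : (p : ℝ) * p * (1 / p ^ 8) ≤ 1 / p ^ 3 := by
    rw [show (p : ℝ) * p * (1 / p ^ 8) = 1 / p ^ 6 by field_simp]
    exact hpow 6 (by norm_num)
  have hp87 : (p : ℝ) * (1 / p ^ 8) ≤ 1 / p ^ 3 := by
    rw [show (p : ℝ) * (1 / p ^ 8) = 1 / p ^ 7 by field_simp]
    exact hpow 7 (by norm_num)
  have b₁ : μ.real E₁ ≤ 2 / p ^ 3 := by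
    have := measureReal_iUnion_le_card_mul (μ := μ) fun jk : Fin p × Fin p =>
      h.measureReal_cov (n := n) hθ (by omega) hs0 hsle jk.1 jk.2
    refine this.trans ?_
    rw [hs2, hexpℓ, Fintype.card_prod, Fintype.card_fin, Nat.cast_mul]
    linear_combination 2 * hp86
  have b₂ : μ.real E₂ ≤ 2 / p ^ 3 := by
    have := measureReal_iUnion_le_card_mul (μ := μ) fun j : Fin p =>
      h.measureReal_mean (n := n) hθ (by omega) hs0 hsle j
    refine this.trans ?_
    rw [hs2, hexpℓ, Fintype.card_fin]
    linear_combination 2 * hp87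
  have b₃ : μ.real E₃ ≤ 2 / p ^ 3 := by
    refine (h.measureReal_sq (n := n) hκ).trans ?_
    have h1 : Real.exp (-(n * 2)) ≤ Real.exp (-(8 * ℓ)) := Real.exp_le_exp.2 (by nlinarith)
    rw [hexpℓ] at h1
    linear_combination h1 + hpow 8 (by norm_num) + hb0
  have b₄ : μ.real E₄ ≤ 2 / p ^ 3 := by
    refine (h.measureReal_lower (n := n)).trans ?_
    have h1 : Real.exp (-(n * (c / 4))) ≤ Real.exp (-(8 * ℓ)) := Real.exp_le_exp.2 (by linarith)
    rw [hexpℓ] at h1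
    linear_combination h1 + hpow 8 (by norm_num) + hb0
  have b₅ : μ.real E₅ ≤ 2 / p ^ 3 := by
    have := measureReal_iUnion_le_card_mul (μ := μ)
      (E := fun i : Fin n => {x | 4 * Real.log (n * p) < κ * ν (x i) ^ 2}) fun i =>
      (measureReal_mono fun x hx => (Set.mem_ofPred_eq ▸ hx : _ < _).le).trans
        (measureReal_coord_ge_le h.int_ν h.exp_ν (4 * Real.log (n * p)) i)
    refine this.trans ?_
    rw [hexpnp, Fintype.card_fin]
    linear_combination 2 * hn4
  have b₆ : μ.real E₆ ≤ 2 / p ^ 3 := by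
    have := measureReal_iUnion_le_card_mul (μ := μ) (E := fun ij : Fin n × Fin p =>
      {x | 4 * Real.log (n * p) < θ * p * a (x ij.1) ij.2 ^ 2}) fun ij =>
      (measureReal_mono fun x hx => (Set.mem_ofPred_eq ▸ hx : _ < _).le).trans
        (measureReal_coord_ge_le (h.exp_coord hθ ij.2).1 (h.exp_coord hθ ij.2).2
          (4 * Real.log (n * p)) ij.1)
    refine this.trans ?_
    rw [hexpnp, Fintype.card_prod, Fintype.card_fin, Fintype.card_fin, Nat.cast_mul]
    linear_combination 2 * hnp4
  have b₇ : μ.real E₇ ≤ 2 / p ^ 3 := by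
    have := measureReal_iUnion_le_card_mul (μ := μ) (b := 2 * Real.exp (-(4 * Real.log (n * p))))
      (E := fun il : Fin n × Fin n => {x | il.1 ≠ il.2 ∧
        4 * Real.log (n * p) < θ * p * inner ℝ (a (x il.1)) (a (x il.2)) ^ 2}) fun il => by
      by_cases hil : il.1 = il.2
      · simp only [hil, ne_eq, not_true_eq_false, false_and, Set.ofPred_false, measureReal_empty]
        positivity
      · refine (measureReal_mono fun x hx => ?_).trans
          (h.measureReal_orth hθ (4 * Real.log (n * p)) hil)
        exact hx.2
    refine this.trans ?_
    rw [hexpnp, Fintype.card_prod, Fintype.card_fin, Nat.cast_mul]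
    linear_combination 2 * hnn4
  have b₈ : μ.real E₈ ≤ 2 / p ^ 3 := by
    have := measureReal_iUnion_le_card_mul (μ := μ) fun j : Fin p =>
      h.measureReal_four (n := n) (τ := 8 * ℓ / n) hθ hB j
    refine this.trans ?_
    rw [show (n : ℝ) * (8 * ℓ / n) = 8 * ℓ by field_simp, hexpℓ, Fintype.card_fin]
    linear_combination hp87 + hb0
  have b₉ : μ.real E₉ = 0 := by
    rw [measureReal_def, (ae_iff.1 (h.ae_sample (n := n)) : μ E₉ = 0), ENNReal.toReal_zero]
  have hsub : {x | ¬GoodSample θ κ c (Matrix.of fun j k => ∫ y, a y j * a y k ∂L)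
      (fun i => a (x i)) (fun i => ν (x i))} ⊆
      E₁ ∪ E₂ ∪ E₃ ∪ E₄ ∪ E₅ ∪ E₆ ∪ E₇ ∪ E₈ ∪ E₉ := by
    intro x hx
    by_contra hne
    simp only [Set.mem_union, not_or] at hne
    obtain ⟨⟨⟨⟨⟨⟨⟨⟨m₁, m₂⟩, m₃⟩, m₄⟩, m₅⟩, m₆⟩, m₇⟩, m₈⟩, m₉⟩ := hne
    simp only [E₁, E₂, E₃, E₄, E₅, E₆, E₇, E₈, E₉, Set.mem_iUnion, Set.mem_ofPred_eq, not_exists,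
      not_lt, not_and, not_not, Prod.forall] at m₁ m₂ m₃ m₄ m₅ m₆ m₇ m₈ m₉
    refine hx ⟨fun i => (m₉ i).1, fun i => (m₉ i).2, m₁, m₂, m₃, m₄, m₅, m₆, m₇, fun hreg j => ?_⟩
    -- Off `E₆` the truncation at `B = (4 log(np))²` is inactive, so the truncated sum controls the
    -- true one.
    have h1 : ∀ i, min ((θ * p * a (x i) j ^ 2) ^ 2) B = (θ * p * a (x i) j ^ 2) ^ 2 := fun i => by
      refine min_eq_left ?_
      have h2 : 0 ≤ θ * p * a (x i) j ^ 2 := by positivity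
      calc (θ * p * a (x i) j ^ 2) ^ 2 ≤ (4 * Real.log (n * p)) ^ 2 :=
            pow_le_pow_left₀ h2 (m₆ i j) 2
        _ = B := by simp only [B]; ring
    have h2 := m₈ j
    simp only [h1] at h2
    refine h2.trans ?_
    have h3 : B * (8 * ℓ / n) ≤ 8 := by
      rw [mul_div_assoc', div_le_iff₀ hn0]
      simp only [B]
      linarith
    nlinarith
  have u : ∀ {A C : Set (Fin n → α)} {x y : ℝ}, μ.real A ≤ x → μ.real C ≤ y →
      μ.real (A ∪ C) ≤ x + y := fun hA hC => (measureReal_union_le _ _).trans (add_le_add hA hC)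
  refine (measureReal_mono hsub).trans ((u (u (u (u (u (u (u (u b₁ b₂) b₃) b₄) b₅) b₆) b₇) b₈)
    b₉.le).trans (le_of_eq ?_))
  ring

end Union

end SCLIME

end

noncomputable section

namespace SCLIME

/-! ### Accuracy of the sample spatial-sign covariance matrix on a typical sample -/

lemma exists_mul_log_pow_le (K : ℝ) (k : ℕ) :
    ∃ N : ℕ, ∀ n : ℕ, N ≤ n → K * Real.log n ^ k ≤ n := by
  have h := (Real.isLittleO_pow_log_id_atTop (n := k)).def (c := 1 / (|K| + 1)) (by positivity)
  obtain ⟨N, hN⟩ := Filter.eventually_atTop.1 (tendsto_natCast_atTop_atTop.eventually h)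
  refine ⟨N, fun n hn => ?_⟩
  have h1 := hN n hn
  simp only [Real.norm_eq_abs, id, Nat.abs_cast] at h1
  rw [div_mul_eq_mul_div, le_div_iff₀ (by positivity), one_mul] at h1
  calc K * Real.log n ^ k ≤ |K * Real.log n ^ k| := le_abs_self _
    _ = |Real.log n ^ k| * |K| := by rw [abs_mul, mul_comm]
    _ ≤ |Real.log n ^ k| * (|K| + 1) := by gcongr; linarith
    _ ≤ n := h1

/-- The entrywise deviation `b` costs `(∑ |z_j|)² b ≤ p b ‖z‖²`. Since `b` is itself of order `n s /
p`, this is a small multiple of `n ‖z‖²`. -/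
lemma sum_inner_sq_le {n p : ℕ} {a : Fin n → Vec p} {S : Mat p} {b g : ℝ} (hb : 0 ≤ b)
    (hcov : ∀ j k, |∑ i, a i j * a i k - n * S j k| ≤ b)
    (hS : ∀ e : Vec p, ∑ j, ∑ k, e j * e k * S j k ≤ g * ‖e‖ ^ 2) (z : Vec p) :
    ∑ i, inner ℝ (a i) z ^ 2 ≤ (n * g + p * b) * ‖z‖ ^ 2 := by
  have h1 : ∀ i, inner ℝ (a i) z ^ 2 = ∑ j, ∑ k, z j * z k * (a i j * a i k) := fun i => by
    have : inner ℝ (a i) z = ∑ j, z j * a i j := by simp [PiLp.inner_apply]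
    rw [this, sq, Finset.sum_mul_sum]
    exact Finset.sum_congr rfl fun j _ => Finset.sum_congr rfl fun k _ => by ring
  have h2 : ∑ i, inner ℝ (a i) z ^ 2 = n * (∑ j, ∑ k, z j * z k * S j k) +
      ∑ j, ∑ k, z j * z k * (∑ i, a i j * a i k - n * S j k) := by
    simp only [h1]
    rw [Finset.sum_comm, Finset.mul_sum, ← Finset.sum_add_distrib]
    refine Finset.sum_congr rfl fun j _ => ?_
    rw [Finset.sum_comm, Finset.mul_sum, ← Finset.sum_add_distrib]
    refine Finset.sum_congr rfl fun k _ => ?_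
    rw [← Finset.mul_sum]; ring
  have h3 : ∑ j, ∑ k, z j * z k * (∑ i, a i j * a i k - n * S j k) ≤
      (∑ j, |z j|) ^ 2 * b := by
    rw [sq, Finset.sum_mul_sum, Finset.sum_mul]
    refine Finset.sum_le_sum fun j _ => ?_
    rw [Finset.sum_mul]
    refine Finset.sum_le_sum fun k _ => ?_
    refine (le_abs_self _).trans ?_
    rw [abs_mul, abs_mul]
    exact mul_le_mul_of_nonneg_left (hcov j k) (by positivity)
  have h4 : (∑ j, |z j|) ^ 2 ≤ p * ‖z‖ ^ 2 := by
    have := sq_sum_le_card_mul_sum_sq (s := Finset.univ) (f := fun j => |z j|)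
    simp only [sq_abs, Finset.card_univ, Fintype.card_fin] at this
    rwa [EuclideanSpace.real_norm_sq_eq]
  have h5 := hS z
  have h6 := mul_le_mul_of_nonneg_right h4 hb
  have h7 := mul_le_mul_of_nonneg_left h5 (Nat.cast_nonneg n : (0 : ℝ) ≤ n)
  rw [h2]
  linarith

/-- The two centre bounds cover complementary ranges of `n`; their sum, together with the covariance
deviation at the true centre, gives the constant. -/
lemma exists_bound_of_goodSample {θ κ c : ℝ} (hθ : 0 < θ) (hκ : 0 < κ) (hc : 0 < c) (hc1 : c ≤ 1) :
    ∃ B δ : ℝ, 0 < B ∧ 0 < δ ∧ ∃ N P : ℕ, ∀ {n p : ℕ} {a : Fin n → Vec p} {ν : Fin n → ℝ}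
      {z : Vec p} {S : Mat p}, N ≤ n → P ≤ p → Real.log p ≤ δ * n → GoodSample θ κ c S a ν →
      IsScaledMedian a ν z → (∀ e : Vec p, ∑ j, ∑ k, e j * e k * S j k ≤ 2 / (θ * p) * ‖e‖ ^ 2) →
      ∀ j k, |∑ i, spatialSign (a i - ν i • z) j * spatialSign (a i - ν i • z) k - n * S j k| ≤
        n * (B * Real.sqrt (Real.log p / n) / p) := by
  have hsθ : 0 < Real.sqrt θ := Real.sqrt_pos.2 hθ
  obtain ⟨A, hA1, hA32, hA3, hA34, hA16, hA8⟩ : ∃ A : ℝ, 1 ≤ A ∧ 32 / Real.sqrt θ ≤ A ∧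
      3 / κ ≤ A ∧ 34 / θ ≤ A ∧ 16 / θ ^ 2 ≤ A ∧ Real.sqrt (8 / θ) ≤ A := by
    have e1 : 0 < 32 / Real.sqrt θ := by positivity
    have e2 : 0 < 3 / κ := by positivity
    have e3 : 0 < 34 / θ := by positivity
    have e4 : 0 < 16 / θ ^ 2 := by positivity
    have e5 : 0 ≤ Real.sqrt (8 / θ) := Real.sqrt_nonneg _
    refine ⟨1 + 32 / Real.sqrt θ + 3 / κ + 34 / θ + 16 / θ ^ 2 + Real.sqrt (8 / θ),
      ?_, ?_, ?_, ?_, ?_, ?_⟩ <;> linarith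
  have hA0 : 0 < A := by linarith
  set d := c / 4 with hd
  have hd0 : 0 < d := by positivity
  have hd1 : d ≤ 1 := by linarith
  obtain ⟨B₁, hB₁, H₁⟩ := exists_centre_bound_of_small_radius hd0 hA1
  obtain ⟨B₂, hB₂, H₂⟩ := exists_centre_bound_of_orthogonal hd0 hd1 hA1
  obtain ⟨N₁, hN₁⟩ := exists_mul_log_pow_le 64 3
  -- This makes `8 A n² ε ≤ 1` when `n ≤ 64 log³ p`: the square of `n² ε` is of order `log¹² p · log
  -- p / p`, whence the exponent `13`.
  obtain ⟨P₁, hP₁⟩ := exists_mul_log_pow_le ((8 * A * 64 ^ 2) ^ 2 * 8 / θ) 13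
  obtain ⟨N₂, hN₂⟩ := exists_nat_ge ((48 * A / d) ^ 2)
  obtain ⟨P₂, hP₂⟩ := exists_nat_ge (8 / (θ * d))
  obtain ⟨P₃, hP₃⟩ := exists_nat_ge (Real.exp (64 * A ^ 2 / (κ * d ^ 2)))
  refine ⟨B₁ + B₂ + 32 / θ, (d / (8 * A)) ^ 2, by positivity, by positivity,
    max 32 (max N₁ N₂), max 3 (max P₁ (max P₂ P₃)), ?_⟩
  intro n p a ν z S hnN hpP hδ hG hz hS j k
  simp only [max_le_iff] at hnN hpP
  obtain ⟨hn32, hn1, hn2⟩ := hnN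
  obtain ⟨hp3, hp1, hp2, hp4⟩ := hpP
  have hn : (32 : ℝ) ≤ n := by exact_mod_cast hn32
  have hn0 : (0 : ℝ) < n := by linarith
  have hp : (3 : ℝ) ≤ p := by exact_mod_cast hp3
  have hp0 : (0 : ℝ) < p := by linarith
  set ℓ := Real.log p with hℓ
  have hℓ0 : 0 < ℓ := Real.log_pos (by linarith)
  set s := Real.sqrt (ℓ / n) with hs
  have hs0 : 0 ≤ s := Real.sqrt_nonneg _
  have hs2 : n * s ^ 2 = ℓ := by rw [hs, Real.sq_sqrt (by positivity)]; field_simp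
  have hsδ : s ≤ d / (8 * A) := by
    rw [hs, Real.sqrt_le_left (by positivity), div_le_iff₀ hn0]; exact hδ
  have hAs : A * s ≤ d / 8 := by
    calc A * s ≤ A * (d / (8 * A)) := by gcongr
      _ = d / 8 := by field_simp
  have hs1 : s ≤ 1 := by linarith [le_mul_of_one_le_left hs0 hA1]
  have hlnp : Real.log (n * p) = Real.log n + ℓ := Real.log_mul hn0.ne' hp0.ne'
  have hln0 : 0 < Real.log n := Real.log_pos (by linarith)
  have hL0 : 0 < Real.log (n * p) := by linarith
  have hSjj : ∀ j, S j j ≤ 2 / (θ * p) := fun j => by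
    have := hS (EuclideanSpace.single j 1)
    simpa [Finset.sum_ite_eq, Pi.single_apply] using this
  have hmean : ∀ j, |∑ i, a i j| ≤ n * (A * s / Real.sqrt p) := fun j => by
    refine (hG.mean j).trans ?_
    rw [Real.sqrt_mul hθ.le]
    have e : n * (32 * s) / (Real.sqrt θ * Real.sqrt p) =
      n * (32 / Real.sqrt θ * s / Real.sqrt p) := by field_simp
    rw [e]; gcongr
  have hsq : ∑ i, ν i ^ 2 ≤ n * A := hG.sq.trans (by gcongr)
  have hcol : ∀ j, ∑ i, a i j ^ 2 ≤ n * (A / p) := fun j => by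
    have h1 := le_of_abs_le (hG.cov j j)
    have h2 := mul_le_mul_of_nonneg_left (hSjj j) hn0.le
    have h3 : n * (32 * s) / (θ * p) ≤ n * (32 * 1) / (θ * p) := by gcongr
    have h4 : n * (34 / θ / p) ≤ n * (A / p) := by gcongr
    have e : n * (34 / θ / p) = n * (2 / (θ * p)) + n * (32 * 1) / (θ * p) := by field_simp; norm_num
    simp only [sq]
    linarith
  have hop : ∑ i, inner ℝ (a i) z ^ 2 ≤ n * (d / 2) * ‖z‖ ^ 2 := by
    refine (sum_inner_sq_le (by positivity) hG.cov hS z).trans ?_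
    refine mul_le_mul_of_nonneg_right ?_ (sq_nonneg _)
    have h1 : 2 / (θ * p) ≤ d / 4 := by
      have h2 : 8 / (θ * d) ≤ p := hP₂.trans (by exact_mod_cast hp2)
      rw [div_le_iff₀ (by positivity)] at h2 ⊢
      linarith
    have h3 : 32 / θ * s ≤ d / 4 := by
      have h4 : 32 / θ ≤ A := le_trans (by gcongr; norm_num) hA34
      exact (mul_le_mul_of_nonneg_right h4 hs0).trans (by linarith)
    have e : p * (n * (32 * s) / (θ * p)) = n * (32 / θ * s) := by field_simp
    rw [e]
    linarith [mul_le_mul_of_nonneg_left (add_le_add h1 h3) hn0.le]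
  have hfin : |∑ i, (spatialSign (a i - ν i • z) j * spatialSign (a i - ν i • z) k -
      a i j * a i k)| ≤ n * ((B₁ + B₂) * s / p) →
      |∑ i, spatialSign (a i - ν i • z) j * spatialSign (a i - ν i • z) k - n * S j k| ≤
        n * ((B₁ + B₂ + 32 / θ) * s / p) := fun h => by
    rw [Finset.sum_sub_distrib] at h
    have h1 := abs_sub_le (∑ i, spatialSign (a i - ν i • z) j * spatialSign (a i - ν i • z) k)
      (∑ i, a i j * a i k) (n * S j k)
    have h2 := hG.cov j k
    have e : n * ((B₁ + B₂ + 32 / θ) * s / p) =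
        n * ((B₁ + B₂) * s / p) + n * (32 * s) / (θ * p) := by field_simp
    linarith
  apply hfin
  by_cases hreg : 16 * Real.log (n * p) ^ 2 * ℓ ≤ n
  · have hfour : ∀ j, ∑ i, (p * a i j ^ 2) ^ 2 ≤ n * A := fun j => by
      have h1 := hG.four hreg j
      have e : ∑ i, (θ * p * a i j ^ 2) ^ 2 = θ ^ 2 * ∑ i, (p * a i j ^ 2) ^ 2 := by
        rw [Finset.mul_sum]; exact Finset.sum_congr rfl fun i _ => by ring
      rw [e, ← le_div_iff₀' (by positivity)] at h1
      refine h1.trans ?_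
      calc 16 * n / θ ^ 2 = n * (16 / θ ^ 2) := by ring
        _ ≤ n * A := by gcongr
    -- The square is of order `log(np) · log p / n`. The constants are absorbed by one further
    -- factor `log(np)`, large by the choice of `P₃`, and the regime assumption concludes.
    have hsmall : ∀ i, ν i * (8 / d * (A * s)) ≤ 1 / 2 := fun i => by
      refine le_of_sq_le_sq ?_ (by norm_num)
      have h1 := hG.max_radius i
      have h2 : 64 * A ^ 2 / (κ * d ^ 2) ≤ ℓ := by
        rw [hℓ, Real.le_log_iff_exp_le hp0]
        exact hP₃.trans (by exact_mod_cast hp4)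
      have h3 : 64 * A ^ 2 / (κ * d ^ 2) ≤ Real.log (n * p) := by linarith
      rw [div_le_iff₀ (by positivity)] at h3
      have e : (ν i * (8 / d * (A * s))) ^ 2 =
          (κ * ν i ^ 2) * (64 * A ^ 2) * (n * s ^ 2) / (κ * d ^ 2 * n) := by
        field_simp; ring
      rw [e, hs2, div_le_iff₀ (by positivity)]
      calc κ * ν i ^ 2 * (64 * A ^ 2) * ℓ
          ≤ 4 * Real.log (n * p) * (Real.log (n * p) * (κ * d ^ 2)) * ℓ := by gcongr
        _ = (16 * Real.log (n * p) ^ 2 * ℓ) * (κ * d ^ 2) / 4 := by ring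
        _ ≤ n * (κ * d ^ 2) / 4 := by gcongr
        _ = (1 / 2) ^ 2 * (κ * d ^ 2 * n) := by ring
    refine (H₁ hz (by omega) (by omega) hG.unit hG.pos hs0 hs1 hAs hG.lower hop hmean hsq hcol
      hfour hsmall j k).trans ?_
    gcongr
    linarith
  · push Not at hreg
    -- If `p < n`, the failure of the first regime would give `n < 64 log³ n`, excluded for large
    -- `n`.
    have hnp : (n : ℝ) ≤ p := by
      by_contra! hlt
      have h1 : ℓ ≤ Real.log n := Real.log_le_log hp0 hlt.le
      have h2 := hN₁ n hn1
      have h3 : 16 * Real.log (n * p) ^ 2 * ℓ ≤ 16 * (2 * Real.log n) ^ 2 * Real.log n := by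
        gcongr; linarith
      have e : 16 * (2 * Real.log n) ^ 2 * Real.log n = 64 * Real.log n ^ 3 := by ring
      linarith
    have hlog2 : Real.log (n * p) ≤ 2 * ℓ := by
      have := Real.log_le_log hn0 hnp
      linarith
    have hn64 : (n : ℝ) ≤ 64 * ℓ ^ 3 := by
      have h3 : 16 * Real.log (n * p) ^ 2 * ℓ ≤ 16 * (2 * ℓ) ^ 2 * ℓ := by gcongr
      have e : 16 * (2 * ℓ) ^ 2 * ℓ = 64 * ℓ ^ 3 := by ring
      linarith
    set ε := Real.sqrt (8 * ℓ / (θ * p)) with hε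
    have hε0 : 0 ≤ ε := Real.sqrt_nonneg _
    have hNN : Real.sqrt n ^ 2 = n := Real.sq_sqrt hn0.le
    have hN0 : 0 < Real.sqrt n := Real.sqrt_pos.2 hn0
    have hcoord : ∀ i j, |a i j| ≤ A * (Real.sqrt n * s) / Real.sqrt p := fun i j => by
      have h1 := hG.max_coord i j
      have h2 : |a i j| ≤ Real.sqrt (8 / θ) * (Real.sqrt n * s) / Real.sqrt p := by
        refine le_of_sq_le_sq ?_ (by positivity)
        rw [sq_abs, div_pow, mul_pow, mul_pow, hNN, hs2, Real.sq_sqrt (by positivity),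
          Real.sq_sqrt hp0.le, le_div_iff₀ hp0, div_mul_eq_mul_div, le_div_iff₀ hθ]
        linarith
      exact h2.trans (by gcongr)
    have horth : ∀ i l, i ≠ l → |inner ℝ (a i) (a l)| ≤ ε := fun i l hil => by
      refine Real.abs_le_sqrt ?_
      have h1 := hG.orth i l hil
      rw [le_div_iff₀ (by positivity)]
      linarith
    have hkey : 8 * A * (n ^ 2 * ε) ≤ 1 := by
      have h1 : n ^ 2 * ε ≤ (64 * ℓ ^ 3) ^ 2 * ε := by gcongr
      have h2 : (8 * A * ((64 * ℓ ^ 3) ^ 2 * ε)) ^ 2 ≤ 1 ^ 2 := by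
        have h3 := hP₁ p hp1
        rw [mul_pow, mul_pow ((64 * ℓ ^ 3) ^ 2), hε, Real.sq_sqrt (by positivity)]
        have e : (8 * A) ^ 2 * (((64 * ℓ ^ 3) ^ 2) ^ 2 * (8 * ℓ / (θ * p))) =
          ((8 * A * 64 ^ 2) ^ 2 * 8 / θ * ℓ ^ 13) / p := by field_simp
        rw [e, one_pow, div_le_one hp0]
        exact h3
      have h4 := le_of_sq_le_sq h2 zero_le_one
      have h5 := mul_le_mul_of_nonneg_left h1 (by positivity : 0 ≤ 8 * A)
      linarith
    have hn2ε : 0 ≤ n ^ 2 * ε := by positivity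
    have hn2ε1 : n ^ 2 * ε ≤ 1 / 8 := by
      linarith [le_mul_of_one_le_left hn2ε hA1]
    have hq : 12 / (d * Real.sqrt n) * A ≤ 1 / 4 := by
      have h1 : 48 * A / d ≤ Real.sqrt n :=
        Real.le_sqrt_of_sq_le (hN₂.trans (by exact_mod_cast hn2))
      rw [div_le_iff₀ hd0] at h1
      rw [div_mul_eq_mul_div, div_le_iff₀ (by positivity)]
      linarith
    have hq0 : 0 < 12 / (d * Real.sqrt n) := by positivity
    have hq1 : 12 / (d * Real.sqrt n) ≤ 1 := by
      linarith [le_mul_of_one_le_right hq0.le hA1]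
    have hεn : n * ε ≤ n ^ 2 * ε :=
      mul_le_mul_of_nonneg_right (le_self_pow₀ (by linarith) two_ne_zero) hε0
    have hεε : ε ≤ n * ε := le_mul_of_one_le_left hε0 (by linarith)
    refine (H₂ hz hn32 (by omega) hG.unit hG.pos hs0 hs1 hG.lower hop hmean hsq hcol hcoord hε0
      horth hq1 (by linarith) (by linarith) ?_ j k).trans ?_
    · have e1 : n * A * (12 / (d * Real.sqrt n)) = n * (12 / (d * Real.sqrt n) * A) := by ring
      have e2 : 4 * n ^ 2 * A * (12 / (d * Real.sqrt n)) * ε =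
        4 * (12 / (d * Real.sqrt n) * A) * (n ^ 2 * ε) := by ring
      rw [e1, e2]
      have h1 : n * (12 / (d * Real.sqrt n) * A) ≤ n * (1 / 4) := by gcongr
      have h2 : 4 * (12 / (d * Real.sqrt n) * A) * (n ^ 2 * ε) ≤ 4 * (1 / 4) * (n ^ 2 * ε) := by
        gcongr
      linarith
    · gcongr
      linarith

end SCLIME

end

noncomputable section

namespace SCLIME

/-! ### The elliptical model is a sign model -/

section Elliptical

lemma integrable_and_integral_le_of_lintegral_le {α : Type*} [MeasurableSpace α] {L : Measure α}
    {f : α → ℝ} (hm : Measurable f) (h0 : ∀ x, 0 ≤ f x) {b : ℝ} (hb : 0 ≤ b)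
    (h : ∫⁻ x, ENNReal.ofReal (f x) ∂L ≤ ENNReal.ofReal b) : Integrable f L ∧ ∫ x, f x ∂L ≤ b := by
  refine ⟨(lintegral_ofReal_ne_top_iff_integrable hm.aestronglyMeasurable
    (Filter.Eventually.of_forall h0)).1 (ne_top_of_le_ne_top ENNReal.ofReal_ne_top h), ?_⟩
  rw [integral_eq_lintegral_of_nonneg_ae (Filter.Eventually.of_forall h0) hm.aestronglyMeasurable]
  exact ENNReal.toReal_le_of_le_ofReal hb h

/-- The pointwise bound `ν ≤ s min(ν, 1) + ν² / s` is integrated with `E ν = 1` and `E ν² ≤ 2 K² ≤ s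
/ 2`: a variable of mean one with bounded second moment cannot have a negligible truncation. -/
lemma le_integral_min_invRadius {p : ℕ} {μ : Vec p} {L : Measure (Vec p)} [IsProbabilityMeasure L]
    {K : ℝ} (hK : 0 < K) (h0 : zetaMom L μ 1 ≠ 0) (ht : zetaMom L μ 1 ≠ ∞)
    (h : psi2Norm (invRadius L μ) L ≤ ENNReal.ofReal K) :
    1 / (2 * max (4 * K ^ 2) 1) ≤ ∫ x, min (invRadius L μ x) 1 ∂L := by
  set s := max (4 * K ^ 2) 1 with hs
  have hs1 : 1 ≤ s := le_max_right _ _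
  have hs4 : 4 * K ^ 2 ≤ s := le_max_left _ _
  have hs0 : 0 < s := by linarith
  have hmν : Measurable (invRadius L μ) := measurable_invRadius
  have i1 := integrable_and_integral_le_of_lintegral_le hmν invRadius_nonneg zero_le_one
    (by rw [lintegral_invRadius h0 ht]; simp)
  have e1 : ∫ x, invRadius L μ x ∂L = 1 := by
    rw [integral_eq_lintegral_of_nonneg_ae (Filter.Eventually.of_forall invRadius_nonneg)
      hmν.aestronglyMeasurable, lintegral_invRadius h0 ht, ENNReal.toReal_one]
  have i2 := integrable_and_integral_le_of_lintegral_le (f := fun x => invRadius L μ x ^ 2)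
    (b := 2 * K ^ 2) (hmν.pow_const 2) (fun x => sq_nonneg _) (by positivity)
    (by simpa using lintegral_invRadius_pow_le hK h le_rfl)
  have im : Integrable (fun x => min (invRadius L μ x) 1) L := by
    refine Integrable.of_bound (C := 1) (by fun_prop) (Filter.Eventually.of_forall fun x => ?_)
    rw [Real.norm_of_nonneg (le_min (invRadius_nonneg x) zero_le_one)]
    exact min_le_right _ _
  have hle : ∫ x, invRadius L μ x ∂L ≤
      ∫ x, (s * min (invRadius L μ x) 1 + invRadius L μ x ^ 2 / s) ∂L := by
    refine integral_mono i1.1 ((im.const_mul s).add (i2.1.div_const s)) fun x => ?_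
    have hν := invRadius_nonneg (L := L) (μ := μ) x
    set t := invRadius L μ x
    change t ≤ s * min t 1 + t ^ 2 / s
    rcases le_total t 1 with h | h
    · rw [min_eq_left h]
      have : 0 ≤ t ^ 2 / s := by positivity
      nlinarith
    · rw [min_eq_right h, mul_one, ← sub_le_iff_le_add', le_div_iff₀ hs0]
      nlinarith [sq_nonneg (t - s), sq_nonneg t]
  rw [integral_add (im.const_mul s) (i2.1.div_const s), integral_const_mul, integral_div, e1] at hle
  have h3 : (∫ x, invRadius L μ x ^ 2 ∂L) / s ≤ 1 / 2 := by
    rw [div_le_iff₀ hs0]; linarith [i2.2]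
  rw [div_le_iff₀ (by positivity)]
  linarith

variable {p : ℕ} {μ : Vec p} {Sig : Mat p} {ρ : Measure ℝ} {η K : ℝ}

lemma signModel_ellipticalLaw (hp : 0 < p) [IsProbabilityMeasure ρ] (hη : 0 < η) (hK : 0 < K)
    (hS : Sig.PosDef)
    (heig : ∀ i, η < hS.isHermitian.eigenvalues i ∧ hS.isHermitian.eigenvalues i < 1 / η)
    (h0 : zetaMom (ellipticalLaw μ Sig ρ) μ 1 ≠ 0) (ht : zetaMom (ellipticalLaw μ Sig ρ) μ 1 ≠ ∞)
    (h : psi2Norm (invRadius (ellipticalLaw μ Sig ρ) μ) (ellipticalLaw μ Sig ρ) ≤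
      ENNReal.ofReal K) :
    SignModel (η ^ 2 / 4) (1 / (4 * Real.exp 1 * K ^ 2)) (1 / (2 * max (4 * K ^ 2) 1))
      (ellipticalLaw μ Sig ρ) (fun x => spatialSign (x - μ))
      (invRadius (ellipticalLaw μ Sig ρ) μ) := by
  have := isProbabilityMeasure_ellipticalLaw (μ := μ) (Sig := Sig) (ρ := ρ) hp
  have hne := ae_ne_of_zetaMom_ne_top ht
  have hmν : Measurable (invRadius (ellipticalLaw μ Sig ρ) μ) := measurable_invRadius
  have hexp := integrable_and_integral_le_of_lintegral_le (L := ellipticalLaw μ Sig ρ)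
    (f := fun x => Real.exp (1 / (4 * Real.exp 1 * K ^ 2) *
      invRadius (ellipticalLaw μ Sig ρ) μ x ^ 2)) (b := 2)
    (by fun_prop) (fun x => (Real.exp_pos _).le) zero_le_two
    (by simpa using lintegral_exp_invRadius_sq_le hK h)
  refine ⟨measurable_spatialSign.comp (measurable_id.sub_const μ), hmν, ?_, ?_,
    fun x => norm_spatialSign_le _, fun e he => ?_, fun e => integral_inner_spatialSign hp e,
    hexp.1, hexp.2, le_integral_min_invRadius hK h0 ht h⟩
  · filter_upwards [hne] with x hx using norm_spatialSign (sub_ne_zero.2 hx)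
  · filter_upwards [hne] with x hx
    have h1 : 0 < ‖x - μ‖ := norm_pos_iff.2 (sub_ne_zero.2 hx)
    have h2 : 0 < (zetaMom (ellipticalLaw μ Sig ρ) μ 1).toReal := ENNReal.toReal_pos h0 ht
    unfold invRadius
    positivity
  · exact integral_exp_inner_spatialSign_sq hS heig hp hη hne he

end Elliptical

/-- The quadratic form is the second moment of a projection, and `x ≤ exp x` bounds it. Thus the
population matrix has operator norm of order `1 / p`, as the consistency of the median requires. -/
lemma SignModel.sum_mul_le {α : Type*} [MeasurableSpace α] {L : Measure α} [IsProbabilityMeasure L]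
    {p : ℕ} {θ κ c : ℝ} {a : α → Vec p} {ν : α → ℝ} (h : SignModel θ κ c L a ν) (hθ : 0 < θ)
    (hp : 0 < p) (e : Vec p) :
    ∑ j, ∑ k, e j * e k * ∫ y, a y j * a y k ∂L ≤ 2 / (θ * p) * ‖e‖ ^ 2 := by
  have hp' : (0 : ℝ) < p := by exact_mod_cast hp
  have hma := h.meas_a
  have hint : ∀ j k, Integrable (fun y => a y j * a y k) L := fun j k => by
    refine Integrable.of_bound (C := 1) (by fun_prop) (Filter.Eventually.of_forall fun y => ?_)
    rw [norm_mul]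
    exact mul_le_one₀ ((PiLp.norm_apply_le (a y) j).trans (h.le_one y)) (norm_nonneg _)
      ((PiLp.norm_apply_le (a y) k).trans (h.le_one y))
  have e1 : ∑ j, ∑ k, e j * e k * ∫ y, a y j * a y k ∂L = ∫ y, inner ℝ e (a y) ^ 2 ∂L := by
    have h1 : ∀ y, inner ℝ e (a y) ^ 2 = ∑ j, ∑ k, e j * e k * (a y j * a y k) := fun y => by
      have : inner ℝ e (a y) = ∑ j, e j * a y j := by simp [PiLp.inner_apply, mul_comm]
      rw [this, sq, Finset.sum_mul_sum]
      exact Finset.sum_congr rfl fun j _ => Finset.sum_congr rfl fun k _ => by ring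
    simp only [h1]
    rw [integral_finsetSum _ fun j _ => integrable_finsetSum _ fun k _ => (hint j k).const_mul _]
    refine Finset.sum_congr rfl fun j _ => ?_
    rw [integral_finsetSum _ fun k _ => (hint j k).const_mul _]
    exact Finset.sum_congr rfl fun k _ => (integral_const_mul _ _).symm
  rw [e1]
  rcases eq_or_ne e 0 with rfl | he
  · simp
  have hn : 0 < ‖e‖ := norm_pos_iff.2 he
  have hu : ‖‖e‖⁻¹ • e‖ ≤ 1 := by simp [norm_smul, hn.ne']
  have h2 : ∀ y, inner ℝ e (a y) ^ 2 ≤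
      ‖e‖ ^ 2 / (θ * p) * Real.exp (θ * p * inner ℝ (‖e‖⁻¹ • e) (a y) ^ 2) := fun y => by
    rw [div_mul_eq_mul_div, le_div_iff₀ (by positivity)]
    have h3 := Real.add_one_le_exp (θ * p * inner ℝ (‖e‖⁻¹ • e) (a y) ^ 2)
    have h4 : inner ℝ e (a y) ^ 2 * (θ * p) =
        ‖e‖ ^ 2 * (θ * p * inner ℝ (‖e‖⁻¹ • e) (a y) ^ 2) := by
      rw [real_inner_smul_left]; field_simp
    rw [h4]
    exact mul_le_mul_of_nonneg_left (by linarith) (sq_nonneg _)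
  have h5 := h.integrable_exp hθ hu
  have h6 : Integrable (fun y => inner ℝ e (a y) ^ 2) L :=
    (h5.const_mul (‖e‖ ^ 2 / (θ * p))).mono' (by fun_prop) (Filter.Eventually.of_forall fun y => by
      rw [Real.norm_of_nonneg (sq_nonneg _)]; exact h2 y)
  refine (integral_mono h6 (h5.const_mul _) h2).trans ?_
  rw [integral_const_mul]
  calc ‖e‖ ^ 2 / (θ * p) * ∫ y, Real.exp (θ * p * inner ℝ (‖e‖⁻¹ • e) (a y) ^ 2) ∂L
      ≤ ‖e‖ ^ 2 / (θ * p) * 2 := by gcongr; exact h.exp_a _ hu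
    _ = _ := by ring

/-! ### Concentration of the sample spatial-sign covariance matrix -/

/-- The bound for typical samples, translated back to spatial medians of the original observations.
The constants and thresholds depend on `η` and `K` only. -/
lemma exists_sampleSSCM_bound {η K : ℝ} (hη : 0 < η) (hK : 0 < K) :
    ∃ B δ : ℝ, 0 < B ∧ 0 < δ ∧ ∃ N P : ℕ, ∀ {n p : ℕ} {μ : Vec p} {Sig : Mat p} {ρ : Measure ℝ}
      [IsProbabilityMeasure ρ] (hS : Sig.PosDef), N ≤ n → P ≤ p → Real.log p ≤ δ * n →
      (∀ i, η < hS.isHermitian.eigenvalues i ∧ hS.isHermitian.eigenvalues i < 1 / η) →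
      zetaMom (ellipticalLaw μ Sig ρ) μ 1 ≠ 0 → zetaMom (ellipticalLaw μ Sig ρ) μ 1 ≠ ∞ →
      psi2Norm (invRadius (ellipticalLaw μ Sig ρ) μ) (ellipticalLaw μ Sig ρ) ≤ ENNReal.ofReal K →
      (sampleLaw (ellipticalLaw μ Sig ρ) n).real {x | ¬∀ m, IsSpatialMedian x m → ∀ j k,
        |(p : ℝ) * sampleSSCM x m j k - p * popSSCM (ellipticalLaw μ Sig ρ) μ j k| ≤
          B * Real.sqrt (Real.log p / n)} ≤ 16 / (p : ℝ) ^ 3 := by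
  set θ := η ^ 2 / 4 with hθ
  set κ := 1 / (4 * Real.exp 1 * K ^ 2) with hκ
  set c := 1 / (2 * max (4 * K ^ 2) 1) with hc
  have hmax : 1 ≤ max (4 * K ^ 2) 1 := le_max_right _ _
  have hθ0 : 0 < θ := by positivity
  have hκ0 : 0 < κ := by positivity
  have hc0 : 0 < c := by positivity
  have hc1 : c ≤ 1 := by rw [hc, div_le_one (by positivity)]; linarith
  obtain ⟨B, δ, hB, hδ, N, P, H⟩ := exists_bound_of_goodSample hθ0 hκ0 hc0 hc1
  refine ⟨B, min δ (c / 32), hB, lt_min hδ (by positivity), max 1 N, max 2 P, ?_⟩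
  intro n p μ Sig ρ _ hS hn hp hlog heig h0 ht hpsi
  simp only [max_le_iff] at hn hp
  have hn0 : (0 : ℝ) < n := by exact_mod_cast hn.1
  have hp0 : (0 : ℝ) < p := by exact_mod_cast (by omega : 0 < p)
  have hM := signModel_ellipticalLaw (μ := μ) (ρ := ρ) (by omega) hη hK hS heig h0 ht hpsi
  have := isProbabilityMeasure_ellipticalLaw (μ := μ) (Sig := Sig) (ρ := ρ) (by omega)
  have hl1 : Real.log p ≤ δ * n := hlog.trans (by gcongr; exact min_le_left _ _)
  have hl2 : Real.log p ≤ n * (c / 32) := by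
    rw [mul_comm]; exact hlog.trans (by gcongr; exact min_le_right _ _)
  have hbad := hM.measureReal_not_goodSample_le (n := n) hθ0 hκ0 hc1 hn.1 hp.1 hl2
  refine (measureReal_mono ?_).trans hbad
  intro x hx hG
  refine hx fun m hm j k => ?_
  set L := ellipticalLaw μ Sig ρ with hL
  have hxμ : ∀ i, x i ≠ μ := fun i hi => by
    have := hG.unit i
    simp [hi, spatialSign] at this
  have hz0 : 0 < (zetaMom L μ 1).toReal := ENNReal.toReal_pos h0 ht
  have hz := hm.isScaledMedian hz0 hxμ
  have h1 := H hn.2 hp.2 hl1 hG hz (fun e => hM.sum_mul_le hθ0 (by omega) e) j k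
  have hsign : ∀ i, spatialSign (x i - m) = spatialSign (spatialSign (x i - μ) -
      invRadius L μ (x i) • ((zetaMom L μ 1).toReal • (m - μ))) := fun i => by
    have hpos : 0 < ‖x i - μ‖ := norm_pos_iff.2 (sub_ne_zero.2 (hxμ i))
    rw [sub_eq_smul_scaled (m := m) hz0 (hxμ i), spatialSign_smul_of_pos (by positivity)]
    rfl
  have e : (p : ℝ) * sampleSSCM x m j k - p * popSSCM L μ j k = p / n *
      (∑ i, spatialSign (x i - m) j * spatialSign (x i - m) k - n * popSSCM L μ j k) := by
    simp only [sampleSSCM, Matrix.of_apply]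
    field_simp
  rw [e, abs_mul, abs_of_pos (by positivity)]
  simp only [hsign]
  calc _ ≤ p / n * (n * (B * Real.sqrt (Real.log p / n) / p)) := by gcongr; exact h1
    _ = _ := by field_simp

end SCLIME

end

noncomputable section

namespace SCLIME

/-! ### Choice of the constants -/

/-- Bounds indexed by the maximum of two levels are dominated by a product of functions of the
single levels. -/
lemma exists_product_majorant (B δ : ℕ → ℝ) (hB : ∀ m, 0 < B m) (hδ : ∀ m, 0 < δ m) :
    ∃ H : ℕ → ℝ, (∀ m, 1 ≤ H m) ∧ (∀ k l, B (max k l) ≤ H k * H l) ∧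
      ∀ k l, 1 ≤ H k * H l * Real.sqrt (δ (max k l)) := by
  -- A value at the larger of two levels is the value at one of them, and the other factor is at
  -- least `1`; hence `H (max k l) ≤ H k * H l`.
  let H : ℕ → ℝ := fun m => 1 + ∑ i ∈ Finset.range (m + 1), (B i + 1 / Real.sqrt (δ i))
  have hs : ∀ m, 0 < Real.sqrt (δ m) := fun m => Real.sqrt_pos.2 (hδ m)
  have ht : ∀ i, 0 ≤ B i + 1 / Real.sqrt (δ i) := fun i =>
    add_nonneg (hB i).le (one_div_pos.2 (hs i)).le
  have h1 : ∀ m, 1 ≤ H m := fun m => le_add_of_nonneg_right (Finset.sum_nonneg fun i _ => ht i)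
  have hself : ∀ m, B m + 1 / Real.sqrt (δ m) ≤ H m := fun m => by
    have := Finset.single_le_sum (f := fun i => B i + 1 / Real.sqrt (δ i)) (fun i _ => ht i)
      (Finset.mem_range.2 (Nat.lt_succ_self m))
    simp only [H]
    linarith
  have hprod : ∀ k l, H (max k l) ≤ H k * H l := fun k l => by
    rcases max_choice k l with h | h <;> rw [h]
    · exact le_mul_of_one_le_right (by linarith [h1 k]) (h1 l)
    · exact le_mul_of_one_le_left (by linarith [h1 l]) (h1 k)
  refine ⟨H, h1, fun k l => ?_, fun k l => ?_⟩
  · have h2 := hself (max k l)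
    have h3 : 0 < 1 / Real.sqrt (δ (max k l)) := one_div_pos.2 (hs _)
    linarith [hprod k l]
  · have h2 := hself (max k l)
    have h3 : 1 / Real.sqrt (δ (max k l)) ≤ H k * H l := by
      linarith [hprod k l, hB (max k l)]
    rwa [div_le_iff₀ (hs _)] at h3

/-- The rate contains the product `C C'`, the only place where constants depending on `K` and on `η`
interact. -/
lemma rate_ge {C C' η : ℝ} (hC : 0 < C) (hη : 0 < η) (hC' : 0 < C') (n p : ℕ) :
    C * C' * Real.sqrt (Real.log p / n) + C' / Real.sqrt p ≤ rate C C' η n p := by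
  unfold rate
  have h1 : 1 ≤ Real.sqrt 2 := Real.one_le_sqrt.2 one_le_two
  have h2 : C' ≤ (8 + η ^ 2 * C') / η ^ 2 := by
    rw [le_div_iff₀ (by positivity)]; linarith
  have h3 : C * C' ≤ Real.sqrt 2 * C * (8 + η ^ 2 * C') / η ^ 2 := by
    rw [mul_div_assoc]
    have : C ≤ Real.sqrt 2 * C := le_mul_of_one_le_left hC.le h1
    gcongr
  gcongr

end SCLIME

end

/-! ### Assembly of the theorem -/

theorem theorem1 :
    ∃ (C' : (c₀ η T M : ℝ) → ℝ) (C : (ζ ψ K : ℝ) → ℝ),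
      ∀ c₀ η T M ζ ψ K : ℝ, 0 < c₀ → 0 < η → 0 < T → 0 < M → 0 < ζ → 0 < ψ → 0 < K →
        0 < C' c₀ η T M ∧ 0 < C ζ ψ K ∧
        ∃ N P : ℕ, ∀ n p : ℕ, N ≤ n → P ≤ p → (3 * Real.log p) ^ (1 / 3 : ℝ) < n →
          ∀ (q s₀ : ℝ), 0 ≤ q → q < 1 → 0 < s₀ →
          ∀ (μ : SCLIME.Vec p) (Sig : SCLIME.Mat p) (ρ : MeasureTheory.Measure ℝ),
            SCLIME.RadialLaw p ρ →
            SCLIME.SparseCond T q s₀ (SCLIME.precision Sig) →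
            SCLIME.CovCond c₀ η M Sig →
            SCLIME.RadiusCond ζ ψ K (SCLIME.ellipticalLaw μ Sig ρ) μ →
          ∀ (Ω : Type*) [MeasurableSpace Ω] (Q : MeasureTheory.Measure Ω)
            [MeasureTheory.IsProbabilityMeasure Q] (X : Fin n → Ω → SCLIME.Vec p),
            ProbabilityTheory.iIndepFun X Q →
            (∀ i, ProbabilityTheory.HasLaw (X i) (SCLIME.ellipticalLaw μ Sig ρ) Q) →
            ∃ A : Set Ω, MeasurableSet A ∧ 1 - 2 / (p : ℝ) ^ 2 < Q.real A ∧
              ∀ ω ∈ A,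
                (∃ V, SCLIME.IsSCLIME (fun i => X i ω)
                  (T * SCLIME.rate (C ζ ψ K) (C' c₀ η T M) η n p) V) ∧
                ∀ V, SCLIME.IsSCLIME (fun i => X i ω)
                  (T * SCLIME.rate (C ζ ψ K) (C' c₀ η T M) η n p) V →
                  SCLIME.ErrorBounds T q s₀ (SCLIME.rate (C ζ ψ K) (C' c₀ η T M) η n p)
                    V (SCLIME.precision Sig) := by
  -- Level `m` stands for the parameters `η = 1 / (m + 1)` and `K = m + 1`, so raising the level
  -- weakens both assumptions.
  have lvl : ∀ m : ℕ, (0 : ℝ) < 1 / (m + 1) ∧ (0 : ℝ) < m + 1 := fun m =>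
    ⟨Nat.one_div_pos_of_nat, Nat.cast_add_one_pos m⟩
  choose B δ hB hδ N P hbound using fun m : ℕ =>
    SCLIME.exists_sampleSSCM_bound (lvl m).1 (lvl m).2
  obtain ⟨H, hH1, hHB, hHδ⟩ := SCLIME.exists_product_majorant B δ hB hδ
  -- In `C'` the summand `1` serves the concentration bound, `1 / T` makes `T R ≥ 1` when `log p > δ
  -- n`, and `64 / η⁴` dominates the bias.
  refine ⟨fun _ η T _ => H ⌈1 / η⌉₊ * (1 + 1 / T) + 64 / η ^ 4, fun _ _ K => H ⌈K⌉₊, ?_⟩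
  intro c₀ η T M ζ ψ K hc₀ hη hT hM hζ hψ hK
  dsimp only
  have hH0 : ∀ m, 0 < H m := fun m => zero_lt_one.trans_le (hH1 m)
  set C := H ⌈K⌉₊ with hC
  set C' := H ⌈1 / η⌉₊ * (1 + 1 / T) + 64 / η ^ 4 with hC'
  have hC0 : 0 < C := hH0 _
  have hη0 := hH0 ⌈1 / η⌉₊
  have hC'0 : 0 < C' := by positivity
  refine ⟨hC'0, hC0, ?_⟩
  set m := max ⌈1 / η⌉₊ ⌈K⌉₊ with hm
  refine ⟨max 1 (N m), max 9 (P m), ?_⟩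
  intro n p hn hp _ q s₀ hq0 hq1 hs₀ μ Sig ρ hρ hsp hcov hrad Ω _ Q _ X hind hlaw
  simp only [max_le_iff] at hn hp
  have hn0 : (0 : ℝ) < n := by exact_mod_cast hn.1
  have hp9 : (9 : ℝ) ≤ p := by exact_mod_cast hp.1
  have hp0 : (0 : ℝ) < p := by linarith
  have hp1 : 0 < p := by omega
  have := hρ.prob
  set r := Real.sqrt (Real.log p / n) with hr
  set R := SCLIME.rate C C' η n p with hR
  have hRge : C * C' * r + C' / Real.sqrt p ≤ R := SCLIME.rate_ge hC0 hη hC'0 n p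
  have hR0 : 0 < R := lt_of_lt_of_le (by positivity) hRge
  have hbounds := fun x : Fin n → SCLIME.Vec p => SCLIME.sclime_bounds (R := R) hn.1 hp1 hT hR0
    hs₀ hq0 hq1 hcov.posDef hsp x
  have hprod : H ⌈1 / η⌉₊ * C * (1 + 1 / T) ≤ C * C' := by
    have : 0 < C * (64 / η ^ 4) := by positivity
    rw [hC']
    linarith
  by_cases hlog : Real.log p ≤ δ m * n
  -- The strict inequality for `k = 1` forces the first inverse moment to be both nonzero and
  -- finite.
  · have hz1 := hrad.moments 1 (by simp)
    rw [pow_one] at hz1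
    have hz0 : SCLIME.zetaMom (SCLIME.ellipticalLaw μ Sig ρ) μ 1 ≠ 0 := fun h => by
      simp [h] at hz1
    have hmη : 1 / η ≤ m := (Nat.le_ceil _).trans (by exact_mod_cast le_max_left _ _)
    have hmK : K ≤ m := (Nat.le_ceil _).trans (by exact_mod_cast le_max_right _ _)
    have hle : 1 / ((m : ℝ) + 1) ≤ η := by
      rw [div_le_comm₀ (by positivity) hη]; linarith
    have heig : ∀ i, 1 / ((m : ℝ) + 1) < hcov.posDef.isHermitian.eigenvalues i ∧
        hcov.posDef.isHermitian.eigenvalues i < 1 / (1 / ((m : ℝ) + 1)) := fun i =>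
      ⟨hle.trans_lt (hcov.eig i).1, (hcov.eig i).2.trans_le
        (one_div_le_one_div_of_le (lvl m).1 hle)⟩
    have hprob := hbound m (μ := μ) (ρ := ρ) hcov.posDef hn.2 hp.2 hlog heig hz0 hz1.ne_top
      (hrad.subGaussian.trans (ENNReal.ofReal_le_ofReal (by linarith)))
    set L := SCLIME.ellipticalLaw μ Sig ρ with hL
    have := SCLIME.isProbabilityMeasure_ellipticalLaw (μ := μ) (Sig := Sig) (ρ := ρ) hp1
    set bad : Set (Fin n → SCLIME.Vec p) := {x | ¬∀ y, SCLIME.IsSpatialMedian x y → ∀ j k,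
      |(p : ℝ) * SCLIME.sampleSSCM x y j k - p * SCLIME.popSSCM L μ j k| ≤ B m * r} with hbad
    have hX := iIndepFun.hasLaw_pi hlaw hind
    have hQ : Q.real ((fun ω i => X i ω) ⁻¹' bad) ≤ 16 / (p : ℝ) ^ 3 := by
      refine le_trans (ENNReal.toReal_mono (measure_ne_top _ _)
        (Measure.le_map_apply hX.aemeasurable bad)) ?_
      rw [hX.map_eq]
      exact hprob
    -- The bad set quantifies over all medians and need not be measurable, so a measurable superset
    -- of equal measure is removed.
    refine ⟨(toMeasurable Q ((fun ω i => X i ω) ⁻¹' bad))ᶜ, (measurableSet_toMeasurable _ _).compl,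
      ?_, fun ω hω => hbounds _ (Or.inr fun y hy i j => ?_)⟩
    · rw [probReal_compl_eq_one_sub (measurableSet_toMeasurable _ _), measureReal_def,
        measure_toMeasurable, ← measureReal_def]
      -- Strict because `p ≥ 9 > 8`; this is the origin of the threshold `9`.
      have h1 : 16 / (p : ℝ) ^ 3 < 2 / (p : ℝ) ^ 2 := by
        rw [div_lt_div_iff₀ (by positivity) (by positivity)]
        have : 0 < (p : ℝ) ^ 2 := by positivity
        nlinarith
      linarith
    · have hgood : (fun i => X i ω) ∉ bad := fun h => hω (subset_toMeasurable _ _ h)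
      simp only [hbad, Set.mem_ofPred_eq, not_not] at hgood
      have h1 := hgood y hy i j
      have h2 := SCLIME.abs_popSSCM_sub_shape_le hcov.posDef hcov.eig hp1 hη
        (SCLIME.ae_ne_of_zetaMom_ne_top hz1.ne_top) i j
      have h3 := abs_sub_le ((p : ℝ) * SCLIME.sampleSSCM (fun i => X i ω) y i j)
        (p * SCLIME.popSSCM L μ i j) (SCLIME.shape Sig i j)
      have h4 : B m * r ≤ C * C' * r := by
        have h5 : H ⌈1 / η⌉₊ * C ≤ C * C' := by
          refine le_trans (le_mul_of_one_le_right (by positivity) ?_) hprod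
          have : 0 < 1 / T := by positivity
          linarith
        have h6 : B m ≤ C * C' := (hHB _ _).trans h5
        gcongr
      have h7 : 64 / η ^ 4 / Real.sqrt p ≤ C' / Real.sqrt p := by
        have : 0 < H ⌈1 / η⌉₊ * (1 + 1 / T) := by positivity
        gcongr
        linarith
      linarith
  -- Here `√(log p / n)` is at least `√δ`, so `T R ≥ 1` and the whole space can serve as the event.
  · push Not at hlog
    refine ⟨Set.univ, MeasurableSet.univ, ?_, fun ω _ => hbounds _ (Or.inl ?_)⟩
    · rw [probReal_univ]
      have : 0 < 2 / (p : ℝ) ^ 2 := by positivity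
      linarith
    · have h1 : Real.sqrt (δ m) ≤ r := Real.sqrt_le_sqrt (by rw [le_div_iff₀ hn0]; exact hlog.le)
      have h2 : 1 ≤ H ⌈1 / η⌉₊ * C * r := (hHδ _ _).trans (by gcongr)
      have h3 : H ⌈1 / η⌉₊ * C * (1 / T) ≤ C * C' := by
        refine le_trans ?_ hprod
        gcongr
        linarith
      have h4 : 0 < C' / Real.sqrt p := by positivity
      calc 1 ≤ H ⌈1 / η⌉₊ * C * r := h2
        _ = T * (H ⌈1 / η⌉₊ * C * (1 / T) * r) := by field_simp
        _ ≤ T * (C * C' * r) := by gcongr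
        _ ≤ T * R := by gcongr; linarith
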